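/- **Setting.** In stochastic online sorting, $n$ items $x_1,\dots,x_n$, independent and uniform on $[0,1]$, arrive one at a time, and each must be placed immediately and irrevocably into an empty cell of an array $A$ with $n$ cells. The cost is $\sum_{i=1}^{n-1}|A[i+1]-A[i]|$, and the competitive ratio is the cost divided by the least cost of any arrangement of the same items. **Algorithm.** Let $B=B(n)$ be a function with $B(n)=\Theta(\log n)$. The algorithm $\mathrm{AlgAdapt}$ on $n$ cells is as follows. If it is not the case that $1<B\le n/\log^5 n$ (or if $n\le 3$), fill the array from left to right. Otherwise divide $[0,1]$ into $B$ segments $[(i-1)/B,i/B]$, $1\le i\le B$; initially the whole array is the *pool*. The algorithm runs in phases $j=1,2,\dots$. Let $n_j$ be the number of future items at the start of phase $j$ (so $n_1=n$), and let $m_j=\lceil n_j/B-\frac12(n_j/B)^{2/3}\rceil$. At the start of phase $j$, a prefix of the current pool is partitioned into $B$ new buffers, in the order of their segments: the buffer of segment $i$ has size $m_j-c_i$, where $c_i$ is the current total number of empty cells in the older buffers of segment $i$. The pool becomes the rest of the old pool. If it now has fewer than $B\log^5 n$ cells, phase $j$ is the last phase and the pool is the *final pool*. An arriving item of segment $i$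 goes to the oldest non-full buffer of segment $i$; within a buffer of size $m$, the cell is chosen by $\mathrm{AlgAdapt}$ on $m$ cells, with $B(m)$ segments, applied to the items of that buffer rescaled from segment $i$ to $[0,1]$. A phase other than the last one ends as soon as all buffers of some segment are full, and then the next phase starts. In the last phase, an item whose segment has no empty buffer cell goes to the first empty cell of the final pool. The algorithm *fails* if (1) when phase $j+1$ is about to start, $n_{j+1}/B>(n_j/B)^{2/3}$; or (2) some new buffer would have size $m_j-c_i\le 0$; or (3) an item arrives for which there is no empty cell in the buffers of its segment or in the final pool. From then on every item (in case (3), including the current one) goes to the first empty cell of the array. Failures of the recursive calls do not count as failures of the algorithm. The trivial left-to-right algorithm never fails. **Theorem.** For every function $B(n)=\Theta(\log n)$: 1. On every input $x\in[0,1]^n$, $\mathrm{AlgAdapt}$ always places the arriving item into an empty cell. 2. On uniformly random input, the expected cost of $\mathrm{AlgAdapt}$ and its expected competitive ratio are both finite and are $n^{o(1)}$. 3. On uniformly random input, $\mathrm{AlgAdapt}$ fails with probability $O(1/n^{10})$. 4. There is a constant $C$ such that, for all sufficiently large $n$ and every input $x\in[0,1]^n$ on which $\mathrm{AlgAdapt}$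 does not fail, every buffer allocated in phase $j\ge 1$ (outside the recursive calls) has size at most $(n/B)^{(2/3)^{j-1}}$, and there are at most $C\log\log n$ phases. The constants and the $o(1)$ may depend on the function $B$. -/

import Mathlib

open MeasureTheory Filter Topology Asymptotics

namespace OnlineSorting

/-! ### Online algorithms, cost, competitive ratio -/

/-- A deterministic online algorithm for an array whose cells are numbered `0, 1, …`: given all the
items received so far, in order of arrival, it returns the cell in which the last one is placed. -/
abbrev Strategy := List ℝ → ℕ

/-- The cell in which the algorithm places the `i`-th item of the input `x`; it only depends on
the items `x 0, …, x i`. -/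
def position (A : Strategy) {n : ℕ} (x : Fin n → ℝ) (i : Fin n) : ℕ :=
  A ((List.ofFn x).take (i + 1))

/-- On input `x` the algorithm puts the `n` items into pairwise distinct cells of the array with
cells `0, …, n - 1`, that is, it always places the arriving item into an empty cell. -/
def ValidOn (A : Strategy) {n : ℕ} (x : Fin n → ℝ) : Prop :=
  (∀ i, position A x i < n) ∧ Function.Injective (position A x)

/-- The content of the array after all the items have been placed (if `ValidOn A x`, then exactly
one summand belongs to the cell `c`). -/
noncomputable def filledArray (A : Strategy) {n : ℕ} (x : Fin n → ℝ) : Fin n → ℝ :=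
  fun c => ∑ i, if position A x i = c then x i else 0

/-- The sum of the absolute differences of adjacent entries of an array. -/
noncomputable def adjacentCost {n : ℕ} (a : Fin n → ℝ) : ℝ :=
  ∑ c : Fin n, if h : (c : ℕ) + 1 < n then |a ⟨c + 1, h⟩ - a c| else 0

/-- The cost of an online algorithm on the input `x`. -/
noncomputable def cost (A : Strategy) {n : ℕ} (x : Fin n → ℝ) : ℝ :=
  adjacentCost (filledArray A x)

/-- The optimal offline cost: the least cost over all arrangements of the items. -/
noncomputable def offlineCost {n : ℕ} (x : Fin n → ℝ) : ℝ :=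
  ⨅ σ : Equiv.Perm (Fin n), adjacentCost (x ∘ σ)

/-- The competitive ratio on the input `x`. -/
noncomputable def competitiveRatio (A : Strategy) {n : ℕ} (x : Fin n → ℝ) : ℝ :=
  cost A x / offlineCost x

/-- The law of `n` independent items, each uniform on `[0, 1]`. -/
noncomputable def uniformInput (n : ℕ) : Measure (Fin n → ℝ) :=
  Measure.pi fun _ => volume.restrict (Set.Icc (0 : ℝ) 1)

/-! ### The algorithm -/

/-- With `k` future items and `b` segments, the predicted lower bound
`⌈k / b - (1 / 2) (k / b) ^ (2 / 3)⌉` on the number of future items from each segment. -/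
noncomputable def lowerBound (b k : ℕ) : ℕ :=
  ⌈(k / b : ℝ) - 1 / 2 * (k / b : ℝ) ^ (2 / 3 : ℝ)⌉₊

/-- The (0-based) index `i < b` of the segment `[i / b, (i + 1) / b]` that contains `x ∈ [0, 1]`. -/
noncomputable def segment (b : ℕ) (x : ℝ) : ℕ := min ⌊b * x⌋₊ (b - 1)

/-- `regular`: in a phase that is not the last one; `last`: in the last phase, where the pool is the
final pool; `failed`: in the failure mode. -/
inductive Mode
  | regular
  | last
  | failed

/-- The state of one level of the recursion. -/
structure State where
  mode : Mode
  /-- The current phase; phases are numbered `1, 2, …`. -/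
  phase : ℕ
  /-- The number of future items at the start of the current phase. -/
  future : ℕ
  /-- `start j i` is the first cell of the buffer of segment `i` that is allocated in phase `j`. -/
  start : ℕ → ℕ → ℕ
  /-- `size j i` is the number of cells of that buffer. -/
  size : ℕ → ℕ → ℕ
  /-- `items j i` lists the items inserted into that buffer so far, in order of arrival, each
  rescaled from the segment to `[0, 1]`. -/
  items : ℕ → ℕ → List ℝ
  /-- The pool consists of the cells from `pool` to the end of the array. -/
  pool : ℕ
  /-- The cells used so far, the most recent one first. -/
  cells : List ℕ

namespace State

/-- The remaining capacity of segment `i`: the number of empty cells in all its buffers. -/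
def capacity (s : State) (i : ℕ) : ℕ :=
  ∑ j ∈ Finset.Icc 1 s.phase, (s.size j i - (s.items j i).length)

/-- The phase in which the oldest non-full buffer of segment `i` was allocated. -/
noncomputable def oldest (s : State) (i : ℕ) : ℕ :=
  sInf {j | 1 ≤ j ∧ j ≤ s.phase ∧ (s.items j i).length < s.size j i}

/-- The first empty cell that is at least `a`. -/
noncomputable def firstEmpty (s : State) (a : ℕ) : ℕ := sInf {c | a ≤ c ∧ c ∉ s.cells}

end State

open Classical in
/-- The adaptive allocation that starts the next phase, for `b` segments and `n` cells.
The failure mode is entered if the number `k` of future items has not decreased enough since the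
start of the current phase (if there is one), or if the size `m - c_i` of some new buffer is not
positive. Otherwise the new buffers, in the order of their segments, take a prefix of the pool, and
the new phase is the last one if the remaining pool has less than `b * log ^ 5 n` cells. -/
noncomputable def allocate (b n : ℕ) (s : State) : State :=
  let k := n - s.cells.length
  let m := lowerBound b k
  if (1 ≤ s.phase ∧ (s.future / b : ℝ) ^ (2 / 3 : ℝ) < (k / b : ℝ)) ∨
      ∃ i < b, m ≤ s.capacity i then
    { s with mode := Mode.failed }
  else
    let pool' := s.pool + ∑ i ∈ Finset.range b, (m - s.capacity i)
    { s with
      mode := if (n : ℝ) - pool' < b * Real.log n ^ 5 then Mode.last else Mode.regular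
      phase := s.phase + 1
      future := k
      start := Function.update s.start (s.phase + 1)
        fun i => s.pool + ∑ i' ∈ Finset.range i, (m - s.capacity i')
      size := Function.update s.size (s.phase + 1) fun i => m - s.capacity i
      pool := pool' }

/-- The state at the start of phase 1: the allocation is applied to an empty array that consists of
the pool only. -/
noncomputable def initialState (b n : ℕ) : State :=
  allocate b n
    { mode := Mode.regular
      phase := 0
      future := n
      start := fun _ _ => 0
      size := fun _ _ => 0
      items := fun _ _ => []
      pool := 0
      cells := [] }

open Classical in
/-- The arrival of the item `x`, where `sub m` is the algorithm used within a buffer of size `m`.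
In the failure mode, `x` goes into the first empty cell of the array. Otherwise it goes into the
oldest non-full buffer of its segment, if there is one; if this is not the last phase and some
segment has no capacity left then, the next phase is started. If the segment has no capacity left,
then `x` goes into the first empty cell of the final pool. If that is full too (or if there is no
final pool), then the failure mode is entered. -/
noncomputable def step (b n : ℕ) (sub : ℕ → Strategy) (s : State) (x : ℝ) : State :=
  let i := segment b x
  if s.mode = Mode.failed then
    { s with cells := s.firstEmpty 0 :: s.cells }
  else if 0 < s.capacity i then
    let j := s.oldest i
    let l := s.items j i ++ [b * x - i]
    let s' : State :=
      { s with
        items := Function.update s.items j (Function.update (s.items j) i l)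
        cells := (s.start j i + sub (s.size j i) l) :: s.cells }
    if s'.mode = Mode.regular ∧ ∃ i' < b, s'.capacity i' = 0 then allocate b n s' else s'
  else if s.mode = Mode.last ∧ s.firstEmpty s.pool < n then
    { s with cells := s.firstEmpty s.pool :: s.cells }
  else
    { s with mode := Mode.failed, cells := s.firstEmpty 0 :: s.cells }

/-- The state of one level after the items `xs` have arrived. -/
noncomputable def run (b n : ℕ) (sub : ℕ → Strategy) (xs : List ℝ) : State :=
  xs.foldl (step b n sub) (initialState b n)

/-- The trivial algorithm, which fills the array from left to right. -/
def leftToRight : Strategy := fun xs => xs.length - 1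

/-- The range of the parameters in which the recursive algorithm is used: `1 < b ≤ n / log ^ 5 n`.
The excluded `n ≤ 3` are degenerate; for `n ≥ 4` the first allocation has positive buffer sizes, and
every allocation fits into the pool. -/
def Admissible (b n : ℕ) : Prop :=
  4 ≤ n ∧ 1 < b ∧ (b : ℝ) * Real.log n ^ 5 ≤ n

open Classical in
/-- The recursive algorithm with adaptive allocation, for `n` cells and `B n` segments. Within a
buffer of size `m`, the same algorithm is used with `m` cells and `B m` segments. Arrays that are
too small are filled from left to right. (Buffers always have size `m < n`.) -/
noncomputable def algAdapt (B : ℕ → ℕ) (n : ℕ) : Strategy :=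
  if Admissible (B n) n then
    fun xs =>
      (run (B n) n (fun m => if _h : m < n then algAdapt B m else leftToRight) xs).cells.headD 0
  else leftToRight
termination_by n

open Classical in
/-- The state of the top level of `algAdapt B n` after it has processed the input `x`. -/
noncomputable def finalState (B : ℕ → ℕ) {n : ℕ} (x : Fin n → ℝ) : State :=
  run (B n) n (fun m => if m < n then algAdapt B m else leftToRight) (List.ofFn x)

/-- The top level of `algAdapt B n` enters the failure mode on input `x` (failures of recursive
subproblems do not count; the trivial algorithm never fails). -/
def Fails (B : ℕ → ℕ) {n : ℕ} (x : Fin n → ℝ) : Prop :=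
  Admissible (B n) n ∧ (finalState B x).mode = Mode.failed

/-- The number of phases of the top level of `algAdapt B n` on input `x`. -/
noncomputable def numPhases (B : ℕ → ℕ) {n : ℕ} (x : Fin n → ℝ) : ℕ := (finalState B x).phase

/-- The size of the buffer of segment `i` allocated in phase `j` by the top level of `algAdapt B n`
on input `x`. -/
noncomputable def bufferSize (B : ℕ → ℕ) {n : ℕ} (x : Fin n → ℝ) (i j : ℕ) : ℕ :=
  (finalState B x).size j i

end OnlineSorting

/-!
The idea is to condition on the sequence `σ` of the segments of the items. Everything that the
top level of the algorithm decides (phases, buffer sizes, which buffer receives an item, failure)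
depends on `σ` only; the values of the items within their segments merely influence where an item is
placed inside its buffer. `simulation` makes this precise: the state of the run always agrees, up to
the cells and the values of the items, with a state computed from `σ`, and it satisfies the
invariants `Layout` (buffers tile a prefix of the array and are filled by valid strategies) and
`InPhase` (bounds on the number of future items). Validity for every input follows by induction on
the number of cells.

*Failure.* If after every `k` items each segment receives, among the remaining `r` items, a number
of items close to `r / b`, then the algorithm does not fail: the new buffers are never too large for
the items still to come, so that within one phase the number of future items per segment drops from
`r / b` to at most `(r / b) ^ (2 / 3)`, and the final pool can absorb the rest. Thus failure forces
`σ` to be `Unbalanced`, and this excludes `Concentrated`. A Chernoff bound that uses the variance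
`r / b` of the number of items in a segment gives a deviation of order `(r / b) ^ (2 / 3)` a
probability of `exp (-Ω((r / b) ^ (1 / 3)))`; since `r / b ≥ log ^ 5 n`, this is smaller than every
power of `1 / n` (`eventually_measureReal_unbalanced_le`). The buffer sizes decrease doubly
exponentially, so there are `O(log log n)` phases (`InPhase.phase_le`).

*Expected cost.* If there is no failure, then the cost is at most the sum of the costs of the
buffers, `O(1)` for every pair of adjacent blocks, and the trivial bound for the final pool
(`Layout.cost_le`). Given `σ`, the items of each buffer are independent and uniform on the segment,
so the expected cost `f (m)` of the recursive call enters with the factor `1 / b`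
(`integral_cost_joinSegments_le`). If `f (m) ≤ C * m ^ ε` for all `m < n`, the first phase
contributes at most `C * (n / b) ^ ε`, the remaining ones `C * O(log log n) * n ^ (2 * ε / 3)`, and
the rest is polylogarithmic. Since `b` tends to infinity, `(n / b) ^ ε` is a small fraction of
`n ^ ε` and the induction closes (`exists_expectedCost_le`), for every `ε > 0`.

*Competitive ratio.* The optimal cost is at least the distance of any two items, hence at least
`1 / 2` except with exponentially small probability, and the ratio never exceeds `n`
(`expectedRatio_le_two_mul_add`).
-/

namespace OnlineSorting

/-! ### Validity and cost of a strategy -/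

/-- On every list of at most `m` items from `[0, 1]`, the strategy puts the items into distinct
cells smaller than `m`. In contrast to `ValidOn`, this also covers inputs that do not fill the
array, as needed for the buffers of the recursion. -/
def ValidStrategy (A : Strategy) (m : ℕ) : Prop :=
  ∀ l : List ℝ, l.length ≤ m → (∀ y ∈ l, y ∈ Set.Icc (0 : ℝ) 1) →
    (∀ q < l.length, A (l.take (q + 1)) < m) ∧
    ∀ q < l.length, ∀ q' < l.length, A (l.take (q + 1)) = A (l.take (q' + 1)) → q = q'

theorem ValidStrategy.validOn {A : Strategy} {n : ℕ} (h : ValidStrategy A n) {x : Fin n → ℝ}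
    (hx : ∀ i, x i ∈ Set.Icc (0 : ℝ) 1) : ValidOn A x := by
  have hl : ∀ y ∈ List.ofFn x, y ∈ Set.Icc (0 : ℝ) 1 := by
    intro y hy
    obtain ⟨i, rfl⟩ := (List.mem_ofFn' x y).1 hy
    exact hx i
  obtain ⟨h1, h2⟩ := h (List.ofFn x) (by simp) hl
  refine ⟨fun i => h1 i (by simp), fun i j hij => ?_⟩
  exact Fin.ext (h2 i (by simp) j (by simp) hij)

theorem validStrategy_leftToRight (m : ℕ) : ValidStrategy leftToRight m := by
  intro l hl _
  have key : ∀ q < l.length, leftToRight (l.take (q + 1)) = q := by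
    intro q hq
    simp only [leftToRight, List.length_take]
    omega
  refine ⟨fun q hq => ?_, fun q hq q' hq' h => ?_⟩
  · rw [key q hq]; omega
  · rwa [key q hq, key q' hq'] at h

theorem ValidOn.exists_position_eq {A : Strategy} {n : ℕ} {x : Fin n → ℝ} (h : ValidOn A x)
    {c : ℕ} (hc : c < n) : ∃ i, position A x i = c := by
  have hinj : Function.Injective (fun i : Fin n => (⟨position A x i, h.1 i⟩ : Fin n)) :=
    fun i j hij => h.2 (by simpa using hij)
  obtain ⟨i, hi⟩ := (Finite.injective_iff_surjective.1 hinj) ⟨c, hc⟩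
  exact ⟨i, by simpa using hi⟩

theorem ValidOn.filledArray_eq {A : Strategy} {n : ℕ} {x : Fin n → ℝ} (h : ValidOn A x)
    {i c : Fin n} (hc : position A x i = c) : filledArray A x c = x i := by
  unfold filledArray
  rw [Finset.sum_eq_single i]
  · simp [hc]
  · intro j _ hj
    rw [if_neg]
    intro hjc
    exact hj (h.2 (hjc.trans hc.symm))
  · simp

/-- An array as a function on `ℕ`, extended by zero. -/
noncomputable def extendZero {n : ℕ} (a : Fin n → ℝ) (c : ℕ) : ℝ :=
  if h : c < n then a ⟨c, h⟩ else 0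

theorem extendZero_of_lt {n : ℕ} (a : Fin n → ℝ) {c : ℕ} (h : c < n) :
    extendZero a c = a ⟨c, h⟩ := dif_pos h

theorem adjacentCost_eq_sum_range {n : ℕ} (a : Fin n → ℝ) :
    adjacentCost a = ∑ c ∈ Finset.range (n - 1), |extendZero a (c + 1) - extendZero a c| := by
  have h1 : adjacentCost a = ∑ c : Fin n, (fun c : ℕ =>
      if c + 1 < n then |extendZero a (c + 1) - extendZero a c| else 0) c := by
    unfold adjacentCost
    refine Finset.sum_congr rfl fun c _ => ?_
    by_cases h : (c : ℕ) + 1 < n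
    · simp [h, extendZero]
    · simp [h]
  rw [h1, Fin.sum_univ_eq_sum_range (fun c : ℕ =>
      if c + 1 < n then |extendZero a (c + 1) - extendZero a c| else 0) n]
  cases n with
  | zero => simp
  | succ n =>
    rw [Finset.sum_range_succ]
    simp only [lt_self_iff_false, if_false, add_zero, Nat.add_sub_cancel]
    exact Finset.sum_congr rfl fun c hc => by simp [Finset.mem_range.1 hc]

theorem adjacentCost_nonneg {n : ℕ} (a : Fin n → ℝ) : 0 ≤ adjacentCost a := by
  rw [adjacentCost_eq_sum_range]
  exact Finset.sum_nonneg fun _ _ => abs_nonneg _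

theorem abs_sub_le_adjacentCost {n : ℕ} (a : Fin n → ℝ) (i j : Fin n) :
    |a i - a j| ≤ adjacentCost a := by
  wlog hij : i ≤ j generalizing i j
  · rw [abs_sub_comm]; exact this j i (le_of_not_ge hij)
  rw [adjacentCost_eq_sum_range]
  have h := dist_le_Ico_sum_dist (extendZero a) (Fin.le_def.1 hij)
  rw [extendZero_of_lt a i.2, extendZero_of_lt a j.2, Real.dist_eq] at h
  refine h.trans ?_
  calc ∑ c ∈ Finset.Ico (i : ℕ) j, dist (extendZero a c) (extendZero a (c + 1))
      = ∑ c ∈ Finset.Ico (i : ℕ) j, |extendZero a (c + 1) - extendZero a c| :=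
        Finset.sum_congr rfl fun c _ => by rw [dist_comm, Real.dist_eq]
    _ ≤ _ := Finset.sum_le_sum_of_subset_of_nonneg
        (fun c hc => by
          rw [Finset.mem_Ico] at hc; rw [Finset.mem_range]; have := j.2; omega)
        (fun _ _ _ => abs_nonneg _)

theorem abs_sub_le_offlineCost {n : ℕ} (x : Fin n → ℝ) (i j : Fin n) :
    |x i - x j| ≤ offlineCost x := by
  refine le_ciInf fun σ => ?_
  simpa using abs_sub_le_adjacentCost (x ∘ σ) (σ.symm i) (σ.symm j)

theorem offlineCost_nonneg {n : ℕ} (x : Fin n → ℝ) : 0 ≤ offlineCost x :=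
  le_ciInf fun _ => adjacentCost_nonneg _

theorem ValidOn.exists_filledArray_eq {A : Strategy} {n : ℕ} {x : Fin n → ℝ} (h : ValidOn A x)
    (c : Fin n) : ∃ i, filledArray A x c = x i := by
  obtain ⟨i, hi⟩ := h.exists_position_eq c.2
  exact ⟨i, h.filledArray_eq hi⟩

theorem cost_nonneg (A : Strategy) {n : ℕ} (x : Fin n → ℝ) : 0 ≤ cost A x :=
  adjacentCost_nonneg _

/-- If every two entries of an array differ by at most `d`, then its cost is at most `n * d`. -/
theorem adjacentCost_le {n : ℕ} (a : Fin n → ℝ) {d : ℝ} (hd : 0 ≤ d)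
    (h : ∀ i j, |a i - a j| ≤ d) : adjacentCost a ≤ n * d := by
  unfold adjacentCost
  calc _ ≤ ∑ _c : Fin n, d := Finset.sum_le_sum fun c _ => by
        split_ifs
        · exact h _ _
        · exact hd
    _ = n * d := by simp

theorem ValidOn.cost_le_mul_offlineCost {A : Strategy} {n : ℕ} {x : Fin n → ℝ}
    (h : ValidOn A x) : cost A x ≤ n * offlineCost x := by
  refine adjacentCost_le _ (offlineCost_nonneg x) fun c d => ?_
  obtain ⟨i, hi⟩ := h.exists_filledArray_eq c
  obtain ⟨j, hj⟩ := h.exists_filledArray_eq d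
  rw [hi, hj]
  exact abs_sub_le_offlineCost x i j

theorem abs_sub_le_one {y z : ℝ} (hy : y ∈ Set.Icc (0 : ℝ) 1) (hz : z ∈ Set.Icc (0 : ℝ) 1) :
    |y - z| ≤ 1 := by
  rw [abs_le]; exact ⟨by linarith [hy.1, hz.2], by linarith [hy.2, hz.1]⟩

theorem ValidOn.cost_le {A : Strategy} {n : ℕ} {x : Fin n → ℝ}
    (h : ValidOn A x) (hx : ∀ i, x i ∈ Set.Icc (0 : ℝ) 1) : cost A x ≤ n := by
  have := adjacentCost_le (filledArray A x) zero_le_one fun c d => by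
    obtain ⟨i, hi⟩ := h.exists_filledArray_eq c
    obtain ⟨j, hj⟩ := h.exists_filledArray_eq d
    rw [hi, hj]
    exact abs_sub_le_one (hx i) (hx j)
  simpa [cost] using this

theorem competitiveRatio_nonneg (A : Strategy) {n : ℕ} (x : Fin n → ℝ) :
    0 ≤ competitiveRatio A x := div_nonneg (cost_nonneg A x) (offlineCost_nonneg x)

theorem ValidOn.competitiveRatio_le {A : Strategy} {n : ℕ} {x : Fin n → ℝ}
    (h : ValidOn A x) : competitiveRatio A x ≤ n :=
  div_le_of_le_mul₀ (offlineCost_nonneg x) (Nat.cast_nonneg n) h.cost_le_mul_offlineCost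

/-! ### The predicted lower bound -/

theorem Admissible.four_le_log_pow {b n : ℕ} (h : Admissible b n) : 4 ≤ Real.log n ^ 5 := by
  have h4 : Real.log 4 = 2 * Real.log 2 := by
    rw [show (4 : ℝ) = 2 ^ 2 by norm_num, Real.log_pow]; norm_num
  have h1 : (1.38 : ℝ) ≤ Real.log n := by
    calc (1.38 : ℝ) ≤ Real.log 4 := by rw [h4]; linarith [Real.log_two_gt_d9]
      _ ≤ Real.log n := Real.log_le_log (by norm_num) (by exact_mod_cast h.1)
  calc (4 : ℝ) ≤ 1.38 ^ 5 := by norm_num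
    _ ≤ Real.log n ^ 5 := by gcongr

theorem Admissible.pos {b n : ℕ} (h : Admissible b n) : (0 : ℝ) < b := by
  exact_mod_cast (zero_lt_one.trans h.2.1)

theorem Admissible.log_pow_le_div {b n r : ℕ} (h : Admissible b n)
    (hr : (b : ℝ) * Real.log n ^ 5 ≤ r) : Real.log n ^ 5 ≤ (r : ℝ) / b := by
  rw [le_div_iff₀ h.pos]; linarith

theorem Admissible.four_le_div {b n r : ℕ} (h : Admissible b n)
    (hr : (b : ℝ) * Real.log n ^ 5 ≤ r) : 4 ≤ (r : ℝ) / b :=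
  h.four_le_log_pow.trans (h.log_pow_le_div hr)

theorem two_le_rpow {μ : ℝ} (h : 4 ≤ μ) : 2 ≤ μ ^ (2 / 3 : ℝ) := by
  calc (2 : ℝ) = 2 ^ (1 : ℝ) := by simp
    _ ≤ 2 ^ (4 / 3 : ℝ) := Real.rpow_le_rpow_of_exponent_le (by norm_num) (by norm_num)
    _ = 4 ^ (2 / 3 : ℝ) := by
        rw [show (4 : ℝ) = 2 ^ (2 : ℝ) by norm_num, ← Real.rpow_mul (by norm_num)]; norm_num
    _ ≤ μ ^ (2 / 3 : ℝ) := by gcongr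

theorem rpow_two_thirds_le {μ : ℝ} (h : 1 ≤ μ) : μ ^ (2 / 3 : ℝ) ≤ μ := by
  simpa using Real.rpow_le_rpow_of_exponent_le h (by norm_num : (2 / 3 : ℝ) ≤ 1)

theorem le_lowerBound (b k : ℕ) :
    (k / b : ℝ) - 1 / 2 * (k / b : ℝ) ^ (2 / 3 : ℝ) ≤ lowerBound b k := Nat.le_ceil _

theorem lowerBound_le_add_one {b k : ℕ} (h : 1 ≤ (k / b : ℝ)) :
    (lowerBound b k : ℝ) ≤ (k / b : ℝ) - 1 / 2 * (k / b : ℝ) ^ (2 / 3 : ℝ) + 1 := by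
  refine (Nat.ceil_lt_add_one ?_).le
  have := rpow_two_thirds_le h
  linarith

theorem lowerBound_pos {b k : ℕ} (h : 1 ≤ (k / b : ℝ)) : 0 < lowerBound b k := by
  refine Nat.ceil_pos.2 ?_
  have := rpow_two_thirds_le h
  linarith

theorem lowerBound_le_div {b k : ℕ} (h : 4 ≤ (k / b : ℝ)) :
    (lowerBound b k : ℝ) ≤ k / b := by
  have h1 := lowerBound_le_add_one (b := b) (k := k) (by linarith)
  have h2 := two_le_rpow h
  linarith

theorem mul_lowerBound_le {b k : ℕ} (hb : (0 : ℝ) < b) (h : 4 ≤ (k / b : ℝ)) :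
    b * lowerBound b k ≤ k := by
  have h1 := lowerBound_le_div h
  rw [le_div_iff₀ hb] at h1
  have : ((b * lowerBound b k : ℕ) : ℝ) ≤ k := by push_cast; linarith
  exact_mod_cast this

/-! ### Counting the items of a segment in a time window -/

/-- The number of times `t` with `a ≤ t < c` at which an item of segment `i` arrives, where `σ t` is
the segment of the item that arrives at time `t`. -/
def tally (σ : ℕ → ℕ) (i a c : ℕ) : ℕ := ((Finset.Ico a c).filter fun t => σ t = i).card

theorem tally_self (σ : ℕ → ℕ) (i a : ℕ) : tally σ i a a = 0 := by simp [tally]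

theorem tally_succ {σ : ℕ → ℕ} {a c : ℕ} (h : a ≤ c) (i : ℕ) :
    tally σ i a (c + 1) = tally σ i a c + if σ c = i then 1 else 0 := by
  unfold tally
  rw [← Finset.insert_Ico_right_eq_Ico_add_one h, Finset.filter_insert]
  split_ifs with hc
  · rw [Finset.card_insert_of_notMem (by simp)]
  · simp

theorem tally_add_tally (σ : ℕ → ℕ) (i : ℕ) {a c d : ℕ} (h1 : a ≤ c) (h2 : c ≤ d) :
    tally σ i a c + tally σ i c d = tally σ i a d := by
  unfold tally
  rw [← Finset.card_union_of_disjoint, ← Finset.filter_union, Finset.Ico_union_Ico_eq_Ico h1 h2]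
  exact Finset.disjoint_filter_filter (Finset.Ico_disjoint_Ico_consecutive a c d)

theorem sum_tally {σ : ℕ → ℕ} {b : ℕ} (hσ : ∀ t, σ t < b) (a c : ℕ) :
    ∑ i ∈ Finset.range b, tally σ i a c = c - a := by
  rw [← Nat.card_Ico a c]
  exact (Finset.card_eq_sum_card_fiberwise fun t _ => by simp [hσ t]).symm

/-! ### Why the algorithm fails -/

/-- The three reasons for a failure in a phase that starts with `r` future items and has `k` items
in the past, in terms of the segments `σ` of the items only: one segment fills up too early; or at
the start of the next phase, the empty cells of a segment exceed the lower bound of its future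
items; or an item arrives whose segment is full when the pool is full, too. -/
def Unbalanced (b n : ℕ) (σ : ℕ → ℕ) : Prop :=
  ∃ r k : ℕ, r ≤ n ∧ (b : ℝ) * Real.log n ^ 5 ≤ r ∧ n ≤ k + r ∧ k < n ∧
    ((((r : ℝ) / b) ^ (2 / 3 : ℝ) < ((n - (k + 1) : ℕ) : ℝ) / b ∧
        ∃ i < b, lowerBound b r ≤ tally σ i (n - r) (k + 1)) ∨
      (((n - (k + 1) : ℕ) : ℝ) / b ≤ ((r : ℝ) / b) ^ (2 / 3 : ℝ) ∧
        (b : ℝ) * Real.log n ^ 5 ≤ (n - (k + 1) : ℕ) ∧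
        ∃ i < b, lowerBound b (n - (k + 1)) ≤ lowerBound b r - tally σ i (n - r) (k + 1)) ∨
      (∃ i < b, σ k = i ∧ lowerBound b r ≤ tally σ i (n - r) k ∧
        n = k + ∑ i ∈ Finset.range b, (lowerBound b r - tally σ i (n - r) k)))

/-- In every window that starts when `r ≥ b * log ^ 5 n` items are in the future, the number of
items of each segment deviates from its mean by at most `(r / b) ^ (2 / 3) / 4`. -/
def Concentrated (b n : ℕ) (σ : ℕ → ℕ) : Prop :=
  ∀ r ≤ n, (b : ℝ) * Real.log n ^ 5 ≤ r → ∀ k ≤ n, n ≤ k + r → ∀ i < b,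
    |(tally σ i (n - r) k : ℝ) - ((k - (n - r) : ℕ) : ℝ) / b|
      ≤ 1 / 4 * ((r : ℝ) / b) ^ (2 / 3 : ℝ)

/-- The margin `(r / b) ^ (2 / 3) / 2` in the definition of the lower bound absorbs the deviations
of a concentrated sequence, provided that `log ^ 5 n` is not too small. -/
theorem Concentrated.not_unbalanced {b n : ℕ} (hb : (0 : ℝ) < b) (hn : 512 ≤ Real.log n ^ 5)
    {σ : ℕ → ℕ} (hσ : ∀ t, σ t < b) (h : Concentrated b n σ) : ¬ Unbalanced b n σ := by
  rintro ⟨r, k, hrn, hr, hkr, hkn, hF⟩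
  set μ : ℝ := (r : ℝ) / b with hμ
  have hμ512 : 512 ≤ μ := by
    rw [hμ, le_div_iff₀ hb]
    nlinarith
  -- powers of `μ` in terms of `w = μ ^ (2 / 9) ≥ 4`
  set w : ℝ := μ ^ (2 / 9 : ℝ) with hw
  have hμ0 : 0 ≤ μ := by linarith
  have hw4 : 4 ≤ w := by
    calc (4 : ℝ) = 512 ^ (2 / 9 : ℝ) := by
          rw [show (512 : ℝ) = 2 ^ (9 : ℝ) by norm_num, ← Real.rpow_mul (by norm_num)]; norm_num
      _ ≤ w := by rw [hw]; gcongr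
  have hw3 : μ ^ (2 / 3 : ℝ) = w ^ 3 := by
    rw [hw, ← Real.rpow_natCast, ← Real.rpow_mul hμ0]; norm_num
  have hmax := lowerBound_le_add_one (b := b) (k := r) (by rw [← hμ]; linarith)
  have hmin := le_lowerBound b r
  rw [← hμ, hw3] at hmax hmin
  -- elapsed and remaining items
  have hL : ∀ c, n ≤ c + r → c ≤ n →
      ((c - (n - r) : ℕ) : ℝ) / b = μ - ((n - c : ℕ) : ℝ) / b := by
    intro c hc hcn
    rw [hμ, ← sub_div]
    congr 1
    rw [eq_sub_iff_add_eq, ← Nat.cast_add]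
    congr 1
    omega
  have hw3' : 16 * w ≤ w ^ 3 := by
    nlinarith [mul_nonneg (mul_nonneg (by linarith : 0 ≤ w) (by linarith : 0 ≤ w - 4))
      (by linarith : 0 ≤ w + 4)]
  rcases hF with ⟨hlt, i, hi, hle⟩ | ⟨hle, hlog, i, hi, hsz⟩ | ⟨i, hi, hik, hle, hsum⟩
  · have h1 := (abs_le.1 (h r hrn hr (k + 1) hkn (by omega) i hi)).2
    rw [hL (k + 1) (by omega) hkn, ← hμ, hw3] at h1
    rw [hw3] at hlt
    have h2 : (lowerBound b r : ℝ) ≤ tally σ i (n - r) (k + 1) := by exact_mod_cast hle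
    nlinarith
  · set ν : ℝ := ((n - (k + 1) : ℕ) : ℝ) / b with hν
    have hν4 : 512 ≤ ν := by
      rw [hν, le_div_iff₀ hb]
      nlinarith
    have h1 := (abs_le.1 (h r hrn hr (k + 1) hkn (by omega) i hi)).1
    rw [hL (k + 1) (by omega) hkn, ← hμ, hw3, ← hν] at h1
    have hpos : 0 < lowerBound b (n - (k + 1)) := lowerBound_pos (by rw [← hν]; linarith)
    have h2 : (lowerBound b (n - (k + 1)) : ℝ) + tally σ i (n - r) (k + 1) ≤ lowerBound b r := by
      have : lowerBound b (n - (k + 1)) + tally σ i (n - r) (k + 1) ≤ lowerBound b r := by omega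
      exact_mod_cast this
    have h3 := le_lowerBound b (n - (k + 1))
    rw [← hν] at h3
    have h4 : ν ^ (2 / 3 : ℝ) ≤ w ^ 2 := by
      calc ν ^ (2 / 3 : ℝ) ≤ (μ ^ (2 / 3 : ℝ)) ^ (2 / 3 : ℝ) := by gcongr
        _ = w ^ 2 := by
          rw [hw, ← Real.rpow_mul hμ0, ← Real.rpow_natCast, ← Real.rpow_mul hμ0]; norm_num
    have h5 : 4 * w ^ 2 ≤ w ^ 3 := by nlinarith
    nlinarith
  · -- At the end every segment has received enough items to fill its buffers.
    have h1 : ∀ i' < b, lowerBound b r ≤ tally σ i' (n - r) n := by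
      intro i' hi'
      have h1 := (abs_le.1 (h r hrn hr n le_rfl (by omega) i' hi')).1
      rw [hL n (by omega) le_rfl, ← hμ, hw3] at h1
      simp only [Nat.sub_self, Nat.cast_zero, zero_div, sub_zero] at h1
      have : (lowerBound b r : ℝ) ≤ tally σ i' (n - r) n := by nlinarith
      exact_mod_cast this
    have h2 : ∑ i' ∈ Finset.range b, (lowerBound b r - tally σ i' (n - r) k) <
        ∑ i' ∈ Finset.range b, tally σ i' k n := by
      refine Finset.sum_lt_sum (fun i' hi' => ?_) ⟨i, Finset.mem_range.2 hi, ?_⟩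
      · have := h1 i' (Finset.mem_range.1 hi')
        rw [← tally_add_tally σ i' (by omega : n - r ≤ k) hkn.le] at this
        omega
      · have : 0 < tally σ i k n :=
          Finset.card_pos.2 ⟨k, by simp [hkn, hik]⟩
        omega
    rw [sum_tally hσ] at h2
    omega

/-! ### The layout of the array -/

theorem segment_lt {b : ℕ} (hb : 0 < b) (y : ℝ) : segment b y < b := by
  unfold segment; omega

theorem rescale_mem_Icc {b : ℕ} (hb : 0 < b) {y : ℝ} (hy : y ∈ Set.Icc (0 : ℝ) 1) :
    (b : ℝ) * y - segment b y ∈ Set.Icc (0 : ℝ) 1 := by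
  have hb' : (1 : ℝ) ≤ b := by exact_mod_cast hb
  have h0 : 0 ≤ (b : ℝ) * y := mul_nonneg (by linarith) hy.1
  have h1 : (b : ℝ) * y ≤ b := by nlinarith [hy.2]
  unfold segment
  rcases le_total ⌊(b : ℝ) * y⌋₊ (b - 1) with h | h
  · rw [min_eq_left h]
    exact ⟨by linarith [Nat.floor_le h0], by linarith [Nat.lt_floor_add_one ((b : ℝ) * y)]⟩
  · rw [min_eq_right h]
    have h2 : ((b - 1 : ℕ) : ℝ) ≤ b * y := (Nat.le_floor_iff h0).1 h
    push_cast [Nat.cast_sub (show 1 ≤ b from hb)] at h2 ⊢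
    exact ⟨by linarith, by linarith⟩

theorem update_update_apply {α : Type*} (f : ℕ → ℕ → α) (j i : ℕ) (v : α) (j' i' : ℕ) :
    Function.update f j (Function.update (f j) i v) j' i' =
      if j' = j ∧ i' = i then v else f j' i' := by
  by_cases hj : j' = j
  · subst hj
    by_cases hi : i' = i
    · subst hi; simp
    · simp [hi]
  · simp [hj]

namespace State

/-- The pair `(j, i)` stands for a buffer that has been allocated. -/
def IsBuffer (s : State) (b j i : ℕ) : Prop := 1 ≤ j ∧ j ≤ s.phase ∧ i < b

/-- What is left of a state if one forgets the values of the items and the cells in which they have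
been placed: the parameters of the phases and of the buffers, and the numbers of items. -/
def skeleton (s : State) : State :=
  { s with
    items := fun j i => (s.items j i).map fun _ => 0
    cells := s.cells.map fun _ => 0 }

theorem capacity_skeleton (s : State) : s.skeleton.capacity = s.capacity := by
  funext i; simp [capacity, skeleton]

theorem oldest_skeleton (s : State) : s.skeleton.oldest = s.oldest := by
  funext i; simp [oldest, skeleton]

theorem oldest_spec {s : State} {i : ℕ} (h : 0 < s.capacity i) :
    1 ≤ s.oldest i ∧ s.oldest i ≤ s.phase ∧
      (s.items (s.oldest i) i).length < s.size (s.oldest i) i := by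
  refine Nat.sInf_mem (s := {j | 1 ≤ j ∧ j ≤ s.phase ∧ (s.items j i).length < s.size j i}) ?_
  obtain ⟨j, hj, hpos⟩ := Finset.exists_ne_zero_of_sum_ne_zero (Nat.pos_iff_ne_zero.1 h)
  rw [Finset.mem_Icc] at hj
  exact ⟨j, hj.1, hj.2, by omega⟩

theorem firstEmpty_spec (s : State) (a : ℕ) : a ≤ s.firstEmpty a ∧ s.firstEmpty a ∉ s.cells := by
  refine Nat.sInf_mem (s := {c | a ≤ c ∧ c ∉ s.cells}) ?_
  obtain ⟨c, hc⟩ := (s.cells.toFinset ∪ Finset.range a).exists_notMem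
  simp only [Finset.mem_union, List.mem_toFinset, Finset.mem_range, not_or, not_lt] at hc
  exact ⟨c, hc.2, hc.1⟩

theorem firstEmpty_le {s : State} {a c : ℕ} (h1 : a ≤ c) (h2 : c ∉ s.cells) :
    s.firstEmpty a ≤ c := Nat.sInf_le ⟨h1, h2⟩

/-- Appending an item to a non-full buffer of segment `i` decreases the capacity of this segment
by one. -/
theorem capacity_update {s : State} {j i : ℕ} {l : List ℝ} (cs : List ℕ) (h1 : 1 ≤ j)
    (h2 : j ≤ s.phase) (h : (s.items j i).length < s.size j i)
    (hl : l.length = (s.items j i).length + 1) (i' : ℕ) :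
    ({ s with items := Function.update s.items j (Function.update (s.items j) i l)
              cells := cs } : State).capacity i' + (if i' = i then 1 else 0) =
      s.capacity i' := by
  unfold capacity
  simp only [update_update_apply]
  by_cases hi : i' = i
  · subst hi
    have hj : j ∈ Finset.Icc 1 s.phase := Finset.mem_Icc.2 ⟨h1, h2⟩
    rw [← Finset.add_sum_erase _ _ hj, ← Finset.add_sum_erase (a := j) _ _ hj]
    have : ∑ x ∈ (Finset.Icc 1 s.phase).erase j,
          (s.size x i' - (if x = j ∧ i' = i' then l else s.items x i').length) =
        ∑ x ∈ (Finset.Icc 1 s.phase).erase j, (s.size x i' - (s.items x i').length) := by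
      refine Finset.sum_congr rfl fun j' hj' => ?_
      rw [if_neg (by simp [(Finset.mem_erase.1 hj').1])]
    rw [this]
    simp only [and_self, if_true]
    omega
  · simp [hi]

end State

/-- The array after `k` items of the input `x` have been placed: the array consists of disjoint
buffers, which cover the cells before the pool, and of the pool. The buffer `(j, i)` holds the items
that arrived at the times in the list `I j i`, in the cells that the recursive algorithm has chosen,
and exactly the first `p` cells of the pool are used. -/
structure Layout (b n : ℕ) (sub : ℕ → Strategy) (x : ℕ → ℝ) (k : ℕ) (I : ℕ → ℕ → List ℕ) (p : ℕ)
    (s : State) : Prop where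
  length_cells : s.cells.length = k
  nodup_cells : s.cells.Nodup
  pool_le : s.pool + p ≤ n
  /-- The used cells of the pool are a prefix of it. -/
  mem_cells_iff : ∀ c, s.pool ≤ c → (c ∈ s.cells ↔ c < s.pool + p)
  items_eq : ∀ j i, s.items j i = (I j i).map fun t => (b : ℝ) * x t - i
  times_nodup : ∀ j i, (I j i).Nodup
  times_lt : ∀ j i, ∀ t ∈ I j i, t < k
  times_segment : ∀ j i, ∀ t ∈ I j i, segment b (x t) = i
  times_length : ∀ j i, (I j i).length ≤ s.size j i
  times_fresh : ∀ j i, s.phase < j → I j i = []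
  end_le : ∀ j i, s.IsBuffer b j i → s.start j i + s.size j i ≤ s.pool
  exists_buffer : ∀ c < s.pool, ∃ j i, s.IsBuffer b j i ∧
    s.start j i ≤ c ∧ c < s.start j i + s.size j i
  buffer_unique : ∀ c j i j' i', s.IsBuffer b j i → s.start j i ≤ c →
    c < s.start j i + s.size j i → s.IsBuffer b j' i' → s.start j' i' ≤ c →
    c < s.start j' i' + s.size j' i' → j = j' ∧ i = i'
  cells_buffer : ∀ c ∈ s.cells, c < s.pool → ∃ j i q, s.IsBuffer b j i ∧ q < (s.items j i).length ∧
    c = s.start j i + sub (s.size j i) ((s.items j i).take (q + 1))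
  /-- The cell used at time `t` is the one that the recursive algorithm has chosen, if this is the
  time at which the `q`-th item of the buffer `(j, i)` has arrived. -/
  content : ∀ j i, s.IsBuffer b j i → ∀ q t, (I j i)[q]? = some t →
    s.cells.reverse[t]? = some (s.start j i + sub (s.size j i) ((s.items j i).take (q + 1)))
  /-- Every cell before the pool is used or belongs to the capacity of a segment. -/
  count : k + ∑ i ∈ Finset.range b, s.capacity i = s.pool + p
  size_le : ∀ j i, s.IsBuffer b j i →
    (s.size j i : ℝ) ≤ ((n : ℝ) / b) ^ ((2 / 3 : ℝ) ^ (j - 1))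

theorem two_thirds_pow_le_one (j : ℕ) : (2 / 3 : ℝ) ^ j ≤ 1 :=
  pow_le_one₀ (by norm_num) (by norm_num)

namespace Layout

variable {b n : ℕ} {sub : ℕ → Strategy} {x : ℕ → ℝ} {k : ℕ} {I : ℕ → ℕ → List ℕ} {p : ℕ} {s : State}

theorem length_items (h : Layout b n sub x k I p s) (j i : ℕ) :
    (s.items j i).length = (I j i).length := by simp [h.items_eq j i]

theorem items_mem (h : Layout b n sub x k I p s) (hb : 0 < b)
    (hx : ∀ t, x t ∈ Set.Icc (0 : ℝ) 1) (j i : ℕ) :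
    ∀ y ∈ s.items j i, y ∈ Set.Icc (0 : ℝ) 1 := by
  intro y hy
  rw [h.items_eq, List.mem_map] at hy
  obtain ⟨t, ht, rfl⟩ := hy
  have := rescale_mem_Icc hb (hx t)
  rwa [h.times_segment j i t ht] at this

theorem size_lt (h : Layout b n sub x k I p s) (hA : Admissible b n) {j i : ℕ}
    (hj : s.IsBuffer b j i) : s.size j i < n := by
  have hb := hA.pos
  have h1 : 1 ≤ (n : ℝ) / b := le_trans (by norm_num) (hA.four_le_div hA.2.2)
  have h2 : (s.size j i : ℝ) ≤ n / b := by
    refine (h.size_le j i hj).trans ?_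
    simpa using Real.rpow_le_rpow_of_exponent_le h1 (two_thirds_pow_le_one (j - 1))
  have h3 : (n : ℝ) / b < n := by
    rw [div_lt_iff₀ hb]
    have h4 : (4 : ℝ) ≤ n := by exact_mod_cast hA.1
    have h5 : (2 : ℝ) ≤ b := by exact_mod_cast hA.2.1
    nlinarith
  exact_mod_cast h2.trans_lt h3

theorem firstEmpty_pool (h : Layout b n sub x k I p s) : s.firstEmpty s.pool = s.pool + p := by
  apply le_antisymm
  · exact State.firstEmpty_le (by omega) (by rw [h.mem_cells_iff _ (by omega)]; omega)
  · obtain ⟨h1, h2⟩ := s.firstEmpty_spec s.pool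
    rw [h.mem_cells_iff _ h1] at h2
    omega

theorem cells_lt (h : Layout b n sub x k I p s) : ∀ c ∈ s.cells, c < n := by
  intro c hc
  have := h.pool_le
  rcases lt_or_ge c s.pool with h1 | h1
  · omega
  · have := (h.mem_cells_iff c h1).1 hc; omega

/-- An arriving item is placed into a non-full buffer of its segment. -/
theorem insert (h : Layout b n sub x k I p s) (hA : Admissible b n)
    (hx : ∀ t, x t ∈ Set.Icc (0 : ℝ) 1) (hsub : ∀ m < n, ValidStrategy (sub m) m) {j i : ℕ}
    (hj : s.IsBuffer b j i) (hlen : (s.items j i).length < s.size j i)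
    (hi : segment b (x k) = i) :
    Layout b n sub x (k + 1) (Function.update I j (Function.update (I j) i (I j i ++ [k]))) p
      { s with
        items := Function.update s.items j
          (Function.update (s.items j) i (s.items j i ++ [b * x k - i]))
        cells := (s.start j i + sub (s.size j i) (s.items j i ++ [b * x k - i])) :: s.cells } := by
  have hb : 0 < b := by have := hA.2.1; omega
  set l := s.items j i ++ [b * x k - i] with hl
  set c := s.start j i + sub (s.size j i) l with hc
  have hlI := h.length_items j i
  have hll : l.length = (s.items j i).length + 1 := by simp [hl]
  have hl01 : ∀ y ∈ l, y ∈ Set.Icc (0 : ℝ) 1 := by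
    intro y hy
    rw [hl, List.mem_append, List.mem_singleton] at hy
    rcases hy with hy | rfl
    · exact h.items_mem hb hx j i y hy
    · rw [← hi]; exact rescale_mem_Icc hb (hx k)
  obtain ⟨hv1, hv2⟩ := hsub _ (h.size_lt hA hj) l (by omega) hl01
  have htake : l.take ((s.items j i).length + 1) = l := List.take_of_length_le (by omega)
  have htake' : ∀ q < (s.items j i).length, l.take (q + 1) = (s.items j i).take (q + 1) :=
    fun q hq => by rw [hl, List.take_append_of_le_length (by omega)]
  have hcsize : sub (s.size j i) l < s.size j i := by
    have := hv1 (s.items j i).length (by omega)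
    rwa [htake] at this
  have hcpool : c < s.pool := by have := h.end_le j i hj; omega
  have hcnew : c ∉ s.cells := by
    intro hmem
    obtain ⟨j', i', q, hj', hq, hcq⟩ := h.cells_buffer c hmem hcpool
    have hv' := (hsub _ (h.size_lt hA hj') (s.items j' i')
      (by rw [h.length_items]; exact h.times_length j' i') (h.items_mem hb hx j' i')).1 q hq
    obtain ⟨rfl, rfl⟩ := h.buffer_unique c j i j' i' hj (by omega) (by omega) hj' (by omega)
      (by omega)
    have heq : sub (s.size j i) (l.take ((s.items j i).length + 1)) =
        sub (s.size j i) (l.take (q + 1)) := by rw [htake, htake' q hq]; omega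
    have := hv2 _ (by omega) q (by omega) heq
    omega
  have hold : ∀ t < k, ∀ d, s.cells.reverse[t]? = some d → (c :: s.cells).reverse[t]? = some d := by
    intro t ht d hd
    rw [List.reverse_cons, List.getElem?_append_left (by simpa [h.length_cells] using ht)]
    exact hd
  constructor
  · simp [h.length_cells]
  · exact List.nodup_cons.2 ⟨hcnew, h.nodup_cells⟩
  · exact h.pool_le
  · intro d hd
    have hd' : s.pool ≤ d := hd
    rw [List.mem_cons, h.mem_cells_iff d hd]
    constructor
    · rintro (rfl | h1)
      · omega
      · exact h1
    · exact Or.inr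
  · intro j' i'
    simp only [update_update_apply]
    split_ifs with hji
    · rw [hji.2, hl, h.items_eq]; simp
    · exact h.items_eq j' i'
  · intro j' i'
    rw [update_update_apply]
    split_ifs with hji
    · refine List.Nodup.append (h.times_nodup j i) (List.nodup_singleton k) ?_
      rw [List.disjoint_singleton]
      exact fun hk => lt_irrefl k (h.times_lt j i k hk)
    · exact h.times_nodup j' i'
  · intro j' i' t
    rw [update_update_apply]
    split_ifs with hji
    · rw [List.mem_append, List.mem_singleton]
      rintro (ht | rfl)
      · have := h.times_lt j i t ht; omega
      · omega
    · intro ht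
      have := h.times_lt j' i' t ht; omega
  · intro j' i' t
    rw [update_update_apply]
    split_ifs with hji
    · rw [List.mem_append, List.mem_singleton]
      rintro (ht | rfl)
      · rw [hji.2]; exact h.times_segment j i t ht
      · rw [hji.2]; exact hi
    · exact h.times_segment j' i' t
  · intro j' i'
    rw [update_update_apply]
    split_ifs with hji
    · obtain ⟨rfl, rfl⟩ := hji
      simp only [List.length_append, List.length_singleton]
      omega
    · exact h.times_length j' i'
  · intro j' i' hj'
    rw [update_update_apply, if_neg]
    · exact h.times_fresh j' i' hj'
    · have := hj.2.1
      have hj'' : s.phase < j' := hj'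
      omega
  · exact h.end_le
  · exact h.exists_buffer
  · exact h.buffer_unique
  · intro d hd hdp
    rw [List.mem_cons] at hd
    rcases hd with rfl | hd
    · refine ⟨j, i, (s.items j i).length, hj, ?_, ?_⟩
      · simp [hll]
      · simp [htake, hc]
    · obtain ⟨j', i', q, hj', hq, hdq⟩ := h.cells_buffer d hd hdp
      refine ⟨j', i', q, hj', ?_, ?_⟩
      · simp only [update_update_apply]
        split_ifs with hji
        · obtain ⟨rfl, rfl⟩ := hji; omega
        · exact hq
      · simp only [update_update_apply]
        split_ifs with hji
        · obtain ⟨rfl, rfl⟩ := hji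
          rw [htake' q hq]; exact hdq
        · exact hdq
  · intro j' i' hj' q t hqt
    rw [update_update_apply] at hqt
    simp only [update_update_apply]
    split_ifs at hqt ⊢ with hji
    · obtain ⟨rfl, rfl⟩ := hji
      rcases lt_or_ge q (I j' i').length with hq | hq
      · rw [List.getElem?_append_left hq] at hqt
        rw [htake' q (by omega)]
        exact hold t (h.times_lt j' i' t (List.mem_of_getElem? hqt)) _ (h.content j' i' hj q t hqt)
      · rw [List.getElem?_append_right hq, List.getElem?_singleton] at hqt
        split_ifs at hqt with hq0
        obtain rfl : k = t := by simpa using hqt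
        have hq' : q = (s.items j' i').length := by omega
        rw [hq', htake, List.reverse_cons, List.getElem?_append_right (by simp [h.length_cells])]
        simp [h.length_cells, hc]
    · exact hold t (h.times_lt j' i' t (List.mem_of_getElem? hqt)) _ (h.content j' i' hj' q t hqt)
  · have h1 : ∑ i' ∈ Finset.range b, s.capacity i' =
        (∑ i' ∈ Finset.range b, ({ s with
          items := Function.update s.items j (Function.update (s.items j) i l)
          cells := c :: s.cells } : State).capacity i') + 1 := by
      rw [← Finset.sum_congr rfl fun i' _ =>
        State.capacity_update (c :: s.cells) hj.1 hj.2.1 hlen hll i', Finset.sum_add_distrib]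
      simp [hj.2.2]
    have := h.count
    simp only
    omega
  · exact h.size_le

/-- An arriving item is placed into the first empty cell of the final pool. -/
theorem insert_pool (h : Layout b n sub x k I p s) (hp : s.pool + p < n) :
    Layout b n sub x (k + 1) I (p + 1) { s with cells := (s.pool + p) :: s.cells } where
  length_cells := by simp [h.length_cells]
  nodup_cells := by
    refine List.nodup_cons.2 ⟨?_, h.nodup_cells⟩
    rw [h.mem_cells_iff _ (by omega)]; omega
  pool_le := by simp only; omega
  mem_cells_iff c hc := by
    have hc' : s.pool ≤ c := hc
    rw [List.mem_cons, h.mem_cells_iff c hc]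
    simp only
    omega
  items_eq := h.items_eq
  times_nodup := h.times_nodup
  times_lt j i t ht := (h.times_lt j i t ht).trans (Nat.lt_succ_self k)
  times_segment := h.times_segment
  times_length := h.times_length
  times_fresh := h.times_fresh
  end_le := h.end_le
  exists_buffer := h.exists_buffer
  buffer_unique := h.buffer_unique
  cells_buffer c hc hcp := by
    rw [List.mem_cons] at hc
    rcases hc with rfl | hc
    · simp only at hcp; omega
    · exact h.cells_buffer c hc hcp
  content j i hj q t hqt := by
    have ht := h.times_lt j i t (List.mem_of_getElem? hqt)
    rw [List.reverse_cons, List.getElem?_append_left (by simpa [h.length_cells] using ht)]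
    exact h.content j i hj q t hqt
  count := by
    have := h.count
    have h2 : ∀ i, ({ s with cells := (s.pool + p) :: s.cells } : State).capacity i =
      s.capacity i := fun _ => rfl
    simp only [h2]
    omega
  size_le := h.size_le

end Layout

/-! ### The allocation of new buffers -/

/-- The state of the current phase after `k` items with segments `σ`: what is known about a phase
in addition to the layout of the array, as long as the algorithm has not failed. -/
structure InPhase (b n : ℕ) (σ : ℕ → ℕ) (k p : ℕ) (s : State) : Prop where
  mode_ne : s.mode ≠ Mode.failed
  phase_pos : 1 ≤ s.phase
  regular : s.mode = Mode.regular →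
    p = 0 ∧ (b : ℝ) * Real.log n ^ 5 ≤ n - s.pool ∧ ∀ i < b, 0 < s.capacity i
  last : s.mode = Mode.last → (n : ℝ) - s.pool < b * Real.log n ^ 5
  future_le : s.future ≤ n
  /-- The phase has started after `n - s.future ≤ k` items. -/
  start_le : n ≤ k + s.future
  le_future : (b : ℝ) * Real.log n ^ 5 ≤ s.future
  future_div_le : (s.future : ℝ) / b ≤ ((n : ℝ) / b) ^ ((2 / 3 : ℝ) ^ (s.phase - 1))
  /-- In the phase, every segment starts with the capacity `lowerBound b s.future`. -/
  capacity_eq : ∀ i < b, s.capacity i = lowerBound b s.future - tally σ i (n - s.future) k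

theorem exists_lt_sum_range_succ (g : ℕ → ℕ) (b d : ℕ) (h : d < ∑ i ∈ Finset.range b, g i) :
    ∃ i < b, ∑ i' ∈ Finset.range i, g i' ≤ d ∧ d < ∑ i' ∈ Finset.range i, g i' + g i := by
  induction b with
  | zero => simp at h
  | succ b ih =>
    rcases lt_or_ge d (∑ i ∈ Finset.range b, g i) with h1 | h1
    · obtain ⟨i, hi, h2⟩ := ih h1
      exact ⟨i, by omega, h2⟩
    · rw [Finset.sum_range_succ] at h
      exact ⟨b, by omega, h1, h⟩

theorem sum_range_add_le (g : ℕ → ℕ) {i i' : ℕ} (h : i < i') :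
    ∑ a ∈ Finset.range i, g a + g i ≤ ∑ a ∈ Finset.range i', g a := by
  rw [← Finset.sum_range_succ]
  exact Finset.sum_le_sum_of_subset (Finset.range_mono h)

/-- The condition under which the allocation of new buffers fails. -/
def AllocationFails (b n : ℕ) (s : State) : Prop :=
  (1 ≤ s.phase ∧ (s.future / b : ℝ) ^ (2 / 3 : ℝ) < ((n - s.cells.length : ℕ) / b : ℝ)) ∨
    ∃ i < b, lowerBound b (n - s.cells.length) ≤ s.capacity i

theorem allocate_of_fails {b n : ℕ} {s : State} (h : AllocationFails b n s) :
    allocate b n s = { s with mode := Mode.failed } := if_pos h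

open Classical in
theorem allocate_of_not_fails {b n : ℕ} {s : State} (h : ¬ AllocationFails b n s) :
    allocate b n s =
      { s with
        mode := if (n : ℝ) - (s.pool + ∑ i ∈ Finset.range b,
            (lowerBound b (n - s.cells.length) - s.capacity i) : ℕ) < b * Real.log n ^ 5
          then Mode.last else Mode.regular
        phase := s.phase + 1
        future := n - s.cells.length
        start := Function.update s.start (s.phase + 1) fun i => s.pool +
          ∑ i' ∈ Finset.range i, (lowerBound b (n - s.cells.length) - s.capacity i')
        size := Function.update s.size (s.phase + 1)
          fun i => lowerBound b (n - s.cells.length) - s.capacity i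
        pool := s.pool + ∑ i ∈ Finset.range b,
          (lowerBound b (n - s.cells.length) - s.capacity i) } := if_neg h

namespace Layout

variable {b n : ℕ} {sub : ℕ → Strategy} {x : ℕ → ℝ} {k : ℕ} {I : ℕ → ℕ → List ℕ} {s : State}

theorem le_future (h : Layout b n sub x k I 0 s)
    (hpool : (b : ℝ) * Real.log n ^ 5 ≤ n - s.pool) :
    (b : ℝ) * Real.log n ^ 5 ≤ (n - k : ℕ) := by
  have h1 := h.count
  have h2 := h.pool_le
  have h3 : (k : ℝ) ≤ s.pool := by
    have : k ≤ s.pool := by omega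
    exact_mod_cast this
  rw [Nat.cast_sub (by omega)]
  linarith

/-- A successful allocation gives the buffers of every segment the same total capacity, the
predicted lower bound of its future items, and starts a new phase. -/
theorem allocate (h : Layout b n sub x k I 0 s) (hA : Admissible b n)
    (hpool : (b : ℝ) * Real.log n ^ 5 ≤ n - s.pool)
    (hphase : 1 ≤ s.phase →
      (s.future : ℝ) / b ≤ ((n : ℝ) / b) ^ ((2 / 3 : ℝ) ^ (s.phase - 1)))
    (hs : ¬ AllocationFails b n s) (σ : ℕ → ℕ) :
    Layout b n sub x k I 0 (allocate b n s) ∧ InPhase b n σ k 0 (allocate b n s) := by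
  rw [allocate_of_not_fails hs]
  unfold AllocationFails at hs
  rw [h.length_cells] at hs ⊢
  have hr := h.le_future hpool
  have hpn : s.pool ≤ n := by have := h.pool_le; omega
  have hk : k ≤ n := by have := h.count; omega
  have hμ := hA.four_le_div hr
  have hbm := mul_lowerBound_le hA.pos hμ
  have hmpos : 0 < lowerBound b (n - k) := lowerBound_pos (by linarith)
  have hmle := lowerBound_le_div hμ
  generalize hm : lowerBound b (n - k) = m at *
  push Not at hs
  obtain ⟨hs1, hs2⟩ := hs
  have hbound : ((n - k : ℕ) : ℝ) / b ≤ ((n : ℝ) / b) ^ ((2 / 3 : ℝ) ^ s.phase) := by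
    rcases Nat.eq_zero_or_pos s.phase with h0 | h0
    · rw [h0, pow_zero, Real.rpow_one]
      have : ((n - k : ℕ) : ℝ) ≤ n := by exact_mod_cast Nat.sub_le n k
      gcongr
    · refine (hs1 h0).trans ?_
      calc ((s.future : ℝ) / b) ^ (2 / 3 : ℝ)
          ≤ (((n : ℝ) / b) ^ ((2 / 3 : ℝ) ^ (s.phase - 1))) ^ (2 / 3 : ℝ) := by
            gcongr; exact hphase h0
        _ = ((n : ℝ) / b) ^ ((2 / 3 : ℝ) ^ s.phase) := by
            rw [← Real.rpow_mul (by positivity), ← pow_succ, Nat.sub_add_cancel h0]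
  have hsum : ∑ i ∈ Finset.range b, (m - s.capacity i) +
      ∑ i ∈ Finset.range b, s.capacity i = b * m := by
    rw [← Finset.sum_add_distrib, ← smul_eq_mul, ← Finset.card_range b, ← Finset.sum_const,
      Finset.card_range]
    refine Finset.sum_congr rfl fun i hi => ?_
    have := hs2 i (Finset.mem_range.1 hi)
    omega
  have hcount := h.count
  -- the total capacity of a segment after the allocation
  have hcap : ∀ (md : Mode) (fu : ℕ) (st : ℕ → ℕ → ℕ) (po : ℕ) (cs : List ℕ), ∀ i < b,
      State.capacity ⟨md, s.phase + 1, fu, st,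
        Function.update s.size (s.phase + 1) (fun i => m - s.capacity i), s.items, po, cs⟩ i =
          m := by
    intro md fu st po cs i hi
    change ∑ j ∈ Finset.Icc 1 (s.phase + 1), (Function.update s.size (s.phase + 1)
      (fun i => m - s.capacity i) j i - (s.items j i).length) = m
    rw [Finset.sum_Icc_succ_top (by omega)]
    have h1 : ∑ j ∈ Finset.Icc 1 s.phase,
        (Function.update s.size (s.phase + 1) (fun i => m - s.capacity i) j i -
          (s.items j i).length) = s.capacity i := by
      refine Finset.sum_congr rfl fun j hj => ?_
      rw [Function.update_of_ne (by have := (Finset.mem_Icc.1 hj).2; omega)]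
    have h2 := hs2 i hi
    rw [h1, h.items_eq, h.times_fresh _ _ (Nat.lt_succ_self _)]
    simp only [Function.update_self, List.map_nil, List.length_nil]
    omega
  refine ⟨?_, ?_⟩
  · constructor
    · exact h.length_cells
    · exact h.nodup_cells
    · simp only; omega
    · intro c hc
      have hc' : s.pool + ∑ i ∈ Finset.range b, (m - s.capacity i) ≤ c := hc
      have h1 := h.mem_cells_iff c (by omega)
      simp only
      rw [h1]; omega
    · exact h.items_eq
    · exact h.times_nodup
    · exact h.times_lt
    · exact h.times_segment
    · intro j i
      simp only
      by_cases hj : j = s.phase + 1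
      · subst hj
        rw [h.times_fresh _ _ (Nat.lt_succ_self _)]; simp
      · rw [Function.update_of_ne hj]; exact h.times_length j i
    · intro j i hj
      have hj' : s.phase + 1 < j := hj
      exact h.times_fresh j i (by omega)
    · rintro j i ⟨h1, h2, h3⟩
      have h2' : j ≤ s.phase + 1 := h2
      simp only
      by_cases hj : j = s.phase + 1
      · subst hj
        rw [Function.update_self, Function.update_self]
        have := sum_range_add_le (fun a => m - s.capacity a) h3
        omega
      · rw [Function.update_of_ne hj, Function.update_of_ne hj]
        have := h.end_le j i ⟨h1, by omega, h3⟩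
        omega
    · intro c hc
      have hc' : c < s.pool + ∑ i ∈ Finset.range b, (m - s.capacity i) := hc
      rcases lt_or_ge c s.pool with h1 | h1
      · obtain ⟨j, i, hj, h2⟩ := h.exists_buffer c h1
        refine ⟨j, i, ⟨hj.1, Nat.le_succ_of_le hj.2.1, hj.2.2⟩, ?_⟩
        have : j ≠ s.phase + 1 := by have := hj.2.1; omega
        simpa only [Function.update_of_ne this] using h2
      · obtain ⟨i, hi, h2, h3⟩ := exists_lt_sum_range_succ
          (fun a => m - s.capacity a) b (c - s.pool) (by omega)
        refine ⟨s.phase + 1, i, ⟨by omega, le_rfl, hi⟩, ?_⟩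
        simp only [Function.update_self]
        omega
    · rintro c j i j' i' ⟨a1, a2, a3⟩ hc1 hc2 ⟨d1, d2, d3⟩ hc3 hc4
      have a2' : j ≤ s.phase + 1 := a2
      have d2' : j' ≤ s.phase + 1 := d2
      simp only at hc1 hc2 hc3 hc4
      by_cases hj : j = s.phase + 1 <;> by_cases hj' : j' = s.phase + 1
      · subst hj; subst hj'
        rw [Function.update_self] at hc1 hc2 hc3 hc4
        rw [Function.update_self] at hc2 hc4
        refine ⟨rfl, ?_⟩
        rcases lt_trichotomy i i' with hlt | heq | hlt
        · have := sum_range_add_le (fun a => m - s.capacity a) hlt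
          omega
        · exact heq
        · have := sum_range_add_le (fun a => m - s.capacity a) hlt
          omega
      · subst hj
        rw [Function.update_self] at hc1
        rw [Function.update_of_ne hj', Function.update_of_ne hj'] at hc4
        have := h.end_le j' i' ⟨d1, by omega, d3⟩
        omega
      · subst hj'
        rw [Function.update_self] at hc3
        rw [Function.update_of_ne hj, Function.update_of_ne hj] at hc2
        have := h.end_le j i ⟨a1, by omega, a3⟩
        omega
      · rw [Function.update_of_ne hj] at hc1 hc2
        rw [Function.update_of_ne hj'] at hc3 hc4
        rw [Function.update_of_ne hj] at hc2
        rw [Function.update_of_ne hj'] at hc4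
        exact h.buffer_unique c j i j' i' ⟨a1, by omega, a3⟩ hc1 hc2 ⟨d1, by omega, d3⟩ hc3 hc4
    · intro c hc hcp
      rcases lt_or_ge c s.pool with h1 | h1
      · obtain ⟨j, i, q, hj, hq, hcq⟩ := h.cells_buffer c hc h1
        have hne : j ≠ s.phase + 1 := by have := hj.2.1; omega
        refine ⟨j, i, q, ⟨hj.1, Nat.le_succ_of_le hj.2.1, hj.2.2⟩, hq, ?_⟩
        simpa only [Function.update_of_ne hne] using hcq
      · have := (h.mem_cells_iff c h1).1 hc
        omega
    · rintro j i ⟨h1, h2, h3⟩ q t hqt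
      have h2' : j ≤ s.phase + 1 := h2
      by_cases hj : j = s.phase + 1
      · subst hj
        rw [h.times_fresh _ _ (Nat.lt_succ_self _)] at hqt
        simp at hqt
      · simp only [Function.update_of_ne hj]
        exact h.content j i ⟨h1, by omega, h3⟩ q t hqt
    · refine (congrArg (k + ·) (Finset.sum_congr rfl fun i hi =>
        hcap _ _ _ _ _ i (Finset.mem_range.1 hi))).trans ?_
      simp only [Finset.sum_const, Finset.card_range, smul_eq_mul]
      omega
    · rintro j i ⟨h1, h2, h3⟩
      have h2' : j ≤ s.phase + 1 := h2
      simp only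
      by_cases hj : j = s.phase + 1
      · subst hj
        rw [Function.update_self, Nat.add_sub_cancel]
        refine le_trans ?_ (hmle.trans hbound)
        exact_mod_cast Nat.sub_le _ _
      · rw [Function.update_of_ne hj]
        exact h.size_le j i ⟨h1, by omega, h3⟩
  · constructor
    · simp only; split_ifs <;> simp
    · simp
    · simp only
      intro hreg
      split_ifs at hreg with hif
      refine ⟨trivial, not_lt.1 hif, fun i hi => ?_⟩
      exact lt_of_lt_of_eq hmpos (hcap _ _ _ _ _ i hi).symm
    · simp only
      intro hlast
      split_ifs at hlast with hif
      exact hif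
    · exact Nat.sub_le _ _
    · simp only; omega
    · exact hr
    · simpa using hbound
    · intro i hi
      refine (hcap _ _ _ _ _ i hi).trans ?_
      simp only
      rw [show n - (n - k) = k by omega, tally_self, hm, Nat.sub_zero]

end Layout

/-- The first allocation never fails. -/
theorem initialState_spec {b n : ℕ} (hA : Admissible b n) (sub : ℕ → Strategy) (x : ℕ → ℝ)
    (σ : ℕ → ℕ) :
    Layout b n sub x 0 (fun _ _ => []) 0 (initialState b n) ∧
      InPhase b n σ 0 0 (initialState b n) := by
  unfold initialState
  have hlay : Layout b n sub x 0 (fun _ _ => []) 0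
      { mode := Mode.regular, phase := 0, future := n, start := fun _ _ => 0,
        size := fun _ _ => 0, items := fun _ _ => [], pool := 0, cells := [] } := by
    constructor <;> try simp [State.IsBuffer, State.capacity]
    rintro j i h1 h2
    omega
  refine hlay.allocate hA ?_ (fun h => absurd h (by simp)) ?_ σ
  · simpa using hA.2.2
  · unfold AllocationFails
    have hpos : 0 < lowerBound b n :=
      lowerBound_pos (le_trans (by norm_num) (hA.four_le_div hA.2.2))
    simp [State.capacity, hpos.ne']

/-! ### The arrival of an item -/

/-- The items `0, …, k - 1` have been placed into distinct cells of an array of `n` cells. -/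
structure Placed (n k : ℕ) (cells : List ℕ) : Prop where
  length_eq : cells.length = k
  nodup : cells.Nodup
  lt : ∀ c ∈ cells, c < n

theorem Layout.placed {b n : ℕ} {sub : ℕ → Strategy} {x : ℕ → ℝ} {k : ℕ} {I : ℕ → ℕ → List ℕ}
    {p : ℕ} {s : State} (h : Layout b n sub x k I p s) : Placed n k s.cells :=
  ⟨h.length_cells, h.nodup_cells, h.cells_lt⟩

theorem Placed.cons_firstEmpty {n k : ℕ} {s : State} (h : Placed n k s.cells) (hk : k < n) :
    Placed n (k + 1) (s.firstEmpty 0 :: s.cells) := by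
  refine ⟨by simp [h.length_eq], List.nodup_cons.2 ⟨(s.firstEmpty_spec 0).2, h.nodup⟩, ?_⟩
  intro c hc
  rcases List.mem_cons.1 hc with rfl | hc
  · have hcard : s.cells.toFinset.card < (Finset.range n).card := by
      rw [List.toFinset_card_of_nodup h.nodup, h.length_eq, Finset.card_range]; exact hk
    obtain ⟨c, hc1, hc2⟩ := Finset.exists_mem_notMem_of_card_lt_card hcard
    exact (State.firstEmpty_le (Nat.zero_le c) (by simpa using hc2)).trans_lt
      (Finset.mem_range.1 hc1)
  · exact h.lt c hc

/-- The state in which the item `y` has been inserted into the oldest non-full buffer of its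
segment. -/
noncomputable def insertItem (b : ℕ) (sub : ℕ → Strategy) (s : State) (y : ℝ) : State :=
  let i := segment b y
  let j := s.oldest i
  { s with
    items := Function.update s.items j (Function.update (s.items j) i (s.items j i ++ [b * y - i]))
    cells := (s.start j i + sub (s.size j i) (s.items j i ++ [b * y - i])) :: s.cells }

section Step

variable {b n : ℕ} {sub : ℕ → Strategy} {s : State} {y : ℝ}

theorem step_of_failed (h : s.mode = Mode.failed) :
    step b n sub s y = { s with cells := s.firstEmpty 0 :: s.cells } := by
  unfold step; exact if_pos h

theorem step_of_capacity_pos (h : s.mode ≠ Mode.failed) (h1 : 0 < s.capacity (segment b y)) :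
    step b n sub s y =
      open Classical in
      if (insertItem b sub s y).mode = Mode.regular ∧ ∃ i < b, (insertItem b sub s y).capacity i = 0
      then allocate b n (insertItem b sub s y) else insertItem b sub s y := by
  unfold step
  rw [if_neg h, if_pos h1]
  rfl

theorem step_of_pool (h : s.mode = Mode.last) (h1 : s.capacity (segment b y) = 0)
    (h2 : s.firstEmpty s.pool < n) :
    step b n sub s y = { s with cells := s.firstEmpty s.pool :: s.cells } := by
  unfold step
  rw [if_neg (by simp [h]), if_neg (by omega), if_pos ⟨h, h2⟩]

theorem step_of_full (h : s.mode ≠ Mode.failed) (h1 : s.capacity (segment b y) = 0)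
    (h2 : ¬ (s.mode = Mode.last ∧ s.firstEmpty s.pool < n)) :
    step b n sub s y = { s with mode := Mode.failed, cells := s.firstEmpty 0 :: s.cells } := by
  unfold step
  rw [if_neg h, if_neg (by omega), if_neg h2]

/-! The skeletons of the states do not depend on the cells chosen by the recursive calls. -/

theorem allocationFails_skeleton : AllocationFails b n s.skeleton ↔ AllocationFails b n s := by
  unfold AllocationFails
  rw [State.capacity_skeleton]
  simp [State.skeleton]

theorem allocate_skeleton : allocate b n s.skeleton = (allocate b n s).skeleton := by
  by_cases h : AllocationFails b n s
  · rw [allocate_of_fails h, allocate_of_fails (allocationFails_skeleton.2 h)]; rfl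
  · rw [allocate_of_not_fails h, allocate_of_not_fails (mt allocationFails_skeleton.1 h),
      State.capacity_skeleton]
    simp [State.skeleton]

/-- The effect of `insertItem` on skeletons. -/
noncomputable def skeletonInsert (K : State) (i : ℕ) : State :=
  { K with
    items := Function.update K.items (K.oldest i)
      (Function.update (K.items (K.oldest i)) i (K.items (K.oldest i) i ++ [0]))
    cells := 0 :: K.cells }

theorem skeleton_insertItem :
    (insertItem b sub s y).skeleton = skeletonInsert s.skeleton (segment b y) := by
  unfold skeletonInsert
  rw [State.oldest_skeleton]
  unfold State.skeleton insertItem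
  simp only [List.map_cons, State.mk.injEq, true_and, and_true]
  funext j i
  simp only [update_update_apply]
  split_ifs <;> simp

open Classical in
/-- The effect of `step` on skeletons: `i` is the segment of the arriving item, and `room` says
whether there is an empty cell in the pool. -/
noncomputable def skeletonStep (b n : ℕ) (K : State) (i : ℕ) (room : Prop) : State :=
  if K.mode = Mode.failed then { K with cells := 0 :: K.cells }
  else if 0 < K.capacity i then
    if (skeletonInsert K i).mode = Mode.regular ∧ ∃ i' < b, (skeletonInsert K i).capacity i' = 0
    then allocate b n (skeletonInsert K i) else skeletonInsert K i
  else if K.mode = Mode.last ∧ room then { K with cells := 0 :: K.cells }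
  else { K with mode := Mode.failed, cells := 0 :: K.cells }

theorem skeleton_step : (step b n sub s y).skeleton =
    skeletonStep b n s.skeleton (segment b y) (s.firstEmpty s.pool < n) := by
  unfold skeletonStep
  have hmode : s.skeleton.mode = s.mode := rfl
  rw [State.capacity_skeleton, hmode]
  by_cases h : s.mode = Mode.failed
  · rw [step_of_failed h, if_pos h]; rfl
  rw [if_neg h]
  by_cases h1 : 0 < s.capacity (segment b y)
  · rw [step_of_capacity_pos h h1, if_pos h1]
    rw [← skeleton_insertItem (sub := sub), State.capacity_skeleton]
    have hmode' : (insertItem b sub s y).skeleton.mode = (insertItem b sub s y).mode := rfl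
    rw [hmode']
    split_ifs
    · rw [allocate_skeleton]
    · rfl
  · rw [if_neg h1]
    by_cases h2 : s.mode = Mode.last ∧ s.firstEmpty s.pool < n
    · rw [if_pos h2, step_of_pool h2.1 (by omega) h2.2]; rfl
    · rw [if_neg h2, step_of_full h (by omega) h2]; rfl

end Step

/-- The possible effects of an arriving item on a state that is not in the failure mode. The
algorithm enters the failure mode only if the segments of the items are unbalanced. -/
theorem Layout.step {b n : ℕ} {sub : ℕ → Strategy} {x : ℕ → ℝ} {σ : ℕ → ℕ} {k : ℕ}
    {I : ℕ → ℕ → List ℕ} {p : ℕ} {s : State} (h : Layout b n sub x k I p s)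
    (hP : InPhase b n σ k p s) (hA : Admissible b n) (hx : ∀ t, x t ∈ Set.Icc (0 : ℝ) 1)
    (hσ : ∀ t, segment b (x t) = σ t) (hsub : ∀ m < n, ValidStrategy (sub m) m) (hk : k < n) :
    (0 < s.capacity (σ k) ∧ Placed n (k + 1) (step b n sub s (x k)).cells ∧
      (step b n sub s (x k)).cells = (s.start (s.oldest (σ k)) (σ k) +
        sub (s.size (s.oldest (σ k)) (σ k))
          (s.items (s.oldest (σ k)) (σ k) ++ [b * x k - σ k])) :: s.cells ∧
      (((step b n sub s (x k)).mode = Mode.failed ∧ Unbalanced b n σ) ∨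
        (Layout b n sub x (k + 1)
          (Function.update I (s.oldest (σ k)) (Function.update (I (s.oldest (σ k))) (σ k)
            (I (s.oldest (σ k)) (σ k) ++ [k]))) p (step b n sub s (x k)) ∧
          InPhase b n σ (k + 1) p (step b n sub s (x k))))) ∨
    (s.capacity (σ k) = 0 ∧ s.pool + p < n ∧
      (step b n sub s (x k)).cells = (s.pool + p) :: s.cells ∧
      Layout b n sub x (k + 1) I (p + 1) (step b n sub s (x k)) ∧
      InPhase b n σ (k + 1) (p + 1) (step b n sub s (x k))) ∨
    (s.capacity (σ k) = 0 ∧ n ≤ s.pool + p ∧ (step b n sub s (x k)).mode = Mode.failed ∧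
      Unbalanced b n σ ∧ (step b n sub s (x k)).cells = s.firstEmpty 0 :: s.cells) := by
  have hb : 0 < b := by have := hA.2.1; omega
  have hib : σ k < b := by rw [← hσ k]; exact segment_lt hb _
  have hstart := hP.start_le
  have hfut := hP.future_le
  rcases Nat.eq_zero_or_pos (s.capacity (σ k)) with hcap | hcap
  · have hlast : s.mode = Mode.last := by
      cases hm : s.mode with
      | regular => have := (hP.regular hm).2.2 _ hib; omega
      | last => rfl
      | failed => exact absurd hm hP.mode_ne
    right
    rcases lt_or_ge (s.pool + p) n with hp | hp
    · left
      rw [step_of_pool hlast (by rw [hσ k]; exact hcap) (by rw [h.firstEmpty_pool]; exact hp),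
        h.firstEmpty_pool]
      refine ⟨hcap, hp, rfl, h.insert_pool hp, ?_⟩
      constructor
      · exact hP.mode_ne
      · exact hP.phase_pos
      · intro hreg
        rw [hlast] at hreg
        cases hreg
      · exact hP.last
      · exact hfut
      · simp only; omega
      · exact hP.le_future
      · exact hP.future_div_le
      · intro i hi
        change s.capacity i = _
        rw [tally_succ (by simp only; omega), hP.capacity_eq i hi]
        split_ifs with hki
        · subst hki
          have := hP.capacity_eq _ hi
          simp only
          omega
        · rfl
    · right
      rw [step_of_full hP.mode_ne (by rw [hσ k]; exact hcap)
        (by rw [h.firstEmpty_pool]; omega)]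
      refine ⟨hcap, hp, rfl, ⟨s.future, k, hfut, hP.le_future, hstart, hk, Or.inr (Or.inr
        ⟨σ k, hib, rfl, ?_, ?_⟩)⟩, rfl⟩
      · have := hP.capacity_eq _ hib
        omega
      · have hsum : ∑ i ∈ Finset.range b, s.capacity i =
            ∑ i ∈ Finset.range b, (lowerBound b s.future - tally σ i (n - s.future) k) :=
          Finset.sum_congr rfl fun i hi => hP.capacity_eq i (Finset.mem_range.1 hi)
        have := h.count
        have := h.pool_le
        omega
  · left
    obtain ⟨hj1, hj2, hjlen⟩ := State.oldest_spec hcap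
    have hins : insertItem b sub s (x k) = { s with
        items := Function.update s.items (s.oldest (σ k))
          (Function.update (s.items (s.oldest (σ k))) (σ k)
            (s.items (s.oldest (σ k)) (σ k) ++ [b * x k - σ k]))
        cells := (s.start (s.oldest (σ k)) (σ k) + sub (s.size (s.oldest (σ k)) (σ k))
          (s.items (s.oldest (σ k)) (σ k) ++ [b * x k - σ k])) :: s.cells } := by
      unfold insertItem
      rw [hσ k]
    have hL := h.insert hA hx hsub ⟨hj1, hj2, hib⟩ hjlen (hσ k)
    have hcap' : ∀ i, (insertItem b sub s (x k)).capacity i + (if i = σ k then 1 else 0) =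
        s.capacity i := by
      intro i
      rw [hins]
      exact State.capacity_update _ hj1 hj2 hjlen (by simp) i
    have hcapeq : ∀ i < b, (insertItem b sub s (x k)).capacity i =
        lowerBound b s.future - tally σ i (n - s.future) (k + 1) := by
      intro i hi
      have h1 := hcap' i
      have h2 := hP.capacity_eq i hi
      rw [tally_succ (by omega)]
      rcases eq_or_ne i (σ k) with rfl | hne
      · simp only [if_true] at h1 ⊢; omega
      · rw [if_neg hne] at h1
        rw [if_neg hne.symm]
        omega
    rw [← hins] at hL
    rw [step_of_capacity_pos hP.mode_ne (by rw [hσ k]; exact hcap)]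
    have hcells : (insertItem b sub s (x k)).cells = (s.start (s.oldest (σ k)) (σ k) +
        sub (s.size (s.oldest (σ k)) (σ k))
          (s.items (s.oldest (σ k)) (σ k) ++ [b * x k - σ k])) :: s.cells := by rw [hins]
    have e1 : (insertItem b sub s (x k)).mode = s.mode := by rw [hins]
    have e2 : (insertItem b sub s (x k)).phase = s.phase := by rw [hins]
    have e3 : (insertItem b sub s (x k)).future = s.future := by rw [hins]
    have e4 : (insertItem b sub s (x k)).pool = s.pool := by rw [hins]
    refine ⟨hcap, ?_⟩
    generalize insertItem b sub s (x k) = s1 at *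
    split_ifs with hfull
    · obtain ⟨hreg, i', hi', hcap0⟩ := hfull
      rw [e1] at hreg
      obtain ⟨rfl, hpool, -⟩ := hP.regular hreg
      have hpool1 : (b : ℝ) * Real.log n ^ 5 ≤ n - s1.pool := by rwa [e4]
      by_cases hF : AllocationFails b n s1
      · rw [allocate_of_fails hF]
        refine ⟨hL.placed, hcells, Or.inl ⟨rfl, s.future, k, hfut, hP.le_future, hstart, hk, ?_⟩⟩
        have hlog := hL.le_future hpool1
        unfold AllocationFails at hF
        rw [hL.length_cells, e3] at hF
        have h0 := hcapeq i' hi'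
        rcases lt_or_ge (((s.future : ℝ) / b) ^ (2 / 3 : ℝ)) (((n - (k + 1) : ℕ) : ℝ) / b)
          with hlt | hge
        · exact Or.inl ⟨hlt, i', hi', by omega⟩
        · rcases hF with ⟨-, hF⟩ | ⟨i, hi, hF⟩
          · exact absurd hF (not_lt.2 hge)
          · refine Or.inr (Or.inl ⟨hge, hlog, i, hi, ?_⟩)
            rwa [hcapeq i hi] at hF
      · obtain ⟨h1, h2⟩ := hL.allocate hA hpool1
          (fun _ => by rw [e2, e3]; exact hP.future_div_le) hF σ
        refine ⟨h1.placed, ?_, Or.inr ⟨h1, h2⟩⟩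
        rw [allocate_of_not_fails hF, ← hcells]
    · refine ⟨hL.placed, hcells, Or.inr ⟨hL, ?_⟩⟩
      constructor
      · rw [e1]; exact hP.mode_ne
      · rw [e2]; exact hP.phase_pos
      · intro hreg
        have hreg' : s.mode = Mode.regular := by rw [← e1]; exact hreg
        obtain ⟨h1, h2, h3⟩ := hP.regular hreg'
        refine ⟨h1, by rwa [e4], fun i hi => ?_⟩
        by_contra h0
        exact hfull ⟨hreg, i, hi, by omega⟩
      · rw [e1, e4]; exact hP.last
      · rw [e3]; exact hfut
      · rw [e3]; omega
      · rw [e3]; exact hP.le_future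
      · rw [e2, e3]; exact hP.future_div_le
      · rw [e3]; exact hcapeq

/-! ### All inputs with the same segments -/

/-- The state of one level after the first `k` items of the sequence `x`. -/
noncomputable def stateAt (b n : ℕ) (sub : ℕ → Strategy) (x : ℕ → ℝ) (k : ℕ) : State :=
  run b n sub ((List.range k).map x)

theorem stateAt_zero (b n : ℕ) (sub : ℕ → Strategy) (x : ℕ → ℝ) :
    stateAt b n sub x 0 = initialState b n := rfl

theorem stateAt_succ (b n : ℕ) (sub : ℕ → Strategy) (x : ℕ → ℝ) (k : ℕ) :
    stateAt b n sub x (k + 1) = step b n sub (stateAt b n sub x k) (x k) := by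
  simp [stateAt, run, List.range_succ]

/-- The items of the sequence `x` belong to `[0, 1]`, and `σ` is the sequence of their segments. -/
structure HasSegments (b : ℕ) (σ : ℕ → ℕ) (x : ℕ → ℝ) : Prop where
  mem : ∀ t, x t ∈ Set.Icc (0 : ℝ) 1
  segment_eq : ∀ t, segment b (x t) = σ t

theorem exists_hasSegments {b : ℕ} (hb : 0 < b) {σ : ℕ → ℕ} (hσ : ∀ t, σ t < b) :
    ∃ x, HasSegments b σ x := by
  have hb' : (0 : ℝ) < b := by exact_mod_cast hb
  refine ⟨fun t => σ t / b, fun t => ⟨by positivity, ?_⟩, fun t => ?_⟩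
  · rw [div_le_one hb']; exact_mod_cast (hσ t).le
  · have := hσ t
    unfold segment
    rw [mul_div_cancel₀ _ hb'.ne', Nat.floor_natCast]
    omega

/-- The items of all inputs with the same sequence `σ` of segments go to the same buffers: the
skeleton `K` of the state, the times `I j i` at which items are inserted into the buffer `(j, i)`,
and the number `p` of used cells of the pool only depend on `σ`. The failure mode is entered only
if `σ` is unbalanced. -/
theorem simulation {b n : ℕ} (hA : Admissible b n) {sub : ℕ → Strategy}
    (hsub : ∀ m < n, ValidStrategy (sub m) m) {σ : ℕ → ℕ} (hσ : ∀ t, σ t < b) {k : ℕ}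
    (hk : k ≤ n) :
    ∃ K : State, (∀ x, HasSegments b σ x → (stateAt b n sub x k).skeleton = K) ∧
      ((K.mode = Mode.failed ∧ Unbalanced b n σ) ∨
        ∃ I p, ∀ x, HasSegments b σ x → Layout b n sub x k I p (stateAt b n sub x k) ∧
          InPhase b n σ k p (stateAt b n sub x k)) := by
  have hb : 0 < b := by have := hA.2.1; omega
  induction k with
  | zero =>
    refine ⟨_, fun x _ => by rw [stateAt_zero], Or.inr ⟨fun _ _ => [], 0, fun x _ => ?_⟩⟩
    rw [stateAt_zero]
    exact initialState_spec hA sub x σ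
  | succ k ih =>
    obtain ⟨K, hK, hF | ⟨I, p, hI⟩⟩ := ih (by omega)
    · refine ⟨{ K with cells := 0 :: K.cells }, fun x hx => ?_, Or.inl hF⟩
      rw [stateAt_succ, skeleton_step, hK x hx]
      exact if_pos hF.1
    · obtain ⟨x₀, hx₀⟩ := exists_hasSegments hb hσ
      have hpool : ∀ x, HasSegments b σ x → (stateAt b n sub x k).pool = K.pool :=
        fun x hx => by rw [← hK x hx]; rfl
      have hcap : ∀ x, HasSegments b σ x → (stateAt b n sub x k).capacity = K.capacity :=
        fun x hx => by rw [← hK x hx, State.capacity_skeleton]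
      have hold : ∀ x, HasSegments b σ x → (stateAt b n sub x k).oldest = K.oldest :=
        fun x hx => by rw [← hK x hx, State.oldest_skeleton]
      have hskel : ∀ x, HasSegments b σ x → (stateAt b n sub x (k + 1)).skeleton =
          skeletonStep b n K (σ k) (K.pool + p < n) := by
        intro x hx
        rw [stateAt_succ, skeleton_step, hK x hx, (hI x hx).1.firstEmpty_pool, hpool x hx,
          hx.segment_eq]
      have hmode : ∀ x, HasSegments b σ x → (stateAt b n sub x (k + 1)).mode =
          (skeletonStep b n K (σ k) (K.pool + p < n)).mode :=
        fun x hx => by rw [← hskel x hx]; rfl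
      have hstep := fun x (hx : HasSegments b σ x) =>
        (hI x hx).1.step (hI x hx).2 hA hx.mem hx.segment_eq hsub (by omega)
      simp only [← stateAt_succ] at hstep
      refine ⟨_, hskel, ?_⟩
      by_cases hf : (skeletonStep b n K (σ k) (K.pool + p < n)).mode = Mode.failed
      · refine Or.inl ⟨hf, ?_⟩
        rw [← hmode x₀ hx₀] at hf
        rcases hstep x₀ hx₀ with ⟨-, -, -, h | h⟩ | h | h
        · exact h.2
        · exact absurd hf h.2.mode_ne
        · exact absurd hf h.2.2.2.2.mode_ne
        · exact h.2.2.2.1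
      · right
        rcases Nat.eq_zero_or_pos (K.capacity (σ k)) with h0 | h0
        · refine ⟨I, p + 1, fun x hx => ?_⟩
          rw [← hcap x hx] at h0
          rw [← hmode x hx] at hf
          rcases hstep x hx with h | h | h
          · omega
          · exact h.2.2.2
          · exact absurd h.2.2.1 hf
        · refine ⟨Function.update I (K.oldest (σ k)) (Function.update (I (K.oldest (σ k))) (σ k)
            (I (K.oldest (σ k)) (σ k) ++ [k])), p, fun x hx => ?_⟩
          rw [← hcap x hx] at h0
          rw [← hmode x hx] at hf
          rcases hstep x hx with ⟨-, -, -, h | h⟩ | h | h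
          · exact absurd h.1 hf
          · rw [hold x hx] at h
            exact h
          · omega
          · omega

/-- The cell chosen for the `k`-th item, for all inputs with the same segments: it is either given
by a recursive call on some of the items, or the same for all inputs, or the first empty cell. -/
theorem cells_succ {b n : ℕ} (hA : Admissible b n) {sub : ℕ → Strategy}
    (hsub : ∀ m < n, ValidStrategy (sub m) m) {σ : ℕ → ℕ} (hσ : ∀ t, σ t < b) {k : ℕ}
    (hk : k < n) :
    (∃ (a m i : ℕ) (T : List ℕ), m < n ∧ T.length < m ∧ (∀ t ∈ T, t < k) ∧ σ k = i ∧
      (∀ t ∈ T, σ t = i) ∧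
      ∀ x, HasSegments b σ x → (stateAt b n sub x (k + 1)).cells =
        (a + sub m ((T ++ [k]).map fun t => (b : ℝ) * x t - i)) :: (stateAt b n sub x k).cells) ∨
    (∃ c, ∀ x, HasSegments b σ x →
      (stateAt b n sub x (k + 1)).cells = c :: (stateAt b n sub x k).cells) ∨
    (∀ x, HasSegments b σ x → (stateAt b n sub x (k + 1)).cells =
      (stateAt b n sub x k).firstEmpty 0 :: (stateAt b n sub x k).cells) := by
  have hb : 0 < b := by have := hA.2.1; omega
  obtain ⟨K, hK, hF | ⟨I, p, hI⟩⟩ := simulation hA hsub hσ hk.le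
  · refine Or.inr (Or.inr fun x hx => ?_)
    have hfail : (stateAt b n sub x k).mode = Mode.failed := by
      rw [← hF.1, ← hK x hx]; rfl
    rw [stateAt_succ, step_of_failed hfail]
  · obtain ⟨x₀, hx₀⟩ := exists_hasSegments hb hσ
    have hpool : ∀ x, HasSegments b σ x → (stateAt b n sub x k).pool = K.pool :=
      fun x hx => by rw [← hK x hx]; rfl
    have hcap : ∀ x, HasSegments b σ x → (stateAt b n sub x k).capacity = K.capacity :=
      fun x hx => by rw [← hK x hx, State.capacity_skeleton]
    have hold : ∀ x, HasSegments b σ x → (stateAt b n sub x k).oldest = K.oldest :=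
      fun x hx => by rw [← hK x hx, State.oldest_skeleton]
    have hstart : ∀ x, HasSegments b σ x → (stateAt b n sub x k).start = K.start :=
      fun x hx => by rw [← hK x hx]; rfl
    have hsize : ∀ x, HasSegments b σ x → (stateAt b n sub x k).size = K.size :=
      fun x hx => by rw [← hK x hx]; rfl
    have hstep := fun x (hx : HasSegments b σ x) =>
      (hI x hx).1.step (hI x hx).2 hA hx.mem hx.segment_eq hsub hk
    simp only [← stateAt_succ] at hstep
    rcases Nat.eq_zero_or_pos (K.capacity (σ k)) with h0 | h0
    · right
      rcases lt_or_ge (K.pool + p) n with hp | hp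
      · refine Or.inl ⟨K.pool + p, fun x hx => ?_⟩
        rw [← hcap x hx] at h0
        rw [← hpool x hx] at hp
        rcases hstep x hx with h | h | h
        · omega
        · rw [h.2.2.1, hpool x hx]
        · omega
      · refine Or.inr fun x hx => ?_
        rw [← hcap x hx] at h0
        rw [← hpool x hx] at hp
        rcases hstep x hx with h | h | h
        · omega
        · omega
        · exact h.2.2.2.2
    · refine Or.inl ⟨K.start (K.oldest (σ k)) (σ k), K.size (K.oldest (σ k)) (σ k), σ k,
        I (K.oldest (σ k)) (σ k), ?_, ?_, ?_, rfl, ?_, fun x hx => ?_⟩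
      · have h0' := h0
        rw [← hcap x₀ hx₀] at h0'
        obtain ⟨h1, h2, -⟩ := State.oldest_spec h0'
        rw [← hold x₀ hx₀, ← hsize x₀ hx₀]
        exact (hI x₀ hx₀).1.size_lt hA ⟨h1, h2, hσ k⟩
      · have h0' := h0
        rw [← hcap x₀ hx₀] at h0'
        obtain ⟨-, -, h3⟩ := State.oldest_spec h0'
        rwa [(hI x₀ hx₀).1.length_items, hold x₀ hx₀, hsize x₀ hx₀] at h3
      · exact (hI x₀ hx₀).1.times_lt _ _
      · intro t ht
        rw [← hx₀.segment_eq t]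
        exact (hI x₀ hx₀).1.times_segment _ _ t ht
      · rw [← hcap x hx] at h0
        rcases hstep x hx with h | h | h
        · rw [h.2.2.1, hold x hx, hstart x hx, hsize x hx, (hI x hx).1.items_eq]
          simp
        · omega
        · omega

/-- In every state, whether or not the algorithm has failed, the used cells are distinct. -/
theorem placed_stateAt {b n : ℕ} (hA : Admissible b n) {sub : ℕ → Strategy}
    (hsub : ∀ m < n, ValidStrategy (sub m) m) {x : ℕ → ℝ} (hx : ∀ t, x t ∈ Set.Icc (0 : ℝ) 1)
    {k : ℕ} (hk : k ≤ n) : Placed n k (stateAt b n sub x k).cells := by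
  have hb : 0 < b := by have := hA.2.1; omega
  induction k with
  | zero => exact (initialState_spec hA sub x fun _ => 0).1.placed
  | succ k ih =>
    have hx' : HasSegments b (fun t => segment b (x t)) x := ⟨hx, fun _ => rfl⟩
    have ih := ih (by omega)
    obtain ⟨K, hK, hF | ⟨I, p, hI⟩⟩ :=
      simulation hA hsub (fun t => segment_lt hb (x t)) (k := k) (by omega)
    · have hfail : (stateAt b n sub x k).mode = Mode.failed := by
        rw [← hF.1, ← hK x hx']; rfl
      rw [stateAt_succ, step_of_failed hfail]
      exact ih.cons_firstEmpty (by omega)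
    · have := (hI x hx').1.step (hI x hx').2 hA hx (fun _ => rfl) hsub (by omega)
      rw [← stateAt_succ] at this
      rcases this with h | h | h
      · exact h.2.1
      · exact h.2.2.2.1.placed
      · rw [h.2.2.2.2]
        exact ih.cons_firstEmpty (by omega)

/-! ### Validity of the recursive algorithm -/

open Classical in
/-- The algorithm used within the buffers of an array of `n` cells, as a function of their size. -/
noncomputable def subStrategy (B : ℕ → ℕ) (n : ℕ) : ℕ → Strategy :=
  fun m => if m < n then algAdapt B m else leftToRight

theorem subStrategy_of_lt (B : ℕ → ℕ) {m n : ℕ} (h : m < n) :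
    subStrategy B n m = algAdapt B m := if_pos h

theorem algAdapt_of_admissible {B : ℕ → ℕ} {n : ℕ} (h : Admissible (B n) n) :
    algAdapt B n = fun xs => (run (B n) n (subStrategy B n) xs).cells.headD 0 := by
  rw [algAdapt, if_pos h]
  rfl

theorem algAdapt_of_not_admissible {B : ℕ → ℕ} {n : ℕ} (h : ¬ Admissible (B n) n) :
    algAdapt B n = leftToRight := by
  rw [algAdapt, if_neg h]

theorem cells_allocate (b n : ℕ) (s : State) : (allocate b n s).cells = s.cells := by
  by_cases h : AllocationFails b n s
  · rw [allocate_of_fails h]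
  · rw [allocate_of_not_fails h]

theorem exists_cells_step (b n : ℕ) (sub : ℕ → Strategy) (s : State) (y : ℝ) :
    ∃ c, (step b n sub s y).cells = c :: s.cells := by
  by_cases h : s.mode = Mode.failed
  · exact ⟨_, by rw [step_of_failed h]⟩
  by_cases h1 : 0 < s.capacity (segment b y)
  · rw [step_of_capacity_pos h h1]
    split_ifs
    · rw [cells_allocate]; exact ⟨_, rfl⟩
    · exact ⟨_, rfl⟩
  · by_cases h2 : s.mode = Mode.last ∧ s.firstEmpty s.pool < n
    · exact ⟨_, by rw [step_of_pool h2.1 (by omega) h2.2]⟩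
    · exact ⟨_, by rw [step_of_full h (by omega) h2]⟩

theorem reverse_cells_getElem? (b n : ℕ) (sub : ℕ → Strategy) (x : ℕ → ℝ) {t k : ℕ} (ht : t < k) :
    (stateAt b n sub x k).cells.reverse[t]? = some ((stateAt b n sub x (t + 1)).cells.headD 0) := by
  have hlen : ∀ k, (stateAt b n sub x k).cells.length = k := by
    intro k
    induction k with
    | zero => rw [stateAt_zero, initialState, cells_allocate]; rfl
    | succ k ih =>
      obtain ⟨c, hc⟩ := exists_cells_step b n sub (stateAt b n sub x k) (x k)
      rw [stateAt_succ, hc, List.length_cons, ih]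
  induction k with
  | zero => omega
  | succ k ih =>
    obtain ⟨c, hc⟩ := exists_cells_step b n sub (stateAt b n sub x k) (x k)
    rw [← stateAt_succ] at hc
    rw [hc, List.reverse_cons]
    rcases Nat.lt_succ_iff_lt_or_eq.1 ht with h | rfl
    · rw [List.getElem?_append_left (by simpa [hlen] using h)]
      exact ih h
    · rw [List.getElem?_append_right (by simp [hlen]), hc]
      simp [hlen]

theorem algAdapt_map_range {B : ℕ → ℕ} {n : ℕ} (h : Admissible (B n) n) (x : ℕ → ℝ) (k : ℕ) :
    algAdapt B n ((List.range k).map x) =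
      (stateAt (B n) n (subStrategy B n) x k).cells.headD 0 := by
  rw [algAdapt_of_admissible h]; rfl

/-- The algorithm always places the arriving item into an empty cell. In the induction, the
validity of the recursive calls guarantees that a buffer with an empty cell is used correctly. -/
theorem validStrategy_algAdapt (B : ℕ → ℕ) (n : ℕ) : ValidStrategy (algAdapt B n) n := by
  induction n using Nat.strong_induction_on with
  | _ n ih =>
  by_cases hA : Admissible (B n) n
  swap
  · rw [algAdapt_of_not_admissible hA]; exact validStrategy_leftToRight n
  have hsub : ∀ m < n, ValidStrategy (subStrategy B n m) m := fun m hm => by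
    rw [subStrategy_of_lt B hm]; exact ih m hm
  intro l hl hl01
  set x : ℕ → ℝ := fun t => l.getD t 0 with hx
  have hx01 : ∀ t, x t ∈ Set.Icc (0 : ℝ) 1 := by
    intro t
    rcases lt_or_ge t l.length with ht | ht
    · rw [hx]
      simp only [List.getD_eq_getElem _ _ ht]
      exact hl01 _ (List.getElem_mem ht)
    · rw [hx]
      simp only [List.getD_eq_default _ _ ht]
      simp
  have htake : ∀ q < l.length, l.take (q + 1) = (List.range (q + 1)).map x := by
    intro q hq
    refine List.ext_getElem (by simp; omega) fun t h1 h2 => ?_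
    simp only [List.length_map, List.length_range] at h2
    simp [hx, List.getElem?_eq_getElem (show t < l.length by omega)]
  obtain ⟨-, hnd, hlt⟩ := placed_stateAt hA hsub hx01 hl
  have key : ∀ q < l.length,
      (stateAt (B n) n (subStrategy B n) x l.length).cells.reverse[q]? =
        some (algAdapt B n (l.take (q + 1))) := by
    intro q hq
    rw [reverse_cells_getElem? _ _ _ _ hq, htake q hq, algAdapt_map_range hA]
  refine ⟨fun q hq => hlt _ (List.mem_reverse.1 (List.mem_of_getElem? (key q hq))),
    fun q hq q' hq' heq => ?_⟩
  refine (List.getElem?_inj (List.getElem?_eq_some_iff.1 (key q hq)).1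
    (List.nodup_reverse.2 hnd)).1 ?_
  rw [key q hq, key q' hq', heq]

theorem validStrategy_subStrategy (B : ℕ → ℕ) {m n : ℕ} (h : m < n) :
    ValidStrategy (subStrategy B n m) m := by
  rw [subStrategy_of_lt B h]; exact validStrategy_algAdapt B m

theorem take_ofFn {n : ℕ} (x : Fin n → ℝ) {k : ℕ} (hk : k ≤ n) :
    (List.ofFn x).take k = (List.range k).map (extendZero x) := by
  refine List.ext_getElem (by simp; omega) fun t h1 h2 => ?_
  simp only [List.length_map, List.length_range] at h2
  simp [extendZero, show t < n by omega]

theorem position_eq {A : Strategy} {n : ℕ} (x : Fin n → ℝ) (t : Fin n) :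
    position A x t = A ((List.range (t + 1)).map (extendZero x)) := by
  rw [position, take_ofFn x t.2]

theorem finalState_eq (B : ℕ → ℕ) {n : ℕ} (x : Fin n → ℝ) :
    finalState B x = stateAt (B n) n (subStrategy B n) (extendZero x) n := by
  unfold stateAt
  rw [← take_ofFn x le_rfl, List.take_of_length_le (by simp)]
  rfl

theorem extendZero_mem_Icc {n : ℕ} {x : Fin n → ℝ} (hx : ∀ i, x i ∈ Set.Icc (0 : ℝ) 1) (t : ℕ) :
    extendZero x t ∈ Set.Icc (0 : ℝ) 1 := by
  unfold extendZero
  split_ifs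
  · exact hx _
  · simp

/-! ### Runs without failure -/

/-- The number of phases of a run without failure is `O(log log n)`: the number of future items per
segment is raised to a power at most `2 / 3` in every phase, and it is never less than
`log ^ 5 n`. -/
theorem InPhase.phase_le {b n : ℕ} {σ : ℕ → ℕ} {k p : ℕ} {s : State} (h : InPhase b n σ k p s)
    (hA : Admissible b n) (hn : 1 ≤ Real.log (Real.log n)) :
    (s.phase : ℝ) ≤ (1 / Real.log (3 / 2) + 1) * Real.log (Real.log n) := by
  have hb := hA.pos
  have hn4 : (4 : ℝ) ≤ n := by exact_mod_cast hA.1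
  have hlog : 0 < Real.log n := Real.log_pos (by linarith)
  have h32 : 0 < Real.log (3 / 2) := Real.log_pos (by norm_num)
  set d : ℕ := s.phase - 1 with hd
  have h1 : Real.log n ^ 5 ≤ (n : ℝ) ^ ((2 / 3 : ℝ) ^ d) := by
    refine (hA.log_pow_le_div h.le_future).trans (h.future_div_le.trans ?_)
    refine Real.rpow_le_rpow (by positivity) ?_ (by positivity)
    refine div_le_self (by positivity) ?_
    exact_mod_cast hA.2.1.le
  have h2 := Real.log_le_log (by positivity) h1
  rw [Real.log_pow, Real.log_rpow (by linarith)] at h2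
  have h3 : (3 / 2 : ℝ) ^ d ≤ Real.log n := by
    have h4 : 1 ≤ (2 / 3 : ℝ) ^ d * Real.log n := by
      refine le_trans ?_ h2
      push_cast
      linarith
    calc (3 / 2 : ℝ) ^ d ≤ (3 / 2 : ℝ) ^ d * ((2 / 3 : ℝ) ^ d * Real.log n) :=
          le_mul_of_one_le_right (by positivity) h4
      _ = Real.log n := by rw [← mul_assoc, ← mul_pow]; norm_num
  have h5 := Real.log_le_log (by positivity) h3
  rw [Real.log_pow] at h5
  have h6 : (d : ℝ) ≤ 1 / Real.log (3 / 2) * Real.log (Real.log n) := by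
    rw [one_div, inv_mul_eq_div, le_div_iff₀ h32]; exact h5
  have h7 : (s.phase : ℝ) = d + 1 := by
    have := h.phase_pos
    rw [hd]
    push_cast [Nat.cast_sub this]
    ring
  rw [h7]
  nlinarith

/-- A run without failure ends in a state that satisfies both invariants. -/
theorem exists_layout_of_not_fails {B : ℕ → ℕ} {n : ℕ} (hA : Admissible (B n) n)
    {x : Fin n → ℝ} (hx : ∀ i, x i ∈ Set.Icc (0 : ℝ) 1) (hF : ¬ Fails B x) :
    ∃ I p, Layout (B n) n (subStrategy B n) (extendZero x) n I p (finalState B x) ∧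
      InPhase (B n) n (fun t => segment (B n) (extendZero x t)) n p (finalState B x) := by
  have hb : 0 < B n := by have := hA.2.1; omega
  have hseg : HasSegments (B n) (fun t => segment (B n) (extendZero x t)) (extendZero x) :=
    ⟨extendZero_mem_Icc hx, fun _ => rfl⟩
  obtain ⟨K, hK, h | ⟨I, p, h⟩⟩ := simulation hA (sub := subStrategy B n)
    (fun m hm => validStrategy_subStrategy B hm) (fun t => segment_lt hb (extendZero x t))
    (le_refl n)
  · refine absurd ⟨hA, ?_⟩ hF
    rw [finalState_eq, ← h.1, ← hK _ hseg]
    rfl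
  · rw [finalState_eq]
    exact ⟨I, p, h _ hseg⟩

theorem unbalanced_of_fails {B : ℕ → ℕ} {n : ℕ} {x : Fin n → ℝ}
    (hx : ∀ i, x i ∈ Set.Icc (0 : ℝ) 1) (hF : Fails B x) :
    Unbalanced (B n) n (fun t => segment (B n) (extendZero x t)) := by
  have hA := hF.1
  have hb : 0 < B n := by have := hA.2.1; omega
  have hseg : HasSegments (B n) (fun t => segment (B n) (extendZero x t)) (extendZero x) :=
    ⟨extendZero_mem_Icc hx, fun _ => rfl⟩
  obtain ⟨K, hK, h | ⟨I, p, h⟩⟩ := simulation hA (sub := subStrategy B n)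
    (fun m hm => validStrategy_subStrategy B hm) (fun t => segment_lt hb (extendZero x t))
    (le_refl n)
  · exact h.2
  · have := (h _ hseg).2.mode_ne
    rw [← finalState_eq] at this
    exact absurd hF.2 this

theorem eventually_admissible {B : ℕ → ℕ}
    (hB : (fun n : ℕ => (B n : ℝ)) =Θ[atTop] (fun n : ℕ => Real.log n)) :
    ∀ᶠ n in atTop, Admissible (B n) n := by
  have hlog : Tendsto (fun n : ℕ => Real.log n) atTop atTop :=
    Real.tendsto_log_atTop.comp tendsto_natCast_atTop_atTop
  have h1 : Tendsto (fun n : ℕ => (B n : ℝ)) atTop atTop := by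
    have := hB.tendsto_norm_atTop_iff.2 (tendsto_norm_atTop_atTop.comp hlog)
    simpa [Function.comp_def] using this
  have h2 : (fun n : ℕ => (B n : ℝ) * Real.log n ^ 5) =o[atTop] fun n : ℕ => (n : ℝ) := by
    have h3 : (fun n : ℕ => (B n : ℝ) * Real.log n ^ 5) =O[atTop]
        fun n : ℕ => Real.log n * Real.log n ^ 5 := hB.1.mul (isBigO_refl _ _)
    refine h3.trans_isLittleO ?_
    have h4 := (Real.isLittleO_pow_log_id_atTop (n := 6)).comp_tendsto tendsto_natCast_atTop_atTop
    refine h4.congr (fun n => ?_) fun n => rfl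
    simp only [Function.comp]; ring
  filter_upwards [eventually_ge_atTop 4, h1.eventually_gt_atTop 1,
    h2.bound zero_lt_one] with n hn4 hB1 hBn
  refine ⟨hn4, by exact_mod_cast hB1, ?_⟩
  rw [one_mul, Real.norm_natCast] at hBn
  exact (Real.le_norm_self _).trans hBn

/-! ### Measurability -/

/-- On the cube `[0, 1]ⁿ`, the positions of the items are measurable functions of the input. -/
def MeasurableStrategy (A : Strategy) (n : ℕ) : Prop :=
  ∀ (i : Fin n) (c : ℕ), MeasurableSet
    {x : Fin n → ℝ | (∀ t, x t ∈ Set.Icc (0 : ℝ) 1) ∧ position A x i = c}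

theorem measurableSet_cube (n : ℕ) :
    MeasurableSet {x : Fin n → ℝ | ∀ t, x t ∈ Set.Icc (0 : ℝ) 1} := by
  simp only [Set.ofPred_forall]
  exact MeasurableSet.iInter fun t => measurableSet_Icc.preimage (measurable_pi_apply t)

theorem measurable_extendZero {n : ℕ} (t : ℕ) :
    Measurable fun x : Fin n → ℝ => extendZero x t := by
  unfold extendZero
  split_ifs
  · exact measurable_pi_apply _
  · exact measurable_const

theorem measurable_segment (b : ℕ) : Measurable (segment b) := by
  unfold segment
  exact (Nat.measurable_floor.comp (measurable_const_mul _)).min measurable_const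

theorem measurableStrategy_leftToRight (n : ℕ) : MeasurableStrategy leftToRight n := by
  intro i c
  have : ∀ x : Fin n → ℝ, position leftToRight x i = i := by
    intro x; rw [position_eq]; simp [leftToRight]
  simp only [this]
  exact (measurableSet_cube n).inter (MeasurableSet.const _)

/-- The inputs whose items have the segments `σ`. -/
def segmentCell (b n : ℕ) (σ : ℕ → ℕ) : Set (Fin n → ℝ) :=
  {x | HasSegments b σ (extendZero x)}

theorem measurableSet_segmentCell (b n : ℕ) (σ : ℕ → ℕ) :
    MeasurableSet (segmentCell b n σ) := by
  have : segmentCell b n σ = ⋂ t : ℕ, {x | extendZero x t ∈ Set.Icc (0 : ℝ) 1} ∩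
      {x | segment b (extendZero x t) = σ t} := by
    ext x
    simp only [segmentCell, Set.mem_ofPred_eq, Set.mem_iInter, Set.mem_inter_iff]
    exact ⟨fun h t => ⟨h.mem t, h.segment_eq t⟩, fun h => ⟨fun t => (h t).1, fun t => (h t).2⟩⟩
  rw [this]
  refine MeasurableSet.iInter fun t =>
    (measurableSet_Icc.preimage (measurable_extendZero t)).inter ?_
  exact ((measurable_segment b).comp (measurable_extendZero t)) (measurableSet_singleton (σ t))

/-- The input of a recursive call: the items that arrive at the times in the list `T` and belong to
segment `i`, rescaled to `[0, 1]`. -/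
noncomputable def subInput (b i : ℕ) (T : List ℕ) (m : ℕ) (x : ℕ → ℝ) : Fin m → ℝ :=
  extendZero (n := T.length) (fun q => (b : ℝ) * x T[q] - i) ∘ Fin.val

theorem map_eq_map_range_subInput {b i m : ℕ} {T : List ℕ} (hT : T.length ≤ m) (x : ℕ → ℝ) {k : ℕ}
    (hk : k ≤ T.length) :
    (T.map fun t => (b : ℝ) * x t - i).take k =
      (List.range k).map (extendZero (subInput b i T m x)) := by
  refine List.ext_getElem (by simp; omega) fun q h1 h2 => ?_
  simp only [List.length_map, List.length_range] at h2
  simp [subInput, extendZero, show q < m by omega, show q < T.length by omega]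

theorem subInput_mem_Icc {b i m : ℕ} (hb : 0 < b) {T : List ℕ} {σ : ℕ → ℕ} {x : ℕ → ℝ}
    (hx : HasSegments b σ x) (hT : ∀ t ∈ T, σ t = i) (q : Fin m) :
    subInput b i T m x q ∈ Set.Icc (0 : ℝ) 1 := by
  unfold subInput
  refine extendZero_mem_Icc (fun q => ?_) q
  have := rescale_mem_Icc hb (hx.mem T[q])
  rwa [hx.segment_eq, hT T[q] (List.getElem_mem q.2)] at this

theorem measurable_subInput (b i : ℕ) (T : List ℕ) (m n : ℕ) :
    Measurable fun x : Fin n → ℝ => subInput b i T m (extendZero x) := by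
  refine measurable_pi_lambda _ fun q => ?_
  refine (measurable_extendZero (n := T.length) q).comp (measurable_pi_lambda _ fun q' => ?_)
  exact ((measurable_extendZero _).const_mul _).sub_const _

/-- On the inputs with segments `σ`, every item goes to a fixed cell of the pool, to the first empty
cell, or to a fixed buffer; in the last case the cell depends measurably on the input of the
recursive call. -/
theorem measurableSet_cells {b n : ℕ} (hA : Admissible b n) {sub : ℕ → Strategy}
    (hsub : ∀ m < n, ValidStrategy (sub m) m) (hmeas : ∀ m < n, MeasurableStrategy (sub m) m)
    {σ : ℕ → ℕ} (hσ : ∀ t, σ t < b) {k : ℕ} (hk : k ≤ n) (S : Set (List ℕ)) :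
    MeasurableSet {x : Fin n → ℝ | x ∈ segmentCell b n σ ∧
      (stateAt b n sub (extendZero x) k).cells ∈ S} := by
  have hb : 0 < b := by have := hA.2.1; omega
  induction k generalizing S with
  | zero =>
    simp only [stateAt_zero]
    exact (measurableSet_segmentCell b n σ).inter (MeasurableSet.const _)
  | succ k ih =>
    have ih := ih (by omega)
    rcases cells_succ hA hsub hσ (k := k) (by omega) with
      ⟨a, m, i, T, hm, hT, hTk, hki, hTi, h⟩ | ⟨c, h⟩ | h
    · have hTi' : ∀ t ∈ T ++ [k], σ t = i := by
        intro t ht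
        rcases List.mem_append.1 ht with ht | ht
        · exact hTi t ht
        · rw [List.mem_singleton.1 ht]; exact hki
      -- the decision of the recursive call is measurable, as its input is
      have hpos : ∀ x : ℕ → ℝ, sub m ((T ++ [k]).map fun t => (b : ℝ) * x t - i) =
          position (sub m) (subInput b i (T ++ [k]) m x) ⟨T.length, hT⟩ := by
        intro x
        rw [position_eq, ← map_eq_map_range_subInput (by simp; omega) _ (by simp),
          List.take_of_length_le (by simp)]
      have hset : {x : Fin n → ℝ | x ∈ segmentCell b n σ ∧
          (stateAt b n sub (extendZero x) (k + 1)).cells ∈ S} =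
          ⋃ e : ℕ, {x | x ∈ segmentCell b n σ ∧
            (stateAt b n sub (extendZero x) k).cells ∈ {L | (a + e) :: L ∈ S}} ∩
            (fun x => subInput b i (T ++ [k]) m (extendZero x)) ⁻¹'
              {y | (∀ t, y t ∈ Set.Icc (0 : ℝ) 1) ∧ position (sub m) y ⟨T.length, hT⟩ = e} := by
        ext x
        simp only [Set.mem_ofPred_eq, Set.mem_iUnion, Set.mem_inter_iff, Set.mem_preimage]
        constructor
        · rintro ⟨hx, hS⟩
          rw [h _ hx, hpos] at hS
          exact ⟨_, ⟨hx, hS⟩, fun q => subInput_mem_Icc hb hx hTi' q, rfl⟩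
        · rintro ⟨e, ⟨hx, hS⟩, -, rfl⟩
          refine ⟨hx, ?_⟩
          rw [h _ hx, hpos]
          exact hS
      rw [hset]
      exact MeasurableSet.iUnion fun e => (ih _).inter
        (measurable_subInput b i _ m n (hmeas m hm _ e))
    · have hset : {x : Fin n → ℝ | x ∈ segmentCell b n σ ∧
          (stateAt b n sub (extendZero x) (k + 1)).cells ∈ S} =
          {x | x ∈ segmentCell b n σ ∧
            (stateAt b n sub (extendZero x) k).cells ∈ {L | c :: L ∈ S}} := by
        ext x
        refine and_congr_right fun hx => ?_
        rw [h _ hx]; rfl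
      rw [hset]
      exact ih _
    · have hset : {x : Fin n → ℝ | x ∈ segmentCell b n σ ∧
          (stateAt b n sub (extendZero x) (k + 1)).cells ∈ S} =
          {x | x ∈ segmentCell b n σ ∧
            (stateAt b n sub (extendZero x) k).cells ∈
              {L | sInf {c | 0 ≤ c ∧ c ∉ L} :: L ∈ S}} := by
        ext x
        refine and_congr_right fun hx => ?_
        rw [h _ hx]; rfl
      rw [hset]
      exact ih _

/-- The sequence of segments given by its first `n` entries. -/
def extendSegments {b n : ℕ} (τ : Fin n → Fin b) (t : ℕ) : ℕ :=
  if h : t < n then τ ⟨t, h⟩ else 0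

theorem extendSegments_lt {b n : ℕ} (hb : 0 < b) (τ : Fin n → Fin b) (t : ℕ) :
    extendSegments τ t < b := by
  unfold extendSegments
  split_ifs
  · exact (τ _).2
  · exact hb

theorem hasSegments_extendZero {b n : ℕ} {τ : Fin n → Fin b} {x : Fin n → ℝ}
    (hx : ∀ i, x i ∈ Set.Icc (0 : ℝ) 1) (h : ∀ i, segment b (x i) = τ i) :
    HasSegments b (extendSegments τ) (extendZero x) := by
  refine ⟨extendZero_mem_Icc hx, fun t => ?_⟩
  unfold extendZero extendSegments
  split_ifs
  · exact h _
  · simp [segment]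

theorem measurableStrategy_algAdapt (B : ℕ → ℕ) (n : ℕ) :
    MeasurableStrategy (algAdapt B n) n := by
  induction n using Nat.strong_induction_on with
  | _ n ih =>
  by_cases hA : Admissible (B n) n
  swap
  · rw [algAdapt_of_not_admissible hA]; exact measurableStrategy_leftToRight n
  have hb : 0 < B n := by have := hA.2.1; omega
  intro i c
  have hset : {x : Fin n → ℝ | (∀ t, x t ∈ Set.Icc (0 : ℝ) 1) ∧
      position (algAdapt B n) x i = c} = ⋃ τ : Fin n → Fin (B n),
        {x | x ∈ segmentCell (B n) n (extendSegments τ) ∧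
          (stateAt (B n) n (subStrategy B n) (extendZero x) (i + 1)).cells ∈
            {L | L.headD 0 = c}} := by
    ext x
    simp only [position_eq, algAdapt_map_range hA, Set.mem_ofPred_eq, Set.mem_iUnion]
    constructor
    · rintro ⟨hx, hc⟩
      exact ⟨fun t => ⟨segment (B n) (x t), segment_lt hb _⟩,
        hasSegments_extendZero hx fun _ => rfl, hc⟩
    · rintro ⟨τ, hx, hc⟩
      refine ⟨fun t => ?_, hc⟩
      have := hx.mem t
      rwa [extendZero_of_lt x t.2] at this
  rw [hset]
  refine MeasurableSet.iUnion fun τ => measurableSet_cells hA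
    (fun m hm => validStrategy_subStrategy B hm) (fun m hm => ?_) (extendSegments_lt hb τ) i.2 _
  rw [subStrategy_of_lt B hm]
  exact ih m hm

instance (n : ℕ) : IsProbabilityMeasure (uniformInput n) := by
  unfold uniformInput
  have : IsProbabilityMeasure (volume.restrict (Set.Icc (0 : ℝ) 1)) := ⟨by simp⟩
  infer_instance

theorem ae_mem_cube (n : ℕ) : ∀ᵐ x ∂uniformInput n, ∀ i, x i ∈ Set.Icc (0 : ℝ) 1 := by
  have : uniformInput n =
      (Measure.pi fun _ : Fin n => (volume : Measure ℝ)).restrict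
        (Set.univ.pi fun _ => Set.Icc (0 : ℝ) 1) := by
    rw [Measure.restrict_pi_pi]; rfl
  rw [this]
  filter_upwards [ae_restrict_mem (MeasurableSet.univ_pi fun _ => measurableSet_Icc)] with x hx i
  exact hx i (Set.mem_univ i)

theorem measurable_adjacentCost {n : ℕ} : Measurable (adjacentCost (n := n)) := by
  unfold adjacentCost
  refine Finset.measurable_sum _ fun c _ => ?_
  split_ifs
  · exact Continuous.measurable (by fun_prop)
  · exact measurable_const

theorem MeasurableStrategy.aestronglyMeasurable_cost {A : Strategy} {n : ℕ}
    (h : MeasurableStrategy A n) :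
    AEStronglyMeasurable (fun x : Fin n → ℝ => cost A x) (uniformInput n) := by
  classical
  set a : (Fin n → ℝ) → Fin n → ℝ := fun x c => ∑ i, Set.indicator
    {x : Fin n → ℝ | (∀ t, x t ∈ Set.Icc (0 : ℝ) 1) ∧ position A x i = c} (fun x => x i) x with ha
  have hmeas : ∀ c, Measurable fun x => a x c := fun c =>
    Finset.measurable_sum _ fun i _ => (measurable_pi_apply i).indicator (h i c)
  refine ⟨fun x => adjacentCost (a x), ?_, ?_⟩
  · exact (measurable_adjacentCost.comp (measurable_pi_lambda _ hmeas)).stronglyMeasurable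
  · filter_upwards [ae_mem_cube n] with x hx
    unfold cost filledArray
    congr 1
    funext c
    simp only [ha, Set.indicator_apply, Set.mem_ofPred_eq]
    exact Finset.sum_congr rfl fun i _ => by simp [hx]

theorem measurable_offlineCost {n : ℕ} : Measurable (offlineCost (n := n)) := by
  unfold offlineCost
  exact Measurable.iInf fun σ => measurable_adjacentCost.comp
    (measurable_pi_lambda _ fun i => measurable_pi_apply _)

theorem integrable_cost (B : ℕ → ℕ) (n : ℕ) :
    Integrable (fun x : Fin n → ℝ => cost (algAdapt B n) x) (uniformInput n) := by
  refine Integrable.of_bound (measurableStrategy_algAdapt B n).aestronglyMeasurable_cost n ?_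
  filter_upwards [ae_mem_cube n] with x hx
  rw [Real.norm_of_nonneg (cost_nonneg _ _)]
  exact ((validStrategy_algAdapt B n).validOn hx).cost_le hx

theorem integrable_competitiveRatio (B : ℕ → ℕ) (n : ℕ) :
    Integrable (fun x : Fin n → ℝ => competitiveRatio (algAdapt B n) x) (uniformInput n) := by
  have hcost := (measurableStrategy_algAdapt B n).aestronglyMeasurable_cost.aemeasurable
  refine Integrable.of_bound
    (hcost.div measurable_offlineCost.aemeasurable).aestronglyMeasurable n ?_
  filter_upwards [ae_mem_cube n] with x hx
  rw [Real.norm_of_nonneg (competitiveRatio_nonneg _ _)]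
  exact ((validStrategy_algAdapt B n).validOn hx).competitiveRatio_le

/-! ### The cost of a run without failure -/

section Cost

variable {B : ℕ → ℕ} {n : ℕ} {x : Fin n → ℝ} {σ : ℕ → ℕ} {I : ℕ → ℕ → List ℕ} {p : ℕ} {s : State}

/-- At the end of a run without failure all buffers are full. -/
theorem Layout.length_times {b : ℕ} {sub : ℕ → Strategy} {y : ℕ → ℝ}
    (h : Layout b n sub y n I p s) {j i : ℕ} (hj : s.IsBuffer b j i) :
    (I j i).length = s.size j i := by
  have h0 : s.capacity i = 0 := by
    have h1 := h.count
    have h2 := h.pool_le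
    have h3 := Finset.single_le_sum (f := s.capacity) (fun _ _ => Nat.zero_le _)
      (Finset.mem_range.2 hj.2.2)
    omega
  have h1 := Finset.sum_eq_zero_iff.1 h0 j (Finset.mem_Icc.2 ⟨hj.1, hj.2.1⟩)
  have h2 := h.times_length j i
  rw [h.length_items] at h1
  omega

/-- At the end of a run without failure, the last phase has been reached. -/
theorem Layout.sub_pool_le {b : ℕ} {sub : ℕ → Strategy} {y : ℕ → ℝ}
    (h : Layout b n sub y n I p s) (hP : InPhase b n σ n p s) (hA : Admissible b n) :
    (n : ℝ) - s.pool ≤ b * Real.log n ^ 5 := by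
  cases hm : s.mode with
  | regular =>
    obtain ⟨rfl, h1, -⟩ := hP.regular hm
    have h2 : s.pool = n := by have := h.count; have := h.pool_le; omega
    rw [h2, sub_self] at h1
    have := mul_pos hA.pos (lt_of_lt_of_le (by norm_num) hA.four_le_log_pow)
    linarith
  | last => exact (hP.last hm).le
  | failed => exact absurd hm hP.mode_ne

/-- A buffer contains the items chosen for it in the arrangement of the recursive call, scaled to
its segment. -/
theorem Layout.filledArray_buffer
    (h : Layout (B n) n (subStrategy B n) (extendZero x) n I p
      (stateAt (B n) n (subStrategy B n) (extendZero x) n))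
    (hA : Admissible (B n) n) (hx : HasSegments (B n) σ (extendZero x)) {j i : ℕ}
    (hj : (stateAt (B n) n (subStrategy B n) (extendZero x) n).IsBuffer (B n) j i) {m a : ℕ}
    (hm : (stateAt (B n) n (subStrategy B n) (extendZero x) n).size j i = m)
    (ha : (stateAt (B n) n (subStrategy B n) (extendZero x) n).start j i = a)
    {d : ℕ} (hd : d < m) :
    extendZero (filledArray (algAdapt B n) x) (a + d) =
      (i + extendZero (filledArray (subStrategy B n m)
        (subInput (B n) i (I j i) m (extendZero x))) d) / B n := by
  have hb : 0 < B n := by have := hA.2.1; omega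
  have hb' : (B n : ℝ) ≠ 0 := by exact_mod_cast hb.ne'
  have hmn : m < n := hm ▸ h.size_lt hA hj
  have hlen : (I j i).length = m := hm ▸ h.length_times hj
  have hx01 : ∀ t, x t ∈ Set.Icc (0 : ℝ) 1 := fun t => by
    have := hx.mem t; rwa [extendZero_of_lt x t.2] at this
  have hseg : ∀ t ∈ I j i, σ t = i := fun t ht => by
    rw [← hx.segment_eq]; exact h.times_segment j i t ht
  set z := subInput (B n) i (I j i) m (extendZero x) with hz
  have hzv : ValidOn (subStrategy B n m) z :=
    (validStrategy_subStrategy B hmn).validOn fun q => subInput_mem_Icc hb hx hseg q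
  obtain ⟨q, hq⟩ := hzv.exists_position_eq hd
  have hqI : (q : ℕ) < (I j i).length := by rw [hlen]; exact q.2
  set t := (I j i)[(q : ℕ)] with ht
  have htn : t < n := h.times_lt j i t (List.getElem_mem hqI)
  -- the cell of the `q`-th item of the buffer
  have hcell : position (algAdapt B n) x ⟨t, htn⟩ = a + d := by
    have h1 := h.content j i hj q t (List.getElem?_eq_getElem hqI)
    rw [reverse_cells_getElem? _ _ _ _ htn, Option.some_inj, hm, ha, h.items_eq,
      map_eq_map_range_subInput (m := m) hlen.le _ (by omega), ← hz,
      ← position_eq (A := subStrategy B n m) z q,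
      hq] at h1
    rw [position_eq, algAdapt_map_range hA, h1]
  have had : a + d < n := by
    rw [← hcell]; exact ((validStrategy_algAdapt B n).validOn hx01).1 _
  rw [extendZero_of_lt _ had, extendZero_of_lt _ hd, hzv.filledArray_eq (i := q) hq,
    ((validStrategy_algAdapt B n).validOn hx01).filledArray_eq (i := ⟨t, htn⟩) hcell]
  have hzq : z q = B n * x ⟨t, htn⟩ - i := by
    rw [hz, subInput, Function.comp_apply, extendZero_of_lt _ hqI, ← extendZero_of_lt x htn]
    rfl
  rw [hzq]
  field_simp
  ring

/-- If there is no failure, then the cost within a buffer is the cost of the recursive call divided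
by the number of segments. The other pairs of adjacent cells lie between two buffers or in the final
pool. -/
theorem Layout.cost_le
    (h : Layout (B n) n (subStrategy B n) (extendZero x) n I p
      (stateAt (B n) n (subStrategy B n) (extendZero x) n))
    (hP : InPhase (B n) n σ n p (stateAt (B n) n (subStrategy B n) (extendZero x) n))
    (hA : Admissible (B n) n) (hx : HasSegments (B n) σ (extendZero x)) {K : State}
    (hK : (stateAt (B n) n (subStrategy B n) (extendZero x) n).skeleton = K) :
    cost (algAdapt B n) x ≤ (∑ j ∈ Finset.Icc 1 K.phase, ∑ i ∈ Finset.range (B n),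
      (cost (subStrategy B n (K.size j i))
        (subInput (B n) i (I j i) (K.size j i) (extendZero x)) / B n + 1)) +
      B n * Real.log n ^ 5 := by
  have hb : 0 < B n := by have := hA.2.1; omega
  have hb' : (0 : ℝ) < B n := by exact_mod_cast hb
  have hpool := h.sub_pool_le hP hA
  have hx01 : ∀ t, x t ∈ Set.Icc (0 : ℝ) 1 := fun t => by
    have := hx.mem t; rwa [extendZero_of_lt x t.2] at this
  have hv := (validStrategy_algAdapt B n).validOn hx01
  have hphase : K.phase = (stateAt (B n) n (subStrategy B n) (extendZero x) n).phase := by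
    rw [← hK]; rfl
  have hsize : K.size = (stateAt (B n) n (subStrategy B n) (extendZero x) n).size := by
    rw [← hK]; rfl
  rw [hphase, hsize]
  have hbuf := fun {j i m a d : ℕ} hj hm ha hd =>
    h.filledArray_buffer hA hx (j := j) (i := i) (m := m) (a := a) (d := d) hj hm ha hd
  generalize stateAt (B n) n (subStrategy B n) (extendZero x) n = s at *
  set α := extendZero (filledArray (algAdapt B n) x) with hα
  set g : ℕ → ℝ := fun c => if c + 1 < n then |α (c + 1) - α c| else 0 with hg
  have hα01 : ∀ c < n, α c ∈ Set.Icc (0 : ℝ) 1 := by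
    intro c hc
    obtain ⟨t, ht⟩ := hv.exists_filledArray_eq ⟨c, hc⟩
    rw [hα, extendZero_of_lt _ hc, ht]
    exact hx01 t
  have hg0 : ∀ c, 0 ≤ g c := fun c => by simp only [hg]; split_ifs <;> simp
  have hg1 : ∀ c, g c ≤ 1 := fun c => by
    simp only [hg]
    split_ifs with hc
    · exact abs_sub_le_one (hα01 _ hc) (hα01 _ (by omega))
    · exact zero_le_one
  have hpn : s.pool ≤ n := by have := h.pool_le; omega
  have hsum1 : cost (algAdapt B n) x ≤ ∑ c ∈ Finset.range n, g c := by
    rw [cost, adjacentCost_eq_sum_range]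
    calc _ = ∑ c ∈ Finset.range (n - 1), g c := Finset.sum_congr rfl fun c hc => by
          simp only [hg]
          rw [if_pos (by have := Finset.mem_range.1 hc; omega)]
      _ ≤ _ := Finset.sum_le_sum_of_subset_of_nonneg (Finset.range_mono (by omega))
          fun c _ _ => hg0 c
  have hsum2 : ∑ c ∈ Finset.range n, g c ≤
      ∑ c ∈ Finset.range s.pool, g c + ((n : ℝ) - s.pool) := by
    rw [← Finset.sum_range_add_sum_Ico _ hpn]
    gcongr
    calc ∑ c ∈ Finset.Ico s.pool n, g c ≤ ∑ c ∈ Finset.Ico s.pool n, 1 :=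
          Finset.sum_le_sum fun c _ => hg1 c
      _ = (n : ℝ) - s.pool := by simp [Nat.cast_sub hpn]
  -- the cells before the pool are partitioned into the buffers
  have hcover : Finset.range s.pool ⊆
      (Finset.Icc 1 s.phase ×ˢ Finset.range (B n)).biUnion
        fun q => Finset.Ico (s.start q.1 q.2) (s.start q.1 q.2 + s.size q.1 q.2) := by
    intro c hc
    obtain ⟨j, i, hj, h1, h2⟩ := h.exists_buffer c (Finset.mem_range.1 hc)
    exact Finset.mem_biUnion.2 ⟨(j, i), Finset.mem_product.2
      ⟨Finset.mem_Icc.2 ⟨hj.1, hj.2.1⟩, Finset.mem_range.2 hj.2.2⟩, Finset.mem_Ico.2 ⟨h1, h2⟩⟩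
  have hdisj : Set.PairwiseDisjoint
      (↑(Finset.Icc 1 s.phase ×ˢ Finset.range (B n)) : Set (ℕ × ℕ))
      fun q => Finset.Ico (s.start q.1 q.2) (s.start q.1 q.2 + s.size q.1 q.2) := by
    rintro ⟨j, i⟩ hji ⟨j', i'⟩ hji' hne
    simp only [Finset.coe_product, Set.mem_prod, Finset.coe_Icc, Set.mem_Icc, Finset.coe_range,
      Set.mem_Iio] at hji hji'
    refine Finset.disjoint_left.2 fun c hc hc' => hne ?_
    rw [Finset.mem_Ico] at hc hc'
    obtain ⟨rfl, rfl⟩ := h.buffer_unique c j i j' i' ⟨hji.1.1, hji.1.2, hji.2⟩ hc.1 hc.2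
      ⟨hji'.1.1, hji'.1.2, hji'.2⟩ hc'.1 hc'.2
    rfl
  have hsum3 : ∑ c ∈ Finset.range s.pool, g c ≤
      ∑ j ∈ Finset.Icc 1 s.phase, ∑ i ∈ Finset.range (B n),
        ∑ c ∈ Finset.Ico (s.start j i) (s.start j i + s.size j i), g c := by
    rw [← Finset.sum_product' (f := fun j i =>
        ∑ c ∈ Finset.Ico (s.start j i) (s.start j i + s.size j i), g c),
      ← Finset.sum_biUnion hdisj]
    exact Finset.sum_le_sum_of_subset_of_nonneg hcover fun c _ _ => hg0 c
  have hsum4 : ∀ j i, s.IsBuffer (B n) j i →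
      ∑ c ∈ Finset.Ico (s.start j i) (s.start j i + s.size j i), g c ≤
        cost (subStrategy B n (s.size j i))
          (subInput (B n) i (I j i) (s.size j i) (extendZero x)) / B n + 1 := by
    intro j i hj
    have hend := h.end_le j i hj
    have hbuf := fun {d : ℕ} hd => hbuf (d := d) hj rfl rfl hd
    rw [Finset.sum_Ico_eq_sum_range, Nat.add_sub_cancel_left, cost, adjacentCost_eq_sum_range]
    generalize s.size j i = m at *
    cases m with
    | zero => simp
    | succ m =>
      rw [Finset.sum_range_succ, Nat.add_sub_cancel, Finset.sum_div]
      refine add_le_add (Finset.sum_le_sum fun q hq => ?_) (hg1 _)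
      rw [Finset.mem_range] at hq
      simp only [hg]
      rw [if_pos (by omega), add_assoc, hbuf (d := q) (by omega), hbuf (d := q + 1) (by omega),
        ← sub_div, add_sub_add_left_eq_sub, abs_div, abs_of_pos hb']
  calc cost (algAdapt B n) x ≤ _ := hsum1.trans hsum2
    _ ≤ _ := add_le_add (hsum3.trans (Finset.sum_le_sum fun j hj =>
      Finset.sum_le_sum fun i hi => hsum4 j i ⟨(Finset.mem_Icc.1 hj).1, (Finset.mem_Icc.1 hj).2,
        Finset.mem_range.1 hi⟩)) hpool

end Cost

/-! ### Uniform segments and uniform items within the segments -/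

/-- The uniform distribution on `b` segments. -/
noncomputable def uniformSegment (b : ℕ) : Measure (Fin b) := (b : ENNReal)⁻¹ • Measure.count

theorem isProbabilityMeasure_uniformSegment {b : ℕ} (hb : 0 < b) :
    IsProbabilityMeasure (uniformSegment b) := by
  refine ⟨?_⟩
  rw [uniformSegment, Measure.smul_apply, Measure.count_univ]
  simp only [ENat.card_eq_coe_fintype_card, Fintype.card_fin, smul_eq_mul]
  exact ENNReal.inv_mul_cancel (by simpa using hb.ne') (ENNReal.natCast_ne_top b)

instance (b : ℕ) : IsFiniteMeasure (uniformSegment b) := by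
  rcases Nat.eq_zero_or_pos b with rfl | hb
  · exact ⟨by simp [uniformSegment, Measure.count_univ]⟩
  · have := isProbabilityMeasure_uniformSegment hb
    infer_instance

theorem integral_uniformSegment {b : ℕ} (f : Fin b → ℝ) :
    ∫ i, f i ∂uniformSegment b = (∑ i, f i) / b := by
  rw [uniformSegment, integral_smul_measure, integral_count]
  simp [div_eq_inv_mul]

/-- The law of the segments of `n` items. -/
noncomputable def uniformSegments (b n : ℕ) : Measure (Fin n → Fin b) :=
  Measure.pi fun _ => uniformSegment b

instance (b n : ℕ) : IsFiniteMeasure (uniformSegments b n) := by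
  unfold uniformSegments; infer_instance

theorem isProbabilityMeasure_uniformSegments {b : ℕ} (hb : 0 < b) (n : ℕ) :
    IsProbabilityMeasure (uniformSegments b n) := by
  have := isProbabilityMeasure_uniformSegment hb
  unfold uniformSegments; infer_instance

theorem sum_volume_inter_Ico {b : ℕ} (hb : 0 < b) {s : Set ℝ} (hs : MeasurableSet s) (k : ℕ) :
    ∑ i ∈ Finset.range k, volume (s ∩ Set.Ico ((i : ℝ) / b) ((i + 1) / b)) =
      volume (s ∩ Set.Ico 0 ((k : ℝ) / b)) := by
  have hb' : (0 : ℝ) < b := by exact_mod_cast hb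
  induction k with
  | zero => simp
  | succ k ih =>
    rw [Finset.sum_range_succ, ih, ← measure_union]
    · rw [← Set.inter_union_distrib_left,
        Set.Ico_union_Ico_eq_Ico (by positivity) (by gcongr; simp)]
      push_cast
      rfl
    · refine Disjoint.mono Set.inter_subset_right Set.inter_subset_right ?_
      exact Set.Ico_disjoint_Ico_same
    · exact hs.inter measurableSet_Ico

theorem restrict_Icc_eq_restrict_Ico :
    volume.restrict (Set.Icc (0 : ℝ) 1) = volume.restrict (Set.Ico (0 : ℝ) 1) :=
  Measure.restrict_congr_set Ico_ae_eq_Icc.symm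

/-- A uniform item from a uniform segment is uniform on `[0, 1]`. -/
theorem measurePreserving_segment {b : ℕ} (hb : 0 < b) :
    MeasurePreserving (fun q : Fin b × ℝ => ((q.1 : ℝ) + q.2) / b)
      ((uniformSegment b).prod (volume.restrict (Set.Icc (0 : ℝ) 1)))
      (volume.restrict (Set.Icc (0 : ℝ) 1)) := by
  have hb' : (0 : ℝ) < b := by exact_mod_cast hb
  have hmeas : Measurable fun q : Fin b × ℝ => ((q.1 : ℝ) + q.2) / b := by fun_prop
  refine ⟨hmeas, ?_⟩
  rw [restrict_Icc_eq_restrict_Ico]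
  ext s hs
  rw [Measure.map_apply hmeas hs, Measure.prod_apply (hmeas hs), uniformSegment,
    lintegral_smul_measure, lintegral_count, tsum_fintype, Measure.restrict_apply hs]
  have key : ∀ i : Fin b, volume.restrict (Set.Ico (0 : ℝ) 1)
      (Prod.mk i ⁻¹' ((fun q : Fin b × ℝ => ((q.1 : ℝ) + q.2) / b) ⁻¹' s)) =
      b * volume (s ∩ Set.Ico ((i : ℝ) / b) (((i : ℕ) + 1 : ℝ) / b)) := by
    intro i
    rw [Measure.restrict_apply (measurable_prodMk_left (hmeas hs))]
    have hset : Prod.mk i ⁻¹' ((fun q : Fin b × ℝ => ((q.1 : ℝ) + q.2) / b) ⁻¹' s) ∩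
        Set.Ico (0 : ℝ) 1 = (fun u : ℝ => (i : ℝ) + u) ⁻¹' ((fun v : ℝ => (b : ℝ)⁻¹ * v) ⁻¹'
          (s ∩ Set.Ico ((i : ℝ) / b) (((i : ℕ) + 1 : ℝ) / b))) := by
      ext u
      simp only [Set.mem_inter_iff, Set.mem_preimage, Set.mem_Ico, ← div_eq_inv_mul]
      refine and_congr_right fun _ => ?_
      rw [div_le_div_iff_of_pos_right hb', div_lt_div_iff_of_pos_right hb']
      constructor <;> rintro ⟨h1, h2⟩ <;> constructor <;> linarith
    rw [hset, measure_preimage_add, Real.volume_preimage_mul_left (inv_ne_zero hb'.ne'), inv_inv,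
      abs_of_pos hb', ENNReal.ofReal_natCast]
  simp only [key]
  rw [← Finset.mul_sum, smul_eq_mul, ← mul_assoc, ENNReal.inv_mul_cancel (by simpa using hb.ne')
    (ENNReal.natCast_ne_top b), one_mul,
    Fin.sum_univ_eq_sum_range (fun i : ℕ => volume (s ∩ Set.Ico ((i : ℝ) / b) ((i + 1) / b))) b,
    sum_volume_inter_Ico hb hs, div_self hb'.ne']

/-- The input with given segments `τ` and given relative positions `u` within the segments. -/
noncomputable def joinSegments {b n : ℕ} (τ : Fin n → Fin b) (u : Fin n → ℝ) : Fin n → ℝ :=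
  fun t => ((τ t : ℝ) + u t) / b

/-- Independent uniform segments and independent uniform positions within them yield independent
uniform items. -/
theorem measurePreserving_joinSegments {b : ℕ} (hb : 0 < b) (n : ℕ) :
    MeasurePreserving (fun q : (Fin n → Fin b) × (Fin n → ℝ) => joinSegments q.1 q.2)
      ((uniformSegments b n).prod (uniformInput n)) (uniformInput n) := by
  have h1 := (measurePreserving_arrowProdEquivProdArrow (Fin b) ℝ (Fin n)
    (fun _ => uniformSegment b) (fun _ => volume.restrict (Set.Icc (0 : ℝ) 1))).symm
  exact (measurePreserving_pi _ _ fun _ : Fin n => measurePreserving_segment hb).comp h1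

theorem ae_mem_Ico (n : ℕ) : ∀ᵐ u ∂uniformInput n, ∀ i, u i ∈ Set.Ico (0 : ℝ) 1 := by
  have : uniformInput n =
      (Measure.pi fun _ : Fin n => (volume : Measure ℝ)).restrict
        (Set.univ.pi fun _ => Set.Ico (0 : ℝ) 1) := by
    rw [Measure.restrict_pi_pi, ← restrict_Icc_eq_restrict_Ico]; rfl
  rw [this]
  filter_upwards [ae_restrict_mem (MeasurableSet.univ_pi fun _ => measurableSet_Ico)] with x hx i
  exact hx i (Set.mem_univ i)

theorem hasSegments_joinSegments {b n : ℕ} (hb : 0 < b) (τ : Fin n → Fin b) {u : Fin n → ℝ}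
    (hu : ∀ i, u i ∈ Set.Ico (0 : ℝ) 1) :
    HasSegments b (extendSegments τ) (extendZero (joinSegments τ u)) := by
  have hb' : (0 : ℝ) < b := by exact_mod_cast hb
  refine hasSegments_extendZero (fun i => ⟨?_, ?_⟩) fun i => ?_
  · exact div_nonneg (add_nonneg (Nat.cast_nonneg _) (hu i).1) hb'.le
  · have h1 : ((τ i : ℕ) : ℝ) + 1 ≤ b := by exact_mod_cast (τ i).2
    rw [joinSegments, div_le_one hb']
    linarith [(hu i).2]
  · unfold segment joinSegments
    rw [mul_div_cancel₀ _ hb'.ne', add_comm, Nat.floor_add_natCast (hu i).1,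
      Nat.floor_eq_zero.2 (hu i).2]
    have := (τ i).2
    omega

/-- Selecting some of the items, in any order, again gives independent uniform items. -/
theorem measurePreserving_comp {m n : ℕ} {e : Fin m → Fin n} (he : Function.Injective e) :
    MeasurePreserving (fun u : Fin n → ℝ => u ∘ e) (uniformInput n) (uniformInput m) := by
  have hprob : IsProbabilityMeasure (volume.restrict (Set.Icc (0 : ℝ) 1)) := ⟨by simp⟩
  have hmeas : ∀ i : Fin n, Measurable fun u : Fin n → ℝ => u i := measurable_pi_apply
  have h1 : ProbabilityTheory.iIndepFun (fun (i : Fin n) (u : Fin n → ℝ) => u i)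
      (uniformInput n) :=
    ProbabilityTheory.iIndepFun_pi
      (μ := fun _ : Fin n => volume.restrict (Set.Icc (0 : ℝ) 1))
      (X := fun _ => id) fun _ => aemeasurable_id
  have h2 := (ProbabilityTheory.iIndepFun_iff_map_fun_eq_pi_map
    fun i => (hmeas (e i)).aemeasurable).1 (h1.precomp he)
  refine ⟨measurable_pi_lambda _ fun i => hmeas (e i), ?_⟩
  refine h2.trans ?_
  unfold uniformInput
  congr 1
  funext i
  exact (measurePreserving_eval (fun _ : Fin n => volume.restrict (Set.Icc (0 : ℝ) 1)) (e i)).map_eq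

/-- The expected cost of the algorithm on uniformly random input. -/
noncomputable def expectedCost (B : ℕ → ℕ) (n : ℕ) : ℝ :=
  ∫ x, cost (algAdapt B n) x ∂uniformInput n

theorem expectedCost_le (B : ℕ → ℕ) (n : ℕ) : expectedCost B n ≤ n := by
  unfold expectedCost
  calc _ ≤ ∫ _x : Fin n → ℝ, (n : ℝ) ∂uniformInput n := by
        refine integral_mono_ae (integrable_cost B n) (integrable_const _) ?_
        filter_upwards [ae_mem_cube n] with x hx
        exact ((validStrategy_algAdapt B n).validOn hx).cost_le hx
    _ = n := by simp

/-- Given the segments of the items, the items of each buffer are independent and uniform on the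
segment. Hence the expected cost within a buffer is the expected cost of the recursive call, divided
by the number of segments. -/
theorem integral_cost_joinSegments_le {B : ℕ → ℕ} {n : ℕ} (hA : Admissible (B n) n)
    {τ : Fin n → Fin (B n)} (hτ : ¬ Unbalanced (B n) n (extendSegments τ)) :
    ∃ (J : ℕ) (m : ℕ → ℕ → ℕ),
      (1 ≤ Real.log (Real.log n) →
        (J : ℝ) ≤ (1 / Real.log (3 / 2) + 1) * Real.log (Real.log n)) ∧
      (∀ j ∈ Finset.Icc 1 J, ∀ i ∈ Finset.range (B n), m j i < n ∧
        (m j i : ℝ) ≤ ((n : ℝ) / B n) ^ ((2 / 3 : ℝ) ^ (j - 1))) ∧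
      ∫ u, cost (algAdapt B n) (joinSegments τ u) ∂uniformInput n ≤
        (∑ j ∈ Finset.Icc 1 J, ∑ i ∈ Finset.range (B n), (expectedCost B (m j i) / B n + 1)) +
          B n * Real.log n ^ 5 := by
  have hb : 0 < B n := by have := hA.2.1; omega
  have hb' : (0 : ℝ) < B n := by exact_mod_cast hb
  have hsub : ∀ m < n, ValidStrategy (subStrategy B n m) m :=
    fun m hm => validStrategy_subStrategy B hm
  have hσ := extendSegments_lt hb τ
  obtain ⟨K, hK, h | ⟨I, p, h⟩⟩ := simulation hA hsub hσ le_rfl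
  · exact absurd h.2 hτ
  obtain ⟨x₀, hx₀⟩ := exists_hasSegments hb hσ
  obtain ⟨hL₀, hP₀⟩ := h x₀ hx₀
  have hphase : K.phase = (stateAt (B n) n (subStrategy B n) x₀ n).phase := by
    rw [← hK x₀ hx₀]; rfl
  have hsize : K.size = (stateAt (B n) n (subStrategy B n) x₀ n).size := by
    rw [← hK x₀ hx₀]; rfl
  have hbuf : ∀ j ∈ Finset.Icc 1 K.phase, ∀ i ∈ Finset.range (B n),
      (stateAt (B n) n (subStrategy B n) x₀ n).IsBuffer (B n) j i := by
    intro j hj i hi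
    rw [hphase, Finset.mem_Icc] at hj
    exact ⟨hj.1, hj.2, Finset.mem_range.1 hi⟩
  refine ⟨K.phase, K.size, fun hn => ?_, fun j hj i hi => ?_, ?_⟩
  · rw [hphase]; exact hP₀.phase_le hA hn
  · rw [hsize]; exact ⟨hL₀.size_lt hA (hbuf j hj i hi), hL₀.size_le j i (hbuf j hj i hi)⟩
  -- the items of the buffer `(j, i)`
  have hitems : ∀ j ∈ Finset.Icc 1 K.phase, ∀ i ∈ Finset.range (B n),
      ∃ e : Fin (K.size j i) → Fin n, Function.Injective e ∧ ∀ u : Fin n → ℝ,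
        subInput (B n) i (I j i) (K.size j i) (extendZero (joinSegments τ u)) = u ∘ e := by
    intro j hj i hi
    have hlen := hL₀.length_times (hbuf j hj i hi)
    rw [← hsize] at hlen
    have hlt : ∀ q : Fin (K.size j i), (q : ℕ) < (I j i).length := fun q => by
      rw [hlen]; exact q.2
    refine ⟨fun q => ⟨(I j i)[(q : ℕ)]'(hlt q), hL₀.times_lt j i _ (List.getElem_mem _)⟩, ?_, ?_⟩
    · intro q q' hqq
      have := (List.Nodup.getElem_inj_iff (hL₀.times_nodup j i)).1 (Fin.mk.inj_iff.1 hqq)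
      exact Fin.ext this
    · intro u
      funext q
      have hlt' := hL₀.times_lt j i _ (List.getElem_mem (hlt q))
      have hseg : extendSegments τ ((I j i)[(q : ℕ)]'(hlt q)) = i := by
        rw [← hx₀.segment_eq]
        exact hL₀.times_segment j i _ (List.getElem_mem _)
      rw [subInput, Function.comp_apply, extendZero_of_lt _ (hlt q), Function.comp_apply]
      change (B n : ℝ) * extendZero (joinSegments τ u) ((I j i)[(q : ℕ)]'(hlt q)) - i = _
      rw [extendZero_of_lt _ hlt', joinSegments, mul_div_cancel₀ _ hb'.ne']
      rw [extendSegments, dif_pos hlt'] at hseg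
      rw [hseg, add_sub_cancel_left]
  set z : (j i : ℕ) → (Fin n → ℝ) → Fin (K.size j i) → ℝ := fun j i u =>
    subInput (B n) i (I j i) (K.size j i) (extendZero (joinSegments τ u)) with hz
  have hint : ∀ j ∈ Finset.Icc 1 K.phase, ∀ i ∈ Finset.range (B n),
      Integrable (fun u : Fin n → ℝ => cost (algAdapt B (K.size j i)) (z j i u))
        (uniformInput n) ∧
      ∫ u, cost (algAdapt B (K.size j i)) (z j i u) ∂uniformInput n =
        expectedCost B (K.size j i) := by
    intro j hj i hi
    obtain ⟨e, he1, he2⟩ := hitems j hj i hi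
    have hze : z j i = fun u => u ∘ e := funext he2
    rw [hze]
    have hmp := measurePreserving_comp he1
    have hcost := integrable_cost B (K.size j i)
    refine ⟨(hmp.integrable_comp hcost.aestronglyMeasurable).2 hcost, ?_⟩
    unfold expectedCost
    rw [← hmp.map_eq, integral_map hmp.aemeasurable]
    rw [hmp.map_eq]
    exact hcost.aestronglyMeasurable
  have hint' : ∀ j ∈ Finset.Icc 1 K.phase, ∀ i ∈ Finset.range (B n),
      Integrable (fun u : Fin n → ℝ => cost (algAdapt B (K.size j i)) (z j i u) / B n + 1)
        (uniformInput n) := fun j hj i hi =>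
    ((hint j hj i hi).1.div_const _).add (integrable_const _)
  have hint'' : Integrable (fun u : Fin n → ℝ => ∑ j ∈ Finset.Icc 1 K.phase,
      ∑ i ∈ Finset.range (B n), (cost (algAdapt B (K.size j i)) (z j i u) / B n + 1))
        (uniformInput n) :=
    integrable_finsetSum _ fun j hj => integrable_finsetSum _ fun i hi => hint' j hj i hi
  calc ∫ u, cost (algAdapt B n) (joinSegments τ u) ∂uniformInput n
      ≤ ∫ u, ((∑ j ∈ Finset.Icc 1 K.phase, ∑ i ∈ Finset.range (B n),
          (cost (algAdapt B (K.size j i)) (z j i u) / B n + 1)) +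
            B n * Real.log n ^ 5) ∂uniformInput n := by
        refine integral_mono_of_nonneg (Eventually.of_forall fun _ => cost_nonneg _ _)
          (hint''.add (integrable_const _)) ?_
        filter_upwards [ae_mem_Ico n] with u hu
        have hx := hasSegments_joinSegments hb τ hu
        obtain ⟨hL, hP⟩ := h _ hx
        refine (hL.cost_le hP hA hx (hK _ hx)).trans (le_of_eq ?_)
        congr 1
        refine Finset.sum_congr rfl fun j hj => Finset.sum_congr rfl fun i hi => ?_
        rw [subStrategy_of_lt B]
        rw [hsize]
        exact hL₀.size_lt hA (hbuf j hj i hi)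
    _ = _ := by
        rw [integral_add hint'' (integrable_const _), integral_finsetSum _ fun j hj =>
          integrable_finsetSum _ fun i hi => hint' j hj i hi]
        congr 1
        · refine Finset.sum_congr rfl fun j hj => ?_
          rw [integral_finsetSum _ fun i hi => hint' j hj i hi]
          refine Finset.sum_congr rfl fun i hi => ?_
          rw [integral_add ((hint j hj i hi).1.div_const _) (integrable_const _), integral_div,
            (hint j hj i hi).2]
          simp
        · simp

/-! ### Concentration -/

/-- The moment generating function of the number of items of segment `i` in a time window. -/
theorem integral_exp_tally {b n : ℕ} (hb : 0 < b) {i : ℕ} (hi : i < b) {a k : ℕ} (hk : k ≤ n)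
    (θ : ℝ) :
    ∫ τ, Real.exp (θ * tally (extendSegments τ) i a k) ∂uniformSegments b n =
      (1 + (Real.exp θ - 1) / b) ^ (k - a) := by
  have hb' : (b : ℝ) ≠ 0 := by exact_mod_cast hb.ne'
  have := isProbabilityMeasure_uniformSegment hb
  have h1 : ∀ τ : Fin n → Fin b, Real.exp (θ * tally (extendSegments τ) i a k) =
      ∏ t : Fin n, if (a ≤ (t : ℕ) ∧ (t : ℕ) < k) ∧ τ t = ⟨i, hi⟩ then Real.exp θ else 1 := by
    intro τ
    have h2 : tally (extendSegments τ) i a k = (Finset.univ.filter fun t : Fin n =>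
        (a ≤ (t : ℕ) ∧ (t : ℕ) < k) ∧ τ t = ⟨i, hi⟩).card := by
      unfold tally
      symm
      refine Finset.card_bij (fun t _ => (t : ℕ)) ?_ (fun _ _ _ _ h => Fin.ext h) ?_
      · intro t ht
        rw [Finset.mem_filter] at ht ⊢
        rw [Finset.mem_Ico]
        refine ⟨ht.2.1, ?_⟩
        rw [extendSegments, dif_pos t.2, Fin.eta, ht.2.2]
      · intro t ht
        rw [Finset.mem_filter, Finset.mem_Ico] at ht
        have htn : t < n := by omega
        refine ⟨⟨t, htn⟩, ?_, rfl⟩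
        rw [extendSegments, dif_pos htn] at ht
        rw [Finset.mem_filter]
        exact ⟨Finset.mem_univ _, ht.1, Fin.ext ht.2⟩
    rw [h2, Finset.prod_ite, Finset.prod_const, Finset.prod_const_one, mul_one, ← Real.exp_nat_mul,
      mul_comm]
  simp only [h1]
  rw [uniformSegments, integral_fintype_prod_eq_prod (fun (t : Fin n) (y : Fin b) =>
    if (a ≤ (t : ℕ) ∧ (t : ℕ) < k) ∧ y = ⟨i, hi⟩ then Real.exp θ else 1)]
  have h3 : ∀ t : Fin n, ∫ y, (if (a ≤ (t : ℕ) ∧ (t : ℕ) < k) ∧ y = ⟨i, hi⟩ then Real.exp θ else 1)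
      ∂uniformSegment b =
        (fun t : ℕ => if a ≤ t ∧ t < k then 1 + (Real.exp θ - 1) / b else 1) t := by
    intro t
    rw [integral_uniformSegment]
    by_cases ht : a ≤ (t : ℕ) ∧ (t : ℕ) < k
    · have h4 : ∀ y : Fin b, (if (a ≤ (t : ℕ) ∧ (t : ℕ) < k) ∧ y = ⟨i, hi⟩ then Real.exp θ else 1) =
          1 + if y = ⟨i, hi⟩ then Real.exp θ - 1 else 0 := by
        intro y
        simp only [ht, and_self, true_and]
        split_ifs <;> ring
      rw [Finset.sum_congr rfl fun y _ => h4 y, Finset.sum_add_distrib, Finset.sum_ite_eq',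
        if_pos (Finset.mem_univ _)]
      simp only [if_pos ht, Finset.sum_const, Finset.card_univ, Fintype.card_fin, nsmul_eq_mul,
        mul_one]
      field_simp
    · simp [ht, hb']
  rw [Finset.prod_congr rfl fun t _ => h3 t, Fin.prod_univ_eq_prod_range
    (fun t : ℕ => if a ≤ t ∧ t < k then 1 + (Real.exp θ - 1) / b else 1) n, Finset.prod_ite,
    Finset.prod_const, Finset.prod_const_one, mul_one, ← Nat.card_Ico a k]
  congr 2
  ext t
  simp only [Finset.mem_filter, Finset.mem_range, Finset.mem_Ico]
  omega

theorem mgf_tally_le {b n : ℕ} (hb : 0 < b) {i : ℕ} (hi : i < b) {a k : ℕ} (hk : k ≤ n)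
    {θ : ℝ} (hθ : |θ| ≤ 1) :
    ProbabilityTheory.mgf (fun τ : Fin n → Fin b => (tally (extendSegments τ) i a k : ℝ))
      (uniformSegments b n) θ ≤ Real.exp (((k - a : ℕ) : ℝ) / b * (θ + θ ^ 2)) := by
  have hb' : (1 : ℝ) ≤ b := by exact_mod_cast hb
  have h1 : Real.exp θ - 1 ≤ θ + θ ^ 2 := by
    have := (abs_le.1 (Real.abs_exp_sub_one_sub_id_le hθ)).2
    linarith
  have h2 : 0 ≤ 1 + (Real.exp θ - 1) / b := by
    have h3 : -1 ≤ (Real.exp θ - 1) / b := by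
      rw [le_div_iff₀ (by linarith)]
      linarith [Real.exp_pos θ]
    linarith
  rw [ProbabilityTheory.mgf, integral_exp_tally hb hi hk]
  calc (1 + (Real.exp θ - 1) / b) ^ (k - a)
      ≤ Real.exp ((θ + θ ^ 2) / b) ^ (k - a) := by
        refine pow_le_pow_left₀ h2 ?_ _
        rw [add_comm]
        refine le_trans ?_ (Real.add_one_le_exp _)
        gcongr
    _ = _ := by rw [← Real.exp_nat_mul]; congr 1; ring

/-- The Chernoff bound for a window of length at most `r`: it is decisive that the variance
is `r / b` and not `r`. -/
theorem measureReal_deviation_le {b n : ℕ} (hb : 0 < b) {i : ℕ} (hi : i < b) {a k r : ℕ}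
    (hk : k ≤ n) (hr : k - a ≤ r) (hμ : 1 ≤ (r : ℝ) / b) :
    (uniformSegments b n).real {τ | 1 / 4 * ((r : ℝ) / b) ^ (2 / 3 : ℝ) <
        |(tally (extendSegments τ) i a k : ℝ) - ((k - a : ℕ) : ℝ) / b|} ≤
      2 * Real.exp (-(((r : ℝ) / b) ^ (1 / 3 : ℝ) / 64)) := by
  have := isProbabilityMeasure_uniformSegments hb n
  have hb' : (0 : ℝ) < b := by exact_mod_cast hb
  have hLle : ((k - a : ℕ) : ℝ) / b ≤ (r : ℝ) / b := by gcongr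
  have hL0 : 0 ≤ ((k - a : ℕ) : ℝ) / b := by positivity
  have hmgf := fun (θ : ℝ) (hθ : |θ| ≤ 1) => mgf_tally_le hb hi (a := a) hk hθ
  generalize ((k - a : ℕ) : ℝ) / b = L at *
  generalize (r : ℝ) / b = μ at *
  -- in terms of `w = μ ^ (1 / 3)`, the deviation is `w ^ 2 / 4`, and the best parameter `1 / (8 w)`
  set w : ℝ := μ ^ (1 / 3 : ℝ) with hw
  have hw1 : 1 ≤ w := Real.one_le_rpow hμ (by norm_num)
  have hw2 : μ ^ (2 / 3 : ℝ) = w ^ 2 := by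
    rw [hw, ← Real.rpow_natCast, ← Real.rpow_mul (by linarith)]; norm_num
  have hw3 : μ = w ^ 3 := by
    rw [hw, ← Real.rpow_natCast, ← Real.rpow_mul (by linarith)]; norm_num
  rw [hw2]
  set X : (Fin n → Fin b) → ℝ := fun τ => (tally (extendSegments τ) i a k : ℝ) with hX
  have hint : ∀ θ : ℝ, Integrable (fun τ => Real.exp (θ * X τ)) (uniformSegments b n) :=
    fun θ => Integrable.of_finite
  set θ : ℝ := 1 / (8 * w) with hθ
  have hθ0 : 0 ≤ θ := by positivity
  have hθ1 : θ ≤ 1 := by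
    rw [hθ, div_le_one (by positivity)]; linarith
  have hexp : L * θ ^ 2 - θ * (1 / 4 * w ^ 2) ≤ -(w / 64) := by
    have h1 : L * θ ^ 2 ≤ w ^ 3 * θ ^ 2 := by rw [hw3] at hLle; gcongr
    have h2 : w ^ 3 * θ ^ 2 - θ * (1 / 4 * w ^ 2) = -(w / 64) := by
      rw [hθ]; field_simp; ring
    linarith
  have hup : (uniformSegments b n).real {τ | L + 1 / 4 * w ^ 2 ≤ X τ} ≤ Real.exp (-(w / 64)) := by
    refine (ProbabilityTheory.measure_ge_le_exp_mul_mgf _ hθ0 (hint θ)).trans ?_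
    refine (mul_le_mul_of_nonneg_left (hmgf θ (by rwa [abs_of_nonneg hθ0]))
      (Real.exp_pos _).le).trans ?_
    rw [← Real.exp_add]
    refine Real.exp_le_exp.2 (le_trans (le_of_eq ?_) hexp)
    ring
  have hlow : (uniformSegments b n).real {τ | X τ ≤ L - 1 / 4 * w ^ 2} ≤
      Real.exp (-(w / 64)) := by
    refine (ProbabilityTheory.measure_le_le_exp_mul_mgf _ (neg_nonpos.2 hθ0) (hint (-θ))).trans ?_
    refine (mul_le_mul_of_nonneg_left (hmgf (-θ) (by rwa [abs_neg, abs_of_nonneg hθ0]))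
      (Real.exp_pos _).le).trans ?_
    rw [← Real.exp_add]
    refine Real.exp_le_exp.2 (le_trans (le_of_eq ?_) hexp)
    ring
  have hsub : {τ | 1 / 4 * w ^ 2 < |X τ - L|} ⊆
      {τ | L + 1 / 4 * w ^ 2 ≤ X τ} ∪ {τ | X τ ≤ L - 1 / 4 * w ^ 2} := by
    intro τ hτ
    rcases lt_abs.1 (show 1 / 4 * w ^ 2 < |X τ - L| from hτ) with h | h
    · left; change L + 1 / 4 * w ^ 2 ≤ X τ; linarith
    · right; change X τ ≤ L - 1 / 4 * w ^ 2; linarith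
  calc _ ≤ _ := measureReal_mono hsub
    _ ≤ _ := measureReal_union_le _ _
    _ ≤ _ := by linarith

/-- A random sequence of segments is concentrated up to a probability that decreases faster than
every power of `n`. -/
theorem measureReal_not_concentrated_le {b n : ℕ} (hA : Admissible b n) :
    (uniformSegments b n).real {τ | ¬ Concentrated b n (extendSegments τ)} ≤
      2 * ((n : ℝ) + 1) ^ 2 * b * Real.exp (-(Real.log n ^ (5 / 3 : ℝ) / 64)) := by
  have hb : 0 < b := by have := hA.2.1; omega
  set bad : ℕ → ℕ → ℕ → Set (Fin n → Fin b) := fun r k i =>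
    {τ | ((b : ℝ) * Real.log n ^ 5 ≤ r ∧ n ≤ k + r) ∧ 1 / 4 * ((r : ℝ) / b) ^ (2 / 3 : ℝ) <
        |(tally (extendSegments τ) i (n - r) k : ℝ) - ((k - (n - r) : ℕ) : ℝ) / b|} with hbad
  have hsub : {τ : Fin n → Fin b | ¬ Concentrated b n (extendSegments τ)} ⊆
      ⋃ r ∈ Finset.range (n + 1), ⋃ k ∈ Finset.range (n + 1), ⋃ i ∈ Finset.range b, bad r k i := by
    intro τ hτ
    have hτ' : ¬ Concentrated b n (extendSegments τ) := hτ
    unfold Concentrated at hτ'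
    push Not at hτ'
    obtain ⟨r, hr, hlog, k, hk, hkr, i, hi, hdev⟩ := hτ'
    simp only [Set.mem_iUnion, Finset.mem_range]
    exact ⟨r, by omega, k, by omega, i, hi, ⟨hlog, hkr⟩, hdev⟩
  have hlog0 : 0 ≤ Real.log n := Real.log_natCast_nonneg n
  have hone : ∀ r ∈ Finset.range (n + 1), ∀ k ∈ Finset.range (n + 1), ∀ i ∈ Finset.range b,
      (uniformSegments b n).real (bad r k i) ≤
        2 * Real.exp (-(Real.log n ^ (5 / 3 : ℝ) / 64)) := by
    intro r hr k hk i hi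
    rw [Finset.mem_range] at hr hk hi
    by_cases hc : (b : ℝ) * Real.log n ^ 5 ≤ r ∧ n ≤ k + r
    · have hμ := hA.log_pow_le_div hc.1
      have h1 := measureReal_deviation_le hb hi (a := n - r) (k := k) (r := r) (n := n) (by omega)
        (by omega) (by linarith [hA.four_le_log_pow])
      have h2 : Real.log n ^ (5 / 3 : ℝ) ≤ ((r : ℝ) / b) ^ (1 / 3 : ℝ) := by
        calc Real.log n ^ (5 / 3 : ℝ) = (Real.log n ^ 5) ^ (1 / 3 : ℝ) := by
              rw [← Real.rpow_natCast, ← Real.rpow_mul hlog0]; norm_num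
          _ ≤ _ := by gcongr
      refine (measureReal_mono ?_).trans (h1.trans ?_)
      · intro τ hτ; exact hτ.2
      · gcongr
    · have : bad r k i = ∅ := by
        ext τ; simp only [hbad, Set.mem_empty_iff_false, iff_false]; exact fun h => hc h.1
      rw [this, measureReal_empty]
      positivity
  calc _ ≤ (uniformSegments b n).real (⋃ r ∈ Finset.range (n + 1), ⋃ k ∈ Finset.range (n + 1),
        ⋃ i ∈ Finset.range b, bad r k i) :=
      measureReal_mono hsub (measure_ne_top _ _)
    _ ≤ ∑ r ∈ Finset.range (n + 1), ∑ k ∈ Finset.range (n + 1), ∑ i ∈ Finset.range b,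
        (uniformSegments b n).real (bad r k i) := by
      refine (measureReal_biUnion_finset_le _ _).trans (Finset.sum_le_sum fun r _ => ?_)
      refine (measureReal_biUnion_finset_le _ _).trans (Finset.sum_le_sum fun k _ => ?_)
      exact measureReal_biUnion_finset_le _ _
    _ ≤ ∑ r ∈ Finset.range (n + 1), ∑ k ∈ Finset.range (n + 1), ∑ i ∈ Finset.range b,
        2 * Real.exp (-(Real.log n ^ (5 / 3 : ℝ) / 64)) :=
      Finset.sum_le_sum fun r hr => Finset.sum_le_sum fun k hk => Finset.sum_le_sum fun i hi =>
        hone r hr k hk i hi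
    _ = _ := by
      simp only [Finset.sum_const, Finset.card_range, nsmul_eq_mul]
      push_cast
      ring

/-! ### The failure probability -/

section Recursion

variable {B : ℕ → ℕ}

theorem tendsto_log_natCast : Tendsto (fun n : ℕ => Real.log n) atTop atTop :=
  Real.tendsto_log_atTop.comp tendsto_natCast_atTop_atTop

/-- As `log ^ (5 / 3) n` grows faster than `log n`, the Chernoff bound beats every power of `n`. -/
theorem eventually_measureReal_unbalanced_le
    (hB : (fun n : ℕ => (B n : ℝ)) =Θ[atTop] (fun n : ℕ => Real.log n)) :
    ∀ᶠ n : ℕ in atTop, (uniformSegments (B n) n).real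
      {τ | Unbalanced (B n) n (extendSegments τ)} ≤ 1 / (n : ℝ) ^ 10 := by
  have hlog23 : Tendsto (fun n : ℕ => Real.log n ^ (2 / 3 : ℝ)) atTop atTop :=
    (tendsto_rpow_atTop (by norm_num)).comp tendsto_log_natCast
  have hlog5 : Tendsto (fun n : ℕ => Real.log n ^ 5) atTop atTop :=
    (tendsto_pow_atTop (by norm_num)).comp tendsto_log_natCast
  filter_upwards [eventually_admissible hB, hlog23.eventually_ge_atTop 1280,
    hlog5.eventually_ge_atTop 512] with n hA h1280 h512
  have hb : 0 < B n := by have := hA.2.1; omega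
  have hn : (4 : ℝ) ≤ n := by exact_mod_cast hA.1
  have hlog : 0 < Real.log n := Real.log_pos (by linarith)
  have hBn : (B n : ℝ) ≤ n := by
    have h1 := hA.2.2
    have h2 := hA.pos
    nlinarith
  have hexp : Real.exp (-(Real.log n ^ (5 / 3 : ℝ) / 64)) ≤ 1 / (n : ℝ) ^ 20 := by
    have h1 : Real.log n ^ (5 / 3 : ℝ) = Real.log n * Real.log n ^ (2 / 3 : ℝ) := by
      rw [← Real.rpow_one_add' hlog.le (by norm_num)]; norm_num
    calc Real.exp (-(Real.log n ^ (5 / 3 : ℝ) / 64)) ≤ Real.exp (-(20 * Real.log n)) := by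
          refine Real.exp_le_exp.2 ?_
          rw [h1]
          nlinarith
      _ = 1 / (n : ℝ) ^ 20 := by
          rw [Real.exp_neg, one_div, mul_comm, Real.exp_mul, Real.exp_log (by linarith)]
          norm_cast
  calc _ ≤ (uniformSegments (B n) n).real {τ | ¬ Concentrated (B n) n (extendSegments τ)} := by
        refine measureReal_mono fun τ hτ hc => ?_
        exact hc.not_unbalanced hA.pos h512 (extendSegments_lt hb τ) hτ
    _ ≤ _ := measureReal_not_concentrated_le hA
    _ ≤ 2 * ((n : ℝ) + n) ^ 2 * n * (1 / (n : ℝ) ^ 20) := by gcongr; linarith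
    _ = (8 * (n : ℝ) ^ 3) / (n : ℝ) ^ 20 := by ring
    _ ≤ (n : ℝ) ^ 10 / (n : ℝ) ^ 20 := by
        gcongr
        calc 8 * (n : ℝ) ^ 3 ≤ (n : ℝ) ^ 7 * (n : ℝ) ^ 3 := by
              gcongr
              calc (8 : ℝ) ≤ 4 ^ 7 := by norm_num
                _ ≤ (n : ℝ) ^ 7 := by gcongr
          _ = (n : ℝ) ^ 10 := by ring
    _ = 1 / (n : ℝ) ^ 10 := by field_simp

/-- The law of the segments of a uniform input is `uniformSegments`, and a failure forces the
sequence of segments to be unbalanced. -/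
theorem measureReal_fails_le {n : ℕ} (hb : 0 < B n) :
    (uniformInput n).real {x : Fin n → ℝ | Fails B x} ≤
      (uniformSegments (B n) n).real {τ | Unbalanced (B n) n (extendSegments τ)} := by
  have hprob := isProbabilityMeasure_uniformSegments hb n
  set bad : Set (Fin n → Fin (B n)) := {τ | Unbalanced (B n) n (extendSegments τ)} with hbad
  set T : Set (Fin n → ℝ) := ⋃ τ ∈ bad, segmentCell (B n) n (extendSegments τ) with hT
  have hTm : MeasurableSet T :=
    MeasurableSet.biUnion (Set.to_countable _) fun τ _ => measurableSet_segmentCell _ _ _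
  have h1 : uniformInput n {x : Fin n → ℝ | Fails B x} ≤ uniformInput n T := by
    refine measure_mono_ae ?_
    filter_upwards [ae_mem_cube n] with x hx hF
    have hseg := hasSegments_extendZero (b := B n)
      (τ := fun t => ⟨segment (B n) (x t), segment_lt hb _⟩) hx fun _ => rfl
    have hU := unbalanced_of_fails hx hF
    rw [funext hseg.segment_eq] at hU
    exact Set.mem_biUnion (show _ ∈ bad from hU) hseg
  have hmp := measurePreserving_joinSegments hb n
  have h2 : uniformInput n T ≤ uniformSegments (B n) n bad := by
    rw [← hmp.measure_preimage hTm.nullMeasurableSet]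
    calc _ ≤ ((uniformSegments (B n) n).prod (uniformInput n)) (bad ×ˢ Set.univ) := by
          refine measure_mono_ae ?_
          filter_upwards [Measure.quasiMeasurePreserving_snd.ae (ae_mem_Ico n)] with q hq hqT
          obtain ⟨τ, hτ, hx⟩ := Set.mem_iUnion₂.1 hqT
          refine ⟨?_, Set.mem_univ _⟩
          have heq : extendSegments q.1 = extendSegments τ := by
            funext t
            rw [← (hasSegments_joinSegments hb q.1 hq).segment_eq t]
            exact HasSegments.segment_eq hx t
          change Unbalanced (B n) n (extendSegments q.1)
          rw [heq]
          exact hτ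
      _ = _ := by rw [Measure.prod_prod, measure_univ, mul_one]
  exact ENNReal.toReal_mono (measure_ne_top _ _) (h1.trans h2)

/-! ### The expected cost -/

/-- The expected cost is split according to the segments: for unbalanced ones, the cost is bounded
by `n`. -/
theorem expectedCost_le_add {n : ℕ} (hb : 0 < B n) {R : ℝ} (hR0 : 0 ≤ R)
    (hR : ∀ τ : Fin n → Fin (B n), ¬ Unbalanced (B n) n (extendSegments τ) →
      ∫ u, cost (algAdapt B n) (joinSegments τ u) ∂uniformInput n ≤ R) :
    expectedCost B n ≤ R + n * (uniformSegments (B n) n).real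
      {τ | Unbalanced (B n) n (extendSegments τ)} := by
  classical
  have hprob := isProbabilityMeasure_uniformSegments hb n
  have hmp := measurePreserving_joinSegments hb n
  have hint := integrable_cost B n
  have hint' := (hmp.integrable_comp hint.aestronglyMeasurable).2 hint
  have h1 : expectedCost B n = ∫ τ, ∫ u, cost (algAdapt B n) (joinSegments τ u)
      ∂uniformInput n ∂uniformSegments (B n) n := by
    rw [expectedCost, ← hmp.map_eq, integral_map hmp.aemeasurable
      (by rw [hmp.map_eq]; exact hint.aestronglyMeasurable), hmp.map_eq]
    exact integral_prod _ hint'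
  rw [h1]
  calc _ ≤ ∫ τ : Fin n → Fin (B n), (R + n * Set.indicator
        {τ : Fin n → Fin (B n) | Unbalanced (B n) n (extendSegments τ)} (fun _ => (1 : ℝ)) τ)
          ∂uniformSegments (B n) n := by
        refine integral_mono Integrable.of_finite Integrable.of_finite fun τ => ?_
        by_cases hτ : Unbalanced (B n) n (extendSegments τ)
        · have h2 : ∫ u, cost (algAdapt B n) (joinSegments τ u) ∂uniformInput n ≤ n := by
            calc _ ≤ ∫ _u : Fin n → ℝ, (n : ℝ) ∂uniformInput n := by
                  refine integral_mono_of_nonneg (Eventually.of_forall fun _ => cost_nonneg _ _)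
                    (integrable_const _) ?_
                  filter_upwards [ae_mem_Ico n] with u hu
                  have hx : ∀ i, joinSegments τ u i ∈ Set.Icc (0 : ℝ) 1 := fun i => by
                    have := (hasSegments_joinSegments hb τ hu).mem i
                    rwa [extendZero_of_lt _ i.2] at this
                  exact ((validStrategy_algAdapt B n).validOn hx).cost_le hx
              _ = n := by simp
          simp only [Set.indicator_apply, Set.mem_ofPred_eq, hτ, if_true]
          linarith
        · simp only [Set.indicator_apply, Set.mem_ofPred_eq, hτ, if_false]
          have := hR τ hτ
          linarith
    _ = _ := by
        rw [integral_add (integrable_const _) Integrable.of_finite, integral_const_mul,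
          integral_indicator_const _ (Set.Finite.measurableSet (Set.toFinite _))]
        simp

/-- For every `ε > 0`, the side conditions of the recursion hold for large `n`; the recursion is
closed because the number of segments tends to infinity, so that already the first phase has
expected cost less than `n ^ ε`. -/
theorem eventually_recursion_small
    (hB : (fun n : ℕ => (B n : ℝ)) =Θ[atTop] (fun n : ℕ => Real.log n)) {ε : ℝ} (hε : 0 < ε)
    (c : ℝ) :
    ∀ᶠ n : ℕ in atTop, (4 : ℝ) ≤ (B n : ℝ) ^ ε ∧
      c * Real.log n ≤ 1 / 4 * (n : ℝ) ^ (ε / 3) ∧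
      c * Real.log n * B n + B n * Real.log n ^ 5 + 1 ≤ 1 / 4 * (n : ℝ) ^ ε := by
  have hBtop : Tendsto (fun n : ℕ => (B n : ℝ)) atTop atTop := by
    have := hB.tendsto_norm_atTop_iff.2 (tendsto_norm_atTop_atTop.comp tendsto_log_natCast)
    simpa [Function.comp_def] using this
  have hpow : ∀ (m : ℕ) (δ : ℝ), 0 < δ →
      (fun n : ℕ => Real.log n ^ m) =o[atTop] fun n : ℕ => (n : ℝ) ^ δ := by
    intro m δ hδ
    have := (isLittleO_log_rpow_rpow_atTop (m : ℝ) hδ).comp_tendsto tendsto_natCast_atTop_atTop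
    refine this.congr (fun n => ?_) fun n => rfl
    simp
  have h2 : (fun n : ℕ => c * Real.log n) =o[atTop] fun n : ℕ => (n : ℝ) ^ (ε / 3) := by
    have := (hpow 1 (ε / 3) (by positivity)).const_mul_left c
    simpa using this
  have h3 : (fun n : ℕ => c * Real.log n * B n + B n * Real.log n ^ 5 + 1) =o[atTop]
      fun n : ℕ => (n : ℝ) ^ ε := by
    have hB1 := hB.1
    have e1 : (fun n : ℕ => c * Real.log n * B n) =o[atTop] fun n : ℕ => (n : ℝ) ^ ε := by
      have : (fun n : ℕ => c * Real.log n * B n) =O[atTop]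
          fun n : ℕ => Real.log n * Real.log n := by
        simpa only [mul_assoc] using ((isBigO_refl (fun n : ℕ => Real.log n) atTop).mul
          hB1).const_mul_left c
      refine this.trans_isLittleO ((hpow 2 ε hε).congr_left fun n => ?_)
      ring
    have e2 : (fun n : ℕ => B n * Real.log n ^ 5) =o[atTop] fun n : ℕ => (n : ℝ) ^ ε := by
      refine (hB1.mul (isBigO_refl (fun n : ℕ => Real.log n ^ 5) atTop)).trans_isLittleO
        ((hpow 6 ε hε).congr_left fun n => ?_)
      ring
    have e3 : (fun _ : ℕ => (1 : ℝ)) =o[atTop] fun n : ℕ => (n : ℝ) ^ ε := by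
      simpa using hpow 0 ε hε
    exact (e1.add e2).add e3
  filter_upwards [((tendsto_rpow_atTop hε).comp hBtop).eventually_ge_atTop 4,
    h2.bound (show (0 : ℝ) < 1 / 4 by norm_num), h3.bound (show (0 : ℝ) < 1 / 4 by norm_num)]
    with n h4 h5 h6
  rw [Real.norm_of_nonneg (show 0 ≤ (n : ℝ) ^ (ε / 3) by positivity)] at h5
  rw [Real.norm_of_nonneg (show 0 ≤ (n : ℝ) ^ ε by positivity)] at h6
  exact ⟨h4, (Real.le_norm_self _).trans h5, (Real.le_norm_self _).trans h6⟩

/-- The recursion for the expected cost: if the cost of all smaller arrays is at most `C * m ^ ε`,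
then the first phase contributes at most `C * (n / b) ^ ε`, and each of the `O(log log n)` later
phases at most `C * n ^ (2 * ε / 3)`. -/
theorem expectedCost_le_of_forall_lt {n : ℕ} (hA : Admissible (B n) n)
    (hn : 1 ≤ Real.log (Real.log n)) {ε C : ℝ} (hε : 0 < ε) (hC : 0 ≤ C)
    (ih : ∀ m < n, expectedCost B m ≤ C * (m : ℝ) ^ ε) :
    expectedCost B n ≤ C * (((n : ℝ) / B n) ^ ε +
        (1 / Real.log (3 / 2) + 1) * Real.log n * (n : ℝ) ^ (2 / 3 * ε)) +
      ((1 / Real.log (3 / 2) + 1) * Real.log n * B n + B n * Real.log n ^ 5) +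
      n * (uniformSegments (B n) n).real {τ | Unbalanced (B n) n (extendSegments τ)} := by
  have hb : 0 < B n := by have := hA.2.1; omega
  have hb' : (0 : ℝ) < B n := by exact_mod_cast hb
  have hb1 : (1 : ℝ) ≤ B n := by exact_mod_cast hb
  have h32 : 0 < Real.log (3 / 2) := Real.log_pos (by norm_num)
  have hnb : 1 ≤ (n : ℝ) / B n := le_trans (by norm_num) (hA.four_le_div hA.2.2)
  have hn4 : (4 : ℝ) ≤ n := by exact_mod_cast hA.1
  have hlog : 0 < Real.log n := Real.log_pos (by linarith)
  set c : ℝ := 1 / Real.log (3 / 2) + 1 with hc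
  have hc0 : 0 ≤ c := by positivity
  refine expectedCost_le_add hb (by positivity) fun τ hτ => ?_
  obtain ⟨J, m, hJ, hm, hle⟩ := integral_cost_joinSegments_le hA hτ
  refine hle.trans ?_
  have hJ' : (J : ℝ) ≤ c * Real.log n := by
    exact (hJ hn).trans (mul_le_mul_of_nonneg_left (Real.log_le_self hlog.le) hc0)
  have hphase : ∀ j ∈ Finset.Icc 1 J, ∑ i ∈ Finset.range (B n), (expectedCost B (m j i) / B n + 1) ≤
      (if j = 1 then C * ((n : ℝ) / B n) ^ ε else 0) +
        (C * (n : ℝ) ^ (2 / 3 * ε) + B n) := by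
    intro j hj
    have hterm : ∀ i ∈ Finset.range (B n), expectedCost B (m j i) / B n + 1 ≤
        ((if j = 1 then C * ((n : ℝ) / B n) ^ ε else 0) + C * (n : ℝ) ^ (2 / 3 * ε)) / B n + 1 := by
      intro i hi
      obtain ⟨hmn, hsize⟩ := hm j hj i hi
      have h1 : expectedCost B (m j i) ≤ C * (((n : ℝ) / B n) ^ ((2 / 3 : ℝ) ^ (j - 1))) ^ ε :=
        (ih _ hmn).trans (by gcongr)
      have h2 : C * (((n : ℝ) / B n) ^ ((2 / 3 : ℝ) ^ (j - 1))) ^ ε ≤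
          (if j = 1 then C * ((n : ℝ) / B n) ^ ε else 0) + C * (n : ℝ) ^ (2 / 3 * ε) := by
        split_ifs with hj1
        · subst hj1
          simp only [Nat.sub_self, pow_zero, Real.rpow_one]
          have : 0 ≤ C * (n : ℝ) ^ (2 / 3 * ε) := by positivity
          linarith
        · rw [zero_add]
          gcongr
          rw [Real.rpow_mul (by positivity)]
          gcongr
          have hj2 : 1 ≤ j - 1 := by have := (Finset.mem_Icc.1 hj).1; omega
          have h3 : (2 / 3 : ℝ) ^ (j - 1) ≤ 2 / 3 := by
            simpa using pow_le_pow_of_le_one (by norm_num : (0 : ℝ) ≤ 2 / 3) (by norm_num) hj2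
          calc ((n : ℝ) / B n) ^ ((2 / 3 : ℝ) ^ (j - 1)) ≤ ((n : ℝ) / B n) ^ (2 / 3 : ℝ) :=
                Real.rpow_le_rpow_of_exponent_le hnb h3
            _ ≤ (n : ℝ) ^ (2 / 3 : ℝ) := by
                gcongr
                exact div_le_self (by positivity) hb1
      gcongr
      exact h1.trans h2
    refine (Finset.sum_le_sum hterm).trans (le_of_eq ?_)
    rw [Finset.sum_const, Finset.card_range, nsmul_eq_mul]
    field_simp
    ring
  have hsum : ∑ j ∈ Finset.Icc 1 J, ∑ i ∈ Finset.range (B n), (expectedCost B (m j i) / B n + 1) ≤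
      C * ((n : ℝ) / B n) ^ ε + J * (C * (n : ℝ) ^ (2 / 3 * ε) + B n) := by
    refine (Finset.sum_le_sum hphase).trans ?_
    rw [Finset.sum_add_distrib, Finset.sum_ite_eq', Finset.sum_const, Nat.card_Icc, nsmul_eq_mul,
      Nat.add_sub_cancel]
    gcongr
    split_ifs
    · exact le_rfl
    · positivity
  have hJsum : (J : ℝ) * (C * (n : ℝ) ^ (2 / 3 * ε) + B n) ≤
      c * Real.log n * (C * (n : ℝ) ^ (2 / 3 * ε) + B n) := by gcongr
  calc _ ≤ C * ((n : ℝ) / B n) ^ ε + c * Real.log n * (C * (n : ℝ) ^ (2 / 3 * ε) + B n) +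
        B n * Real.log n ^ 5 := by linarith
    _ = _ := by ring

/-- The expected cost is `O(n ^ ε)` for every `ε > 0`. The constant is at least the number of those
`n` for which the recursion is not yet effective, where the trivial bound `n` is used. -/
theorem exists_expectedCost_le
    (hB : (fun n : ℕ => (B n : ℝ)) =Θ[atTop] (fun n : ℕ => Real.log n)) {ε : ℝ} (hε : 0 < ε) :
    ∃ C : ℝ, 1 ≤ C ∧ ∀ n : ℕ, expectedCost B n ≤ C * (n : ℝ) ^ ε := by
  have hloglog : Tendsto (fun n : ℕ => Real.log (Real.log n)) atTop atTop :=
    Real.tendsto_log_atTop.comp tendsto_log_natCast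
  obtain ⟨N, hN⟩ := eventually_atTop.1 ((eventually_admissible hB).and
    ((hloglog.eventually_ge_atTop 1).and ((eventually_measureReal_unbalanced_le hB).and
      (eventually_recursion_small hB hε (1 / Real.log (3 / 2) + 1)))))
  refine ⟨N + 1, by simp, fun n => ?_⟩
  have hC1 : (1 : ℝ) ≤ N + 1 := by simp
  induction n using Nat.strong_induction_on with
  | _ n ih =>
  rcases Nat.eq_zero_or_pos n with rfl | hn0
  · refine (expectedCost_le B 0).trans ?_
    simp [Real.zero_rpow hε.ne']
  have hn1 : (1 : ℝ) ≤ n := by exact_mod_cast hn0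
  have hnε : 1 ≤ (n : ℝ) ^ ε := Real.one_le_rpow hn1 hε.le
  rcases lt_or_ge n N with hnN | hnN
  · refine (expectedCost_le B n).trans ?_
    have : (n : ℝ) ≤ N := by exact_mod_cast hnN.le
    nlinarith
  obtain ⟨hA, hll, hprob, h4, h5, h6⟩ := hN n hnN
  have hb : (0 : ℝ) < B n := hA.pos
  have hrec := expectedCost_le_of_forall_lt hA hll hε (by linarith : (0 : ℝ) ≤ N + 1) ih
  generalize (1 / Real.log (3 / 2) + 1) * Real.log n = J at *
  generalize ((N : ℝ) + 1) = C at *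
  have hfail : (n : ℝ) * (uniformSegments (B n) n).real
      {τ | Unbalanced (B n) n (extendSegments τ)} ≤ 1 := by
    calc _ ≤ (n : ℝ) * (1 / (n : ℝ) ^ 10) := by gcongr
      _ ≤ (n : ℝ) * (1 / (n : ℝ) ^ 1) := by
          gcongr
          norm_num
      _ = 1 := by field_simp
  have h7 : ((n : ℝ) / B n) ^ ε ≤ 1 / 4 * (n : ℝ) ^ ε := by
    rw [Real.div_rpow (by positivity) hb.le, div_le_iff₀ (by positivity)]
    nlinarith
  have h8 : J * (n : ℝ) ^ (2 / 3 * ε) ≤ 1 / 4 * (n : ℝ) ^ ε := by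
    calc J * (n : ℝ) ^ (2 / 3 * ε) ≤ 1 / 4 * (n : ℝ) ^ (ε / 3) * (n : ℝ) ^ (2 / 3 * ε) := by gcongr
      _ = 1 / 4 * (n : ℝ) ^ ε := by
          rw [mul_assoc, ← Real.rpow_add (by linarith)]; congr 2; ring
  have h9 : C * (((n : ℝ) / B n) ^ ε + J * (n : ℝ) ^ (2 / 3 * ε)) ≤
      C * (1 / 4 * (n : ℝ) ^ ε + 1 / 4 * (n : ℝ) ^ ε) := by gcongr
  nlinarith

end Recursion

/-! ### The competitive ratio -/

/-- The expected competitive ratio of the algorithm on `n` uniformly random items. -/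
noncomputable def expectedRatio (B : ℕ → ℕ) (n : ℕ) : ℝ :=
  ∫ x, competitiveRatio (algAdapt B n) x ∂uniformInput n

theorem expectedRatio_le (B : ℕ → ℕ) (n : ℕ) : expectedRatio B n ≤ n := by
  unfold expectedRatio
  calc _ ≤ ∫ _x : Fin n → ℝ, (n : ℝ) ∂uniformInput n := by
        refine integral_mono_ae (integrable_competitiveRatio B n) (integrable_const _) ?_
        filter_upwards [ae_mem_cube n] with x hx
        exact ((validStrategy_algAdapt B n).validOn hx).competitiveRatio_le
    _ = n := by simp

theorem measureReal_uniformInput_forall_mem (n : ℕ) (s : Set ℝ) :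
    (uniformInput n).real {x | ∀ i, x i ∈ s} =
      (volume.restrict (Set.Icc (0 : ℝ) 1)).real s ^ n := by
  have : {x : Fin n → ℝ | ∀ i, x i ∈ s} = Set.univ.pi fun _ => s := by ext x; simp
  rw [this, Measure.real, uniformInput, Measure.pi_pi, Finset.prod_const, ENNReal.toReal_pow]
  simp [Measure.real]

/-- If the optimal cost is less than `1 / 2`, then all items lie in `[0, 3 / 4]` or all of them lie
in `[1 / 4, 1]`. -/
theorem measureReal_offlineCost_lt_half_le (n : ℕ) :
    (uniformInput n).real {x | offlineCost x < 1 / 2} ≤ 2 * (3 / 4) ^ n := by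
  have hlow : (volume.restrict (Set.Icc (0 : ℝ) 1)).real (Set.Icc 0 (3 / 4)) = 3 / 4 := by
    rw [measureReal_restrict_apply measurableSet_Icc, Set.inter_eq_left.2
      (Set.Icc_subset_Icc le_rfl (by norm_num)), Real.volume_real_Icc]
    norm_num
  have hhigh : (volume.restrict (Set.Icc (0 : ℝ) 1)).real (Set.Icc (1 / 4) 1) = 3 / 4 := by
    rw [measureReal_restrict_apply measurableSet_Icc, Set.inter_eq_left.2
      (Set.Icc_subset_Icc (by norm_num) le_rfl), Real.volume_real_Icc]
    norm_num
  set low : Set (Fin n → ℝ) := {x | ∀ i, x i ∈ Set.Icc (0 : ℝ) (3 / 4)} with hlow'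
  set high : Set (Fin n → ℝ) := {x | ∀ i, x i ∈ Set.Icc (1 / 4 : ℝ) 1} with hhigh'
  calc (uniformInput n).real {x | offlineCost x < 1 / 2} ≤ (uniformInput n).real (low ∪ high) := by
        refine ENNReal.toReal_mono (measure_ne_top _ _) (measure_mono_ae ?_)
        filter_upwards [ae_mem_cube n] with x hx hopt
        by_contra hnot
        obtain ⟨h1, h2⟩ := not_or.1 hnot
        obtain ⟨i, hi⟩ := not_forall.1 h1
        obtain ⟨j, hj⟩ := not_forall.1 h2
        have hi' : 3 / 4 < x i := lt_of_not_ge fun h => hi ⟨(hx i).1, h⟩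
        have hj' : x j < 1 / 4 := lt_of_not_ge fun h => hj ⟨h, (hx j).2⟩
        have h3 := (le_abs_self _).trans (abs_sub_le_offlineCost x i j)
        have h4 : offlineCost x < 1 / 2 := hopt
        linarith
    _ ≤ (uniformInput n).real low + (uniformInput n).real high := measureReal_union_le _ _
    _ = 2 * (3 / 4) ^ n := by
        rw [hlow', hhigh', measureReal_uniformInput_forall_mem,
          measureReal_uniformInput_forall_mem, hlow, hhigh]
        ring

theorem nat_mul_three_fourths_pow_le (n : ℕ) : (n : ℝ) * (3 / 4) ^ n ≤ 3 := by
  have h1 := one_add_mul_le_pow (show (-2 : ℝ) ≤ 1 / 3 by norm_num) n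
  have h2 : (1 + 1 / 3 : ℝ) ^ n * (3 / 4) ^ n = 1 := by rw [← mul_pow]; norm_num
  have h3 : (0 : ℝ) < (3 / 4) ^ n := by positivity
  nlinarith

/-- The optimal cost is at least `1 / 2` except with exponentially small probability, and the
competitive ratio never exceeds `n`. -/
theorem expectedRatio_le_two_mul_add (B : ℕ → ℕ) (n : ℕ) :
    expectedRatio B n ≤ 2 * expectedCost B n + 6 := by
  have hm : MeasurableSet {x : Fin n → ℝ | offlineCost x < 1 / 2} :=
    measurableSet_lt measurable_offlineCost measurable_const
  have hint : Integrable (fun x : Fin n → ℝ => n * Set.indicator {x | offlineCost x < 1 / 2}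
      (fun _ => (1 : ℝ)) x) (uniformInput n) :=
    ((integrable_const _).indicator hm).const_mul _
  have hcost := (integrable_cost B n).const_mul 2
  calc expectedRatio B n ≤ ∫ x : Fin n → ℝ, (2 * cost (algAdapt B n) x + n * Set.indicator
        {x | offlineCost x < 1 / 2} (fun _ => (1 : ℝ)) x) ∂uniformInput n := by
        refine integral_mono_ae (integrable_competitiveRatio B n) (hcost.add hint) ?_
        filter_upwards [ae_mem_cube n] with x hx
        have h0 := cost_nonneg (algAdapt B n) x
        by_cases h : offlineCost x < 1 / 2
        · simp only [Set.indicator_apply, Set.mem_ofPred_eq, h, if_true]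
          have := ((validStrategy_algAdapt B n).validOn hx).competitiveRatio_le
          linarith
        · simp only [Set.indicator_apply, Set.mem_ofPred_eq, h, if_false, mul_zero, add_zero]
          have h' : 1 / 2 ≤ offlineCost x := not_lt.1 h
          rw [competitiveRatio, div_le_iff₀ (by linarith)]
          nlinarith
    _ = 2 * expectedCost B n + n * (uniformInput n).real {x | offlineCost x < 1 / 2} := by
        rw [integral_add hcost hint, integral_const_mul, integral_const_mul,
          integral_indicator_const _ hm, expectedCost]
        simp
    _ ≤ 2 * expectedCost B n + n * (2 * (3 / 4) ^ n) := by
        gcongr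
        exact measureReal_offlineCost_lt_half_le n
    _ ≤ 2 * expectedCost B n + 6 := by
        have := nat_mul_three_fourths_pow_le n
        linarith

/-- A sequence that is `O(n ^ ε)` for every `ε > 0` is `n ^ o(1)`. -/
theorem exists_exponent {g : ℕ → ℝ} (hg : ∀ n : ℕ, g n ≤ n)
    (h : ∀ ε : ℝ, 0 < ε → ∃ C : ℝ, ∀ n : ℕ, 1 ≤ n → g n ≤ C * (n : ℝ) ^ ε) :
    ∃ e : ℕ → ℝ, Tendsto e atTop (𝓝 0) ∧ ∀ n : ℕ, g n ≤ (n : ℝ) ^ e n := by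
  -- For `n ≤ 1` the exponent is `0` since `log n = 0`, and `g n ≤ n ≤ 1` suffices.
  refine ⟨fun n => Real.log (max 1 (g n)) / Real.log n, ?_, fun n => ?_⟩
  · have hlog : Tendsto (fun n : ℕ => Real.log n) atTop atTop := tendsto_log_natCast
    refine Metric.tendsto_atTop'.2 fun ε hε => ?_
    obtain ⟨C, hC⟩ := h (ε / 2) (by positivity)
    obtain ⟨N, hN⟩ := eventually_atTop.1
      ((hlog.eventually_gt_atTop (Real.log (max 1 C) / (ε / 2))).and (eventually_ge_atTop 2))
    refine ⟨N, fun n hn => ?_⟩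
    obtain ⟨h1, h2⟩ := hN n hn.le
    have hn1 : (1 : ℝ) < n := by exact_mod_cast h2
    have hl : 0 < Real.log n := Real.log_pos hn1
    have h3 : 0 ≤ Real.log (max 1 (g n)) := Real.log_nonneg (le_max_left _ _)
    have h4 : max 1 (g n) ≤ max 1 C * (n : ℝ) ^ (ε / 2) := by
      have h5 : 1 ≤ (n : ℝ) ^ (ε / 2) := Real.one_le_rpow hn1.le (by positivity)
      refine max_le ?_ ((hC n (by omega)).trans ?_)
      · nlinarith [le_max_left 1 C]
      · gcongr
        exact le_max_right _ _
    have h6 : Real.log (max 1 (g n)) ≤ Real.log (max 1 C) + ε / 2 * Real.log n := by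
      refine (Real.log_le_log (by positivity) h4).trans_eq ?_
      rw [Real.log_mul (by positivity) (by positivity), Real.log_rpow (by linarith)]
    rw [Real.dist_0_eq_abs, abs_of_nonneg (by positivity), div_lt_iff₀ hl]
    rw [div_lt_iff₀ (by positivity)] at h1
    linarith
  · rcases le_or_gt n 1 with hn | hn
    · interval_cases n
      · exact (hg 0).trans (by simp)
      · exact (hg 1).trans (by simp)
    · have hn1 : (1 : ℝ) < n := by exact_mod_cast hn
      have hl : 0 < Real.log n := Real.log_pos hn1
      rw [Real.rpow_def_of_pos (by linarith), mul_div_cancel₀ _ hl.ne',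
        Real.exp_log (by positivity)]
      exact le_max_right _ _

end OnlineSorting


theorem mainTheorem4 (B : ℕ → ℕ)
    (hB : (fun n : ℕ => (B n : ℝ)) =Θ[atTop] (fun n : ℕ => Real.log n)) :
    -- the algorithm always places the arriving item into an empty cell
    (∀ (n : ℕ) (x : Fin n → ℝ), (∀ i, x i ∈ Set.Icc (0 : ℝ) 1) →
      OnlineSorting.ValidOn (OnlineSorting.algAdapt B n) x) ∧
    -- the expected cost and the expected competitive ratio are `n ^ o(1)`
    (∃ e : ℕ → ℝ, Tendsto e atTop (𝓝 0) ∧ ∀ n : ℕ,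
      (Integrable (fun x => OnlineSorting.cost (OnlineSorting.algAdapt B n) x)
          (OnlineSorting.uniformInput n) ∧
        ∫ x, OnlineSorting.cost (OnlineSorting.algAdapt B n) x ∂OnlineSorting.uniformInput n
          ≤ (n : ℝ) ^ e n) ∧
      (Integrable (fun x => OnlineSorting.competitiveRatio (OnlineSorting.algAdapt B n) x)
          (OnlineSorting.uniformInput n) ∧
        ∫ x, OnlineSorting.competitiveRatio (OnlineSorting.algAdapt B n) x
            ∂OnlineSorting.uniformInput n ≤ (n : ℝ) ^ e n)) ∧
    -- the failure probability is `O(1 / n ^ 10)`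
    ((fun n : ℕ => (OnlineSorting.uniformInput n).real
        {x : Fin n → ℝ | OnlineSorting.Fails B x}) =O[atTop] fun n : ℕ => 1 / (n : ℝ) ^ 10) ∧
    -- unless the algorithm fails, the buffer sizes shrink, over `O(log log n)` phases
    (∃ C : ℝ, ∀ᶠ n : ℕ in atTop, ∀ x : Fin n → ℝ, (∀ i, x i ∈ Set.Icc (0 : ℝ) 1) →
      ¬ OnlineSorting.Fails B x →
        (∀ j, 1 ≤ j → j ≤ OnlineSorting.numPhases B x → ∀ i < B n,
          (OnlineSorting.bufferSize B x i j : ℝ) ≤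
            ((n : ℝ) / B n) ^ ((2 / 3 : ℝ) ^ (j - 1))) ∧
        (OnlineSorting.numPhases B x : ℝ) ≤ C * Real.log (Real.log n)) := by
  have hmeas := OnlineSorting.eventually_measureReal_unbalanced_le hB
  have hadm := OnlineSorting.eventually_admissible hB
  refine ⟨fun n x hx => (OnlineSorting.validStrategy_algAdapt B n).validOn hx, ?_, ?_,
    1 / Real.log (3 / 2) + 1, ?_⟩
  · obtain ⟨e, he, hle⟩ := OnlineSorting.exists_exponent
      (g := fun n => max (OnlineSorting.expectedCost B n) (OnlineSorting.expectedRatio B n))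
      (fun n => max_le (OnlineSorting.expectedCost_le B n) (OnlineSorting.expectedRatio_le B n))
      fun ε hε => by
        obtain ⟨C, hC, h⟩ := OnlineSorting.exists_expectedCost_le hB hε
        refine ⟨2 * C + 6, fun n hn => ?_⟩
        have hn1 : 1 ≤ (n : ℝ) ^ ε := Real.one_le_rpow (by exact_mod_cast hn) hε.le
        have h1 := h n
        have h2 := OnlineSorting.expectedRatio_le_two_mul_add B n
        refine max_le ?_ ?_ <;> nlinarith
    exact ⟨e, he, fun n => ⟨⟨OnlineSorting.integrable_cost B n, (le_max_left _ _).trans (hle n)⟩,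
      OnlineSorting.integrable_competitiveRatio B n, (le_max_right _ _).trans (hle n)⟩⟩
  · refine IsBigO.of_bound 1 ?_
    filter_upwards [hadm, hmeas] with n hA hn
    have hb : 0 < B n := by have := hA.2.1; omega
    rw [Real.norm_of_nonneg measureReal_nonneg, Real.norm_of_nonneg (by positivity), one_mul]
    exact (OnlineSorting.measureReal_fails_le hb).trans hn
  · filter_upwards [hadm, (Real.tendsto_log_atTop.comp
      OnlineSorting.tendsto_log_natCast).eventually_ge_atTop 1] with n hA hn x hx hF
    obtain ⟨I, p, hL, hP⟩ := OnlineSorting.exists_layout_of_not_fails hA hx hF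
    exact ⟨fun j hj1 hj2 i hi => hL.size_le j i ⟨hj1, hj2, hi⟩, hP.phase_le hA hn⟩
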